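/- **Model.** An asset has value $\tilde v=\pm\sigma_v$ with probability $\tfrac12$ each. A mass $\mu>0$ of informed speculators receive signals $s_i=\tilde v+e_i$, with $e_i$ i.i.d. $N(0,\sigma_e^2)$; $\phi,\Phi$ denote the standard normal density and distribution function, and $B(s)=\Pr(\tilde v=\sigma_v\mid s)=\frac{\phi((s-\sigma_v)/\sigma_e)}{\phi((s-\sigma_v)/\sigma_e)+\phi((s+\sigma_v)/\sigma_e)}$. Liquidity buyers and sellers have masses $Z^+,Z^-\ge 0$, which are continuously distributed (atomless) with mean $\tfrac12\mu_z$ and exchangeable ($(Z^+,Z^-)$ and $(Z^-,Z^+)$ have the same law, e.g. i.i.d.). A liquidity trader has a delay cost $\sigma_v d$ per unit, where $d\in[0,\bar d]$, $1\le\bar d<\infty$, has distribution function $G\in C^2([0,\bar d])$ with $G(0)=0$, $G(x)>0$ for $x>0$, and $G'(x)+xG''(x)\ge 0$ on $[0,1]$. Each trader has one unit and may trade in an exchange at half-spread $A$, or at price $0$ in a dark pool whose expected execution rates are $\underline R$ for orders in the right direction (buy if $\tilde v=\sigma_v$, sell if $\tilde v=-\sigma_v$) and $\bar R$ for orders in the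 wrong one; informed speculators may also not trade, and liquidity traders may delay. If $q$ is the probability, given the signal, that the chosen direction is right ($q=B(s)$ for buying, $q=1-B(s)$ for selling), an informed speculator gets, per unit, $(2q-1)\sigma_v-A$ in the exchange, $q\underline R\sigma_v-(1-q)\bar R\sigma_v$ in the dark pool, and $0$ from not trading. A liquidity trader gets $-A$ in the exchange, $-\frac{\bar R-\underline R}{2}\sigma_v-\bigl(1-\frac{\bar R+\underline R}{2}\bigr)\sigma_v d$ in the dark pool, and $-\sigma_v d$ from delaying. **Equilibrium.** An equilibrium consists of (measurable) strategies $h_I(s)$ and $h_{U,\iota}(d)$, $\iota\in\{\text{Buyer},\text{Seller}\}$, numbers $A,\bar R,\underline R$, and fractions $\overline{\gamma_e},\underline{\gamma_e}$ (resp. $\overline{\gamma_d},\underline{\gamma_d}$) of informed speculators trading in the right and wrong direction in the exchange (resp. dark pool) and $\alpha_e,\alpha_d$ of liquidity traders in the two venues, such that (i) given $A,\bar R,\underline R$, the strategies are optimal for every $s$ and $d$, also against orders split between venues; (ii) the market maker breaks even on average, $0=\mathbb E\{\sigma_v[(\underline{\gamma_e}-\overline{\gamma_e})\mu+\alpha_e(Z^--Z^+)]+A[(\overline{\gamma_e}+\underline{\gamma_e})\mu+\alpha_e(Z^++Z^-)]\}$;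 (iii) $\bar R,\underline R$ are the expected execution rates under rationing (the shorter side is executed fully, the longer side proportionally), that is, the formulas for $\bar R,\underline R$ displayed below, where an order on an empty side facing a non-empty one is executed with probability $1$; (iv) the fractions are those generated by the strategies, in both states and on both sides of the liquidity traders. Quantities that (ii) or (iii) leave undetermined because a venue is empty are given by limits along cut-off strategies, whose participation fractions are those displayed below: if nobody trades in the exchange, $A$ is the limit, as $s_1\to\infty$, of the spread formula below; if nobody trades in the dark pool and almost all traders follow the cut-off strategies below with $s_0=s_1=s\ge 0$, then $\bar R,\underline R$ are the limits of the rates for the cut-offs $(s,s+\epsilon)$ as $\epsilon\to0^+$. **Theorem (Equilibrium with a dark pool).** For all $\sigma_v,\sigma_e>0$ there is an equilibrium in cut-off strategies: there are $0<s_0<s_1$ such that $$B(s_0)(\bar R+\underline R)=\bar R,\qquad B(s_1)\bigl[(1-\bar R)+(1-\underline R)\bigr]\sigma_v=A+(1-\bar R)\sigma_v,$$ informed speculators buy in the exchange if $s\ge s_1$, buy in the dark pool if $s_0\le s<s_1$, sell in the dark pool if $-s_1\le s<-s_0$, sell in the exchange if $s<-s_1$, and otherwise do not trade; liquidity traders trade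 in the exchange if $d\ge 2B(s_1)-1$, in the dark pool if $2B(s_0)-1\le d<2B(s_1)-1$, and otherwise delay. Moreover $$A=\frac{\overline{\gamma_e}-\underline{\gamma_e}}{\overline{\gamma_e}+\underline{\gamma_e}+\alpha_e\mu_z/\mu}\,\sigma_v,\quad \bar R=\mathbb E\min\Bigl\{1,\frac{\overline{\gamma_d}\mu+\alpha_dZ^+}{\underline{\gamma_d}\mu+\alpha_dZ^-}\Bigr\},\quad \underline R=\mathbb E\min\Bigl\{1,\frac{\underline{\gamma_d}\mu+\alpha_dZ^-}{\overline{\gamma_d}\mu+\alpha_dZ^+}\Bigr\},$$ $$\overline{\gamma_e}=1-\Phi\bigl(\tfrac{s_1-\sigma_v}{\sigma_e}\bigr),\quad \underline{\gamma_e}=1-\Phi\bigl(\tfrac{s_1+\sigma_v}{\sigma_e}\bigr),\quad \overline{\gamma_d}=\Phi\bigl(\tfrac{s_1-\sigma_v}{\sigma_e}\bigr)-\Phi\bigl(\tfrac{s_0-\sigma_v}{\sigma_e}\bigr),\quad \underline{\gamma_d}=\Phi\bigl(\tfrac{s_1+\sigma_v}{\sigma_e}\bigr)-\Phi\bigl(\tfrac{s_0+\sigma_v}{\sigma_e}\bigr),$$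 $$\alpha_e=1-G(2B(s_1)-1),\qquad \alpha_d=G(2B(s_1)-1)-G(2B(s_0)-1).$$ Conversely, every equilibrium is of this form for some $0<s_0<s_1$ (up to the choice of the indifferent traders with $s\in\{\pm s_0,\pm s_1\}$ or $d\in\{2B(s_0)-1,2B(s_1)-1\}$), and every equilibrium is non-trivial: $\overline{\gamma_e},\underline{\gamma_e},\overline{\gamma_d},\underline{\gamma_d},\alpha_e,\alpha_d>0$. -/

import Mathlib

open MeasureTheory ProbabilityTheory Filter Topology Set

noncomputable section

namespace DarkPool

/-! ### Primitives of the model -/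

/-- The data of the market other than the two standard deviations: the mass `mu` of informed
speculators, the random masses `Zp` of liquidity buyers and `Zm` of liquidity sellers (random
variables on `(Ω, P)`) with mean `muZ / 2`, the largest delay cost `dBar` and the law `nu` of the
delay cost of a liquidity trader. -/
structure Market (Ω : Type*) [MeasurableSpace Ω] where
  P : Measure Ω
  Zp : Ω → ℝ
  Zm : Ω → ℝ
  mu : ℝ
  muZ : ℝ
  dBar : ℝ
  nu : Measure ℝ

variable {Ω : Type*} [MeasurableSpace Ω]

/-- The cumulative distribution function of the delay cost. -/
def Market.G (M : Market Ω) : ℝ → ℝ := fun x => cdf M.nu x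

/-- The standing assumptions on the primitives. -/
structure Market.Admissible (M : Market Ω) : Prop where
  mu_pos : 0 < M.mu
  prob_P : IsProbabilityMeasure M.P
  measurable_Zp : Measurable M.Zp
  measurable_Zm : Measurable M.Zm
  Zp_nonneg : ∀ᵐ ω ∂M.P, 0 ≤ M.Zp ω
  Zm_nonneg : ∀ᵐ ω ∂M.P, 0 ≤ M.Zm ω
  /-- the masses of buyers and sellers are continuously distributed -/
  Zp_atomless : ∀ x : ℝ, M.P {ω | M.Zp ω = x} = 0
  Zm_atomless : ∀ x : ℝ, M.P {ω | M.Zm ω = x} = 0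
  Zp_integrable : Integrable M.Zp M.P
  Zm_integrable : Integrable M.Zm M.P
  Zp_mean : ∫ ω, M.Zp ω ∂M.P = M.muZ / 2
  Zm_mean : ∫ ω, M.Zm ω ∂M.P = M.muZ / 2
  /-- `(Zp, Zm)` and `(Zm, Zp)` have the same law; this holds when `Zp`, `Zm` are i.i.d. -/
  exchangeable : IdentDistrib (fun ω => (M.Zp ω, M.Zm ω)) (fun ω => (M.Zm ω, M.Zp ω)) M.P M.P
  one_le_dBar : 1 ≤ M.dBar
  prob_nu : IsProbabilityMeasure M.nu
  /-- the delay cost takes values in `[0, dBar]` -/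
  nu_support : M.nu (Icc 0 M.dBar)ᶜ = 0
  G_contDiff : ContDiffOn ℝ 2 M.G (Icc 0 M.dBar)
  /-- the delay cost has no atom at `0` ... -/
  G_zero : M.G 0 = 0
  /-- ... and `0` belongs to its support -/
  G_pos : ∀ x : ℝ, 0 < x → 0 < M.G x
  /-- `G'(x) + x G''(x) ≥ 0` on `[0, 1]` -/
  G_shape : ∀ x ∈ Icc (0 : ℝ) 1, 0 ≤ derivWithin M.G (Icc 0 M.dBar) x
    + x * iteratedDerivWithin 2 M.G (Icc 0 M.dBar) x

/-- Density of the standard normal distribution. -/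
def phi (x : ℝ) : ℝ := gaussianPDFReal 0 1 x

/-- Distribution function of the standard normal distribution. -/
def Phi (x : ℝ) : ℝ := cdf (gaussianReal 0 1) x

/-- Conditional law of the signal `s = v + e` given the asset value `v`, where `e` is normal with
mean `0` and standard deviation `σe`. -/
def signalLaw (σe v : ℝ) : Measure ℝ := gaussianReal v (Real.toNNReal (σe ^ 2))

/-- Posterior probability of the high asset value `σv` given the signal `s`. -/
def belief (σv σe s : ℝ) : ℝ :=
  phi ((s - σv) / σe) / (phi ((s - σv) / σe) + phi ((s + σv) / σe))

/-! ### Actions and payoffs -/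

inductive Direction
  | buy
  | sell

inductive Venue
  | exchange
  | darkPool

/-- Actions of an informed speculator. -/
inductive InformedAction
  | trade (dir : Direction) (ven : Venue)
  | noTrade

/-- Actions of a liquidity trader (buyers buy and sellers sell). -/
inductive LiquidityAction
  | trade (ven : Venue)
  | delay

inductive Side
  | buyer
  | seller

/-- A candidate equilibrium: strategies, spread, execution rates and participation fractions.
`Rwrong`, `Rright` are the expected dark pool execution rates (`R̄` and `R̲`) of orders in the wrong
and in the right direction; `gammaE...`, `gammaD...` are the fractions of informed speculators who
trade in the right / wrong direction in the exchange and in the dark pool; `alphaE`, `alphaD` are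
the fractions of liquidity traders in the exchange and in the dark pool in period 1. -/
structure Candidate where
  hI : ℝ → InformedAction
  hU : Side → ℝ → LiquidityAction
  A : ℝ
  Rwrong : ℝ
  Rright : ℝ
  gammaEright : ℝ
  gammaEwrong : ℝ
  gammaDright : ℝ
  gammaDwrong : ℝ
  alphaE : ℝ
  alphaD : ℝ

/-- Probability, given the signal `s`, that trading in the given direction is right. -/
def probRight (σv σe : ℝ) (dir : Direction) (s : ℝ) : ℝ :=
  match dir with
  | .buy => belief σv σe s
  | .sell => 1 - belief σv σe s

/-- Expected per unit profit of an informed speculator with signal `s`. -/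
def informedUnitPayoff (σv σe : ℝ) (E : Candidate) (dir : Direction) (s : ℝ) : Venue → ℝ
  | .exchange => probRight σv σe dir s * σv - (1 - probRight σv σe dir s) * σv - E.A
  | .darkPool =>
      probRight σv σe dir s * E.Rright * σv - (1 - probRight σv σe dir s) * E.Rwrong * σv

def informedPayoff (σv σe : ℝ) (E : Candidate) (s : ℝ) : InformedAction → ℝ
  | .trade dir ven => informedUnitPayoff σv σe E dir s ven
  | .noTrade => 0

/-- Per unit payoff of a liquidity trader with delay cost `d`. -/
def liquidityPayoff (σv : ℝ) (E : Candidate) (d : ℝ) : LiquidityAction → ℝ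
  | .trade .exchange => -E.A
  | .trade .darkPool =>
      -((E.Rwrong - E.Rright) / 2) * σv - (1 - (E.Rwrong + E.Rright) / 2) * σv * d
  | .delay => -(σv * d)

/-- The action prescribed to each informed speculator is at least as good as every feasible order:
a direction and quantities `qe`, `qd` sent to the two venues, of at most one unit in total. -/
def InformedOptimal (σv σe : ℝ) (E : Candidate) : Prop :=
  ∀ (s : ℝ) (dir : Direction) (qe qd : ℝ), 0 ≤ qe → 0 ≤ qd → qe + qd ≤ 1 →
    qe * informedUnitPayoff σv σe E dir s .exchange + qd * informedUnitPayoff σv σe E dir s .darkPool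
      ≤ informedPayoff σv σe E s (E.hI s)

/-- The same for the liquidity traders, who delay the part of their unit which they do not send to
a venue in period 1. -/
def LiquidityOptimal (M : Market Ω) (σv : ℝ) (E : Candidate) : Prop :=
  ∀ (side : Side), ∀ d ∈ Icc (0 : ℝ) M.dBar, ∀ (qe qd : ℝ), 0 ≤ qe → 0 ≤ qd → qe + qd ≤ 1 →
    qe * liquidityPayoff σv E d (.trade .exchange) + qd * liquidityPayoff σv E d (.trade .darkPool)
        + (1 - qe - qd) * liquidityPayoff σv E d .delay
      ≤ liquidityPayoff σv E d (E.hU side d)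

/-! ### Cut-off strategies and the aggregates they generate -/

open Classical in
def informedCutoff (s0 s1 : ℝ) (s : ℝ) : InformedAction :=
  if s1 ≤ s then .trade .buy .exchange
  else if s0 ≤ s ∧ s < s1 then .trade .buy .darkPool
  else if -s1 ≤ s ∧ s < -s0 then .trade .sell .darkPool
  else if s < -s1 then .trade .sell .exchange
  else .noTrade

/-- The delay cost at which the liquidity traders switch when the informed ones switch at `s`. -/
def delayCutoff (σv σe s : ℝ) : ℝ := 2 * belief σv σe s - 1

open Classical in
def liquidityCutoff (σv σe s0 s1 : ℝ) (d : ℝ) : LiquidityAction :=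
  if delayCutoff σv σe s1 ≤ d then .trade .exchange
  else if delayCutoff σv σe s0 ≤ d ∧ d < delayCutoff σv σe s1 then .trade .darkPool
  else .delay

def cutGammaEright (σv σe s1 : ℝ) : ℝ := 1 - Phi ((s1 - σv) / σe)

def cutGammaEwrong (σv σe s1 : ℝ) : ℝ := 1 - Phi ((s1 + σv) / σe)

def cutGammaDright (σv σe s0 s1 : ℝ) : ℝ := Phi ((s1 - σv) / σe) - Phi ((s0 - σv) / σe)

def cutGammaDwrong (σv σe s0 s1 : ℝ) : ℝ := Phi ((s1 + σv) / σe) - Phi ((s0 + σv) / σe)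

def cutAlphaE (M : Market Ω) (σv σe s1 : ℝ) : ℝ := 1 - M.G (delayCutoff σv σe s1)

def cutAlphaD (M : Market Ω) (σv σe s0 s1 : ℝ) : ℝ :=
  M.G (delayCutoff σv σe s1) - M.G (delayCutoff σv σe s0)

/-! ### The two venues -/

/-- Profit of the market maker when the asset value is `σv` (the case `-σv` is symmetric). -/
def marketMakerPayoff (M : Market Ω) (σv : ℝ) (E : Candidate) (ω : Ω) : ℝ :=
  σv * ((E.gammaEwrong * M.mu - E.gammaEright * M.mu)
      + (E.alphaE * M.Zm ω - E.alphaE * M.Zp ω))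
    + E.A * (E.gammaEright * M.mu + E.gammaEwrong * M.mu
      + E.alphaE * M.Zp ω + E.alphaE * M.Zm ω)

/-- The spread as a function of the participation in the exchange. -/
def spread (M : Market Ω) (σv gR gW a : ℝ) : ℝ := (gR - gW) / (gR + gW + a * (M.muZ / M.mu)) * σv

/-- The market maker breaks even on average. If nobody trades in the exchange then every spread
does so, and the spread is taken to be its limit along cut-off strategies whose exchange cut-off
tends to infinity. -/
def BreakEven (M : Market Ω) (σv σe : ℝ) (E : Candidate) : Prop :=
  ∫ ω, marketMakerPayoff M σv E ω ∂M.P = 0 ∧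
  (E.gammaEright = 0 ∧ E.gammaEwrong = 0 ∧ E.alphaE = 0 →
    Tendsto (fun s1 => spread M σv (cutGammaEright σv σe s1) (cutGammaEwrong σv σe s1)
      (cutAlphaE M σv σe s1)) atTop (𝓝 E.A))

open Classical in
/-- Rationing: fraction executed on a side of the pool with volume `own` when the other side has
volume `opp`. It is `min {1, opp / own}` if `own > 0`, and `1` on an empty side. -/
def fillRate (own opp : ℝ) : ℝ := if own ≤ opp then 1 else opp / own

/-- Expected execution rate of orders in the wrong direction, with dark pool participation `gR`,
`gW` of the informed and `a` of the liquidity traders (asset value `σv`, so that the wrong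
direction is to sell). -/
def rateWrong (M : Market Ω) (gR gW a : ℝ) : ℝ :=
  ∫ ω, fillRate (gW * M.mu + a * M.Zm ω) (gR * M.mu + a * M.Zp ω) ∂M.P

/-- Expected execution rate of orders in the right direction. -/
def rateRight (M : Market Ω) (gR gW a : ℝ) : ℝ :=
  ∫ ω, fillRate (gR * M.mu + a * M.Zp ω) (gW * M.mu + a * M.Zm ω) ∂M.P

def EmptyPool (E : Candidate) : Prop :=
  E.gammaDright = 0 ∧ E.gammaDwrong = 0 ∧ E.alphaD = 0

/-- All traders, up to a null set, follow the strategies with cut-offs `s0`, `s1`. -/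
def AECutoff (M : Market Ω) (σv σe : ℝ) (E : Candidate) (s0 s1 : ℝ) : Prop :=
  (∀ᵐ s ∂(volume : Measure ℝ), E.hI s = informedCutoff s0 s1 s) ∧
  ∀ side : Side, ∀ᵐ d ∂M.nu, E.hU side d = liquidityCutoff σv σe s0 s1 d

/-- `Rwrong` and `Rright` are the expected execution rates. In an empty pool these are the
undefined `0 / 0`; if traders then follow cut-off strategies with `s0 = s1 = s`, the rates are their
limits along the cut-offs `s`, `s + ε` as `ε → 0+`. -/
def RatesConsistent (M : Market Ω) (σv σe : ℝ) (E : Candidate) : Prop :=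
  (¬ EmptyPool E →
    E.Rwrong = rateWrong M E.gammaDright E.gammaDwrong E.alphaD ∧
    E.Rright = rateRight M E.gammaDright E.gammaDwrong E.alphaD) ∧
  (EmptyPool E → ∀ s : ℝ, 0 ≤ s → AECutoff M σv σe E s s →
    Tendsto (fun ε => rateWrong M (cutGammaDright σv σe s (s + ε))
      (cutGammaDwrong σv σe s (s + ε)) (cutAlphaD M σv σe s (s + ε))) (𝓝[>] 0) (𝓝 E.Rwrong) ∧
    Tendsto (fun ε => rateRight M (cutGammaDright σv σe s (s + ε))
      (cutGammaDwrong σv σe s (s + ε)) (cutAlphaD M σv σe s (s + ε))) (𝓝[>] 0) (𝓝 E.Rright))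

/-- The numbers in the candidate are the participation fractions generated by its strategies, in
either state of the asset and on either side of the liquidity traders. -/
structure FractionsConsistent (M : Market Ω) (σv σe : ℝ) (E : Candidate) : Prop where
  measurable_hI : ∀ a : InformedAction, MeasurableSet {s | E.hI s = a}
  measurable_hU : ∀ (side : Side) (a : LiquidityAction), MeasurableSet {d | E.hU side d = a}
  eright_high : (signalLaw σe σv).real {s | E.hI s = .trade .buy .exchange} = E.gammaEright
  eright_low : (signalLaw σe (-σv)).real {s | E.hI s = .trade .sell .exchange} = E.gammaEright
  ewrong_high : (signalLaw σe σv).real {s | E.hI s = .trade .sell .exchange} = E.gammaEwrong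
  ewrong_low : (signalLaw σe (-σv)).real {s | E.hI s = .trade .buy .exchange} = E.gammaEwrong
  dright_high : (signalLaw σe σv).real {s | E.hI s = .trade .buy .darkPool} = E.gammaDright
  dright_low : (signalLaw σe (-σv)).real {s | E.hI s = .trade .sell .darkPool} = E.gammaDright
  dwrong_high : (signalLaw σe σv).real {s | E.hI s = .trade .sell .darkPool} = E.gammaDwrong
  dwrong_low : (signalLaw σe (-σv)).real {s | E.hI s = .trade .buy .darkPool} = E.gammaDwrong
  alphaE_eq : ∀ side : Side, M.nu.real {d | E.hU side d = .trade .exchange} = E.alphaE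
  alphaD_eq : ∀ side : Side, M.nu.real {d | E.hU side d = .trade .darkPool} = E.alphaD

/-! ### Equilibrium -/

structure IsEquilibrium (M : Market Ω) (σv σe : ℝ) (E : Candidate) : Prop where
  informed_optimal : InformedOptimal σv σe E
  liquidity_optimal : LiquidityOptimal M σv E
  break_even : BreakEven M σv σe E
  rates : RatesConsistent M σv σe E
  fractions : FractionsConsistent M σv σe E

/-- `s0`, `s1` solve the indifference equations, `0 < s0 < s1`, and the spread, the execution rates
and the participation fractions are given by the cut-off formulas. -/
structure CutoffSystem (M : Market Ω) (σv σe : ℝ) (E : Candidate) (s0 s1 : ℝ) : Prop where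
  s0_pos : 0 < s0
  s0_lt_s1 : s0 < s1
  indifference0 : belief σv σe s0 * (E.Rwrong + E.Rright) = E.Rwrong
  indifference1 : belief σv σe s1 * ((1 - E.Rwrong) + (1 - E.Rright)) * σv
    = E.A + (1 - E.Rwrong) * σv
  spread_eq : E.A = (E.gammaEright - E.gammaEwrong)
    / (E.gammaEright + E.gammaEwrong + E.alphaE * (M.muZ / M.mu)) * σv
  rateWrong_eq : E.Rwrong = ∫ ω, min 1 ((E.gammaDright * M.mu + E.alphaD * M.Zp ω)
    / (E.gammaDwrong * M.mu + E.alphaD * M.Zm ω)) ∂M.P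
  rateRight_eq : E.Rright = ∫ ω, min 1 ((E.gammaDwrong * M.mu + E.alphaD * M.Zm ω)
    / (E.gammaDright * M.mu + E.alphaD * M.Zp ω)) ∂M.P
  gammaEright_eq : E.gammaEright = 1 - Phi ((s1 - σv) / σe)
  gammaEwrong_eq : E.gammaEwrong = 1 - Phi ((s1 + σv) / σe)
  gammaDright_eq : E.gammaDright = Phi ((s1 - σv) / σe) - Phi ((s0 - σv) / σe)
  gammaDwrong_eq : E.gammaDwrong = Phi ((s1 + σv) / σe) - Phi ((s0 + σv) / σe)
  alphaE_eq : E.alphaE = 1 - M.G (2 * belief σv σe s1 - 1)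
  alphaD_eq : E.alphaD = M.G (2 * belief σv σe s1 - 1) - M.G (2 * belief σv σe s0 - 1)

/-- The strategies are the cut-off strategies, except possibly at the indifferent signals and delay
costs, where the choice between the two optimal actions is arbitrary. -/
def FollowsCutoffs (M : Market Ω) (σv σe : ℝ) (E : Candidate) (s0 s1 : ℝ) : Prop :=
  (∀ s : ℝ, |s| ≠ s0 → |s| ≠ s1 → E.hI s = informedCutoff s0 s1 s) ∧
  ∀ side : Side, ∀ d ∈ Icc (0 : ℝ) M.dBar,
    d ≠ delayCutoff σv σe s0 → d ≠ delayCutoff σv σe s1 →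
      E.hU side d = liquidityCutoff σv σe s0 s1 d

/-- Positive participation of informed (in the right and in the wrong direction) and of liquidity
traders in both venues. -/
def NonTrivial (E : Candidate) : Prop :=
  0 < E.gammaEright ∧ 0 < E.gammaEwrong ∧ 0 < E.gammaDright ∧ 0 < E.gammaDwrong ∧
    0 < E.alphaE ∧ 0 < E.alphaD

end DarkPool

end

noncomputable section

namespace DarkPool

variable {Ω : Type*} [MeasurableSpace Ω]

/-! ### A planar intermediate value theorem -/

/-! Write x(s) = 2B(s) - 1 (`delayCutoff`), S = (R̄ + R̲)/2 and D = (R̄ - R̲)/2. In the better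
direction an informed speculator compares σv·x(|s|) - A, σv·(S·x(|s|) - D) and 0. After adding σv·d
to each payoff, a liquidity trader compares the same three affine functions at d. If 0 < S < 1, both
types therefore switch at x0 = D/S and x1 = (A/σv - D)/(1 - S), provided x0 < x1. What remains is a
system of two equations in (s0, s1), because A, R̄, R̲ are themselves functions of the cut-offs.

Existence. Execution rates depend only on ratios of volumes, so participation between the cut-offs s
and t may be divided by t - s. The resulting mean densities extend the rates continuously to the
diagonal s = t, and the Poincaré–Miranda theorem applies to the region 0 ≤ s ≤ t, ε ≤ t ≤ L. The
equation for s0 has opposite signs at s = 0, where adverse selection makes the pool lose, and at s =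
t. On the diagonal the likelihood ratio of the signal exactly offsets the imbalance of the informed
orders, and exchangeable liquidity orders tip the payoff to strictly positive (`mul_rateWrong_lt`,
`darkPool_payoff_self_pos`). The equation for s1 has opposite signs at t = ε, where the spread
exceeds x, and at t = L. For the latter the spread must vanish as t grows (`tendsto_cutSpread`):
Gaussian tails are thinner than 1 - x, while the shape condition on G gives 1 - G(x) ≥ c(1 - x) near
1. In addition `exists_cutRight_le` keeps S away from 1 when s is small.

Converse. Buyers in a venue have nonnegative signals, so informed participation there is either null
or larger in the right direction. Hence A > 0 unless the informed shun the exchange, and R̲ < R̄ if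
they use the pool. Each degenerate case leaves traders with a strict deviation. In an empty pool the
limit rates are the diagonal ones, so traders near the cut-off would enter. In a pool without
informed traders D = 0, so weak positive signals would enter. At A = 0 the exchange dominates the
pool. Once both venues are active, 0 < x0 < x1 < 1, and strict comparison of the affine payoffs
determines the strategies off the cut-offs. -/

/-- Along a path on which `sin (θ + c)` does not vanish the angle `θ` varies by less than `π`. -/
theorem abs_angle_sub_lt_pi {θ : ℝ → ℝ} (hθ : Continuous θ) (c : ℝ)
    (h : ∀ t ∈ Icc (0 : ℝ) 1, Real.sin (θ t + c) ≠ 0) : |θ 1 - θ 0| < Real.pi := by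
  by_contra hcon
  push Not at hcon
  have key : ∀ y ∈ uIcc (θ 0) (θ 1), Real.sin (y + c) ≠ 0 := by
    intro y hy
    obtain ⟨t, ht, rfl⟩ := intermediate_value_uIcc (a := (0 : ℝ)) (b := 1) hθ.continuousOn hy
    rw [uIcc_of_le zero_le_one] at ht
    exact h t ht
  have hpi := Real.pi_pos
  set m := min (θ 0) (θ 1) with hm
  have hmax : m + Real.pi ≤ max (θ 0) (θ 1) := by
    have := max_sub_min_eq_abs (θ 0) (θ 1)
    linarith
  -- The least multiple of π at or above m + c lies within π of it, so an interval of length π must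
  -- meet a zero of the shifted sine.
  set n : ℤ := ⌈(m + c) / Real.pi⌉ with hn
  have h1 : (m + c) ≤ n * Real.pi := by
    have := Int.le_ceil ((m + c) / Real.pi)
    rwa [div_le_iff₀ hpi] at this
  have h2 : n * Real.pi < m + c + Real.pi := by
    have := Int.ceil_lt_add_one ((m + c) / Real.pi)
    have h3 := mul_lt_mul_of_pos_right this hpi
    rw [add_mul, div_mul_cancel₀ _ hpi.ne'] at h3
    linarith
  refine key (n * Real.pi - c) ?_ ?_
  · rw [uIcc, mem_Icc]
    exact ⟨by change m ≤ _; linarith, le_trans (by linarith) hmax⟩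
  · rw [sub_add_cancel]
    exact Real.sin_int_mul_pi n

/-- Variation below π lets the sign of the sine decide whether the angle has increased. This is
applied to each edge of the square. -/
theorem angle_lt_of_sin_sub_pos {x y : ℝ} (h : |y - x| < Real.pi) (hs : 0 < Real.sin (y - x)) :
    x < y := by
  by_contra hcon
  push Not at hcon
  have := Real.sin_nonpos_of_nonpos_of_neg_pi_le (x := y - x) (by linarith)
    (by linarith [(abs_lt.1 h).1])
  linarith

/-- The Poincaré–Miranda theorem in the plane. -/
theorem poincare_miranda {f g : ℝ × ℝ → ℝ}
    (hf : ContinuousOn f (Icc 0 1 ×ˢ Icc 0 1)) (hg : ContinuousOn g (Icc 0 1 ×ˢ Icc 0 1))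
    (hf0 : ∀ y ∈ Icc (0 : ℝ) 1, f (0, y) < 0) (hf1 : ∀ y ∈ Icc (0 : ℝ) 1, 0 < f (1, y))
    (hg0 : ∀ x ∈ Icc (0 : ℝ) 1, g (x, 0) < 0) (hg1 : ∀ x ∈ Icc (0 : ℝ) 1, 0 < g (x, 1)) :
    ∃ p ∈ Icc (0 : ℝ) 1 ×ˢ Icc (0 : ℝ) 1, f p = 0 ∧ g p = 0 := by
  by_contra hcon
  push Not at hcon
  let cl : ℝ → ℝ := fun x => max 0 (min 1 x)
  have hcl : Continuous cl := by fun_prop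
  have hclm : ∀ x, cl x ∈ Icc (0 : ℝ) 1 := fun x =>
    ⟨le_max_left _ _, max_le zero_le_one (min_le_left _ _)⟩
  have hcli : ∀ x ∈ Icc (0 : ℝ) 1, cl x = x := fun x hx => by
    simp only [cl, min_eq_right hx.2, max_eq_right hx.1]
  have hcc : Continuous fun p : ℝ × ℝ => (cl p.1, cl p.2) := by fun_prop
  have hcm : ∀ p : ℝ × ℝ, (cl p.1, cl p.2) ∈ Icc (0 : ℝ) 1 ×ˢ Icc (0 : ℝ) 1 := fun p =>
    ⟨hclm _, hclm _⟩
  have hfc : Continuous fun p : ℝ × ℝ => f (cl p.1, cl p.2) :=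
    hf.comp_continuous hcc hcm
  have hgc : Continuous fun p : ℝ × ℝ => g (cl p.1, cl p.2) :=
    hg.comp_continuous hcc hcm
  -- Clamping the coordinates extends f + ig to the whole plane without zeros. The plane is simply
  -- connected, so the map lifts through the exponential.
  let F : C(ℝ × ℝ, ℂ) := ⟨fun p => (⟨f (cl p.1, cl p.2), g (cl p.1, cl p.2)⟩ : ℂ), by
    have : (fun p : ℝ × ℝ => (⟨f (cl p.1, cl p.2), g (cl p.1, cl p.2)⟩ : ℂ))
        = fun p : ℝ × ℝ => (f (cl p.1, cl p.2) : ℂ) + (g (cl p.1, cl p.2) : ℂ) * Complex.I := by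
      funext p
      exact Complex.mk_eq_add_mul_I _ _
    rw [this]
    exact (Complex.continuous_ofReal.comp hfc).add
      ((Complex.continuous_ofReal.comp hgc).mul continuous_const)⟩
  have hF0 : ∀ p, F p ∈ ({0}ᶜ : Set ℂ) := by
    intro p hp
    have h1 : F p = 0 := hp
    have hre := congrArg Complex.re h1
    have him := congrArg Complex.im h1
    exact hcon _ (hcm p) hre him
  -- L is a continuous logarithm of F, and its imaginary part is a continuous angle.
  obtain ⟨L, ⟨-, hL⟩, -⟩ := Complex.isCoveringMapOn_exp.existsUnique_continuousMap_lifts F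
    (a₀ := (0, 0)) (e₀ := Complex.log (F (0, 0))) (Complex.exp_log (hF0 _)) hF0
  have hexp : ∀ p, Complex.exp (L p) = F p := fun p => congrFun hL p
  have hre : ∀ p, Real.exp (L p).re * Real.cos (L p).im = f (cl p.1, cl p.2) := fun p => by
    rw [← Complex.exp_re, hexp]; rfl
  have him : ∀ p, Real.exp (L p).re * Real.sin (L p).im = g (cl p.1, cl p.2) := fun p => by
    rw [← Complex.exp_im, hexp]; rfl
  have hθ : Continuous fun p => (L p).im := Complex.continuous_im.comp L.continuous
  have cos_pos : ∀ x ∈ Icc (0 : ℝ) 1, ∀ y ∈ Icc (0 : ℝ) 1, 0 < f (x, y) →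
      0 < Real.cos (L (x, y)).im := fun x hx y hy h => by
    have := hre (x, y)
    rw [hcli x hx, hcli y hy] at this
    exact pos_of_mul_pos_right (this ▸ h) (Real.exp_pos _).le
  have cos_neg : ∀ x ∈ Icc (0 : ℝ) 1, ∀ y ∈ Icc (0 : ℝ) 1, f (x, y) < 0 →
      Real.cos (L (x, y)).im < 0 := fun x hx y hy h => by
    have := hre (x, y)
    rw [hcli x hx, hcli y hy] at this
    exact neg_of_mul_neg_right (this ▸ h) (Real.exp_pos _).le
  have sin_pos : ∀ x ∈ Icc (0 : ℝ) 1, ∀ y ∈ Icc (0 : ℝ) 1, 0 < g (x, y) →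
      0 < Real.sin (L (x, y)).im := fun x hx y hy h => by
    have := him (x, y)
    rw [hcli x hx, hcli y hy] at this
    exact pos_of_mul_pos_right (this ▸ h) (Real.exp_pos _).le
  have sin_neg : ∀ x ∈ Icc (0 : ℝ) 1, ∀ y ∈ Icc (0 : ℝ) 1, g (x, y) < 0 →
      Real.sin (L (x, y)).im < 0 := fun x hx y hy h => by
    have := him (x, y)
    rw [hcli x hx, hcli y hy] at this
    exact neg_of_mul_neg_right (this ▸ h) (Real.exp_pos _).le
  have m0 : (0 : ℝ) ∈ Icc (0 : ℝ) 1 := ⟨le_rfl, zero_le_one⟩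
  have m1 : (1 : ℝ) ∈ Icc (0 : ℝ) 1 := ⟨zero_le_one, le_rfl⟩
  have c00 := cos_neg 0 m0 0 m0 (hf0 0 m0)
  have c01 := cos_neg 0 m0 1 m1 (hf0 1 m1)
  have c10 := cos_pos 1 m1 0 m0 (hf1 0 m0)
  have c11 := cos_pos 1 m1 1 m1 (hf1 1 m1)
  have s00 := sin_neg 0 m0 0 m0 (hg0 0 m0)
  have s10 := sin_neg 1 m1 0 m0 (hg0 1 m1)
  have s01 := sin_pos 0 m0 1 m1 (hg1 0 m0)
  have s11 := sin_pos 1 m1 1 m1 (hg1 1 m1)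
  have e1 := abs_angle_sub_lt_pi (θ := fun x => (L (x, 0)).im) (by fun_prop) 0 fun x hx => by
    simpa using (sin_neg x hx 0 m0 (hg0 x hx)).ne
  have e2 := abs_angle_sub_lt_pi (θ := fun y => (L (1, y)).im) (by fun_prop) (Real.pi / 2)
    fun y hy => by
      simpa [Real.sin_add_pi_div_two] using (cos_pos 1 m1 y hy (hf1 y hy)).ne'
  have e3 := abs_angle_sub_lt_pi (θ := fun x => (L (x, 1)).im) (by fun_prop) 0 fun x hx => by
    simpa using (sin_pos x hx 1 m1 (hg1 x hx)).ne'
  have e4 := abs_angle_sub_lt_pi (θ := fun y => (L (0, y)).im) (by fun_prop) (Real.pi / 2)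
    fun y hy => by
      simpa [Real.sin_add_pi_div_two] using (cos_neg 0 m0 y hy (hf0 y hy)).ne
  -- The corners lie in successive quadrants, so the angle strictly increases along each edge
  -- traversed counterclockwise. Returning to the starting corner is then a contradiction.
  have l1 := angle_lt_of_sin_sub_pos e1 (by rw [Real.sin_sub]; nlinarith)
  have l2 := angle_lt_of_sin_sub_pos e2 (by rw [Real.sin_sub]; nlinarith)
  have l3 := angle_lt_of_sin_sub_pos (by rw [abs_sub_comm]; exact e3)
    (by rw [Real.sin_sub]; nlinarith)
  have l4 := angle_lt_of_sin_sub_pos (by rw [abs_sub_comm]; exact e4)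
    (by rw [Real.sin_sub]; nlinarith)
  linarith


section

/-! ### Signals and beliefs -/

/-- Density of the signal given the asset value `v`. -/
def density (σe v s : ℝ) : ℝ := gaussianPDFReal v (Real.toNNReal (σe ^ 2)) s

variable {σv σe : ℝ}

theorem variance_ne_zero (hσe : 0 < σe) : Real.toNNReal (σe ^ 2) ≠ 0 := by
  simpa using hσe.ne'

theorem density_pos (hσe : 0 < σe) (v s : ℝ) : 0 < density σe v s :=
  gaussianPDFReal_pos _ _ _ (variance_ne_zero hσe)

theorem continuous_density (σe v : ℝ) : Continuous (density σe v) := by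
  unfold density gaussianPDFReal
  fun_prop

theorem density_eq (hσe : 0 < σe) (v s : ℝ) :
    density σe v s = (√(2 * Real.pi * σe ^ 2))⁻¹ * Real.exp (-(s - v) ^ 2 / (2 * σe ^ 2)) := by
  unfold density gaussianPDFReal
  rw [Real.coe_toNNReal _ (by positivity)]

theorem phi_eq_mul_density (hσe : 0 < σe) (v s : ℝ) :
    phi ((s - v) / σe) = σe * density σe v s := by
  rw [density_eq hσe, phi, gaussianPDFReal]
  have h1 : √(2 * Real.pi * σe ^ 2) = √(2 * Real.pi) * σe := by
    rw [Real.sqrt_mul (by positivity), Real.sqrt_sq hσe.le]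
  have h2 : -((s - v) / σe - 0) ^ 2 / (2 * ((1 : NNReal) : ℝ))
      = -(s - v) ^ 2 / (2 * σe ^ 2) := by
    push_cast
    field_simp
    ring
  rw [h1, h2]
  have : √(2 * Real.pi) ≠ 0 := by positivity
  push_cast
  field_simp

/-- The rate of decay of the likelihood ratio of the two asset values. -/
def decay (σv σe : ℝ) : ℝ := 2 * σv / σe ^ 2

theorem decay_pos (hσv : 0 < σv) (hσe : 0 < σe) : 0 < decay σv σe := by
  unfold decay; positivity

/-- The quadratic terms of the two Gaussian exponents agree, so the likelihood ratio is exponential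
in the signal. -/
theorem density_neg_eq (hσe : 0 < σe) (s : ℝ) :
    density σe (-σv) s = density σe σv s * Real.exp (-(decay σv σe * s)) := by
  rw [density_eq hσe, density_eq hσe, mul_assoc _ _ (Real.exp _), ← Real.exp_add]
  congr 2
  unfold decay
  field_simp
  ring

theorem belief_eq (hσe : 0 < σe) (s : ℝ) :
    belief σv σe s = 1 / (1 + Real.exp (-(decay σv σe * s))) := by
  have h : phi ((s + σv) / σe) = σe * density σe (-σv) s := by
    rw [← phi_eq_mul_density hσe, sub_neg_eq_add]
  have hd := density_pos hσe σv s
  rw [belief, h, phi_eq_mul_density hσe, density_neg_eq hσe]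
  have := Real.exp_pos (-(decay σv σe * s))
  field_simp

theorem delayCutoff_eq (hσe : 0 < σe) (s : ℝ) : delayCutoff σv σe s
    = (1 - Real.exp (-(decay σv σe * s))) / (1 + Real.exp (-(decay σv σe * s))) := by
  rw [delayCutoff, belief_eq hσe]
  have := Real.exp_pos (-(decay σv σe * s))
  field_simp
  ring

/-- Bayes' rule with equal priors: (1 - x)/(1 + x) is the likelihood ratio of the low to the high
value. On the diagonal s = t it turns a comparison of volumes into one of payoffs. -/
theorem delayCutoff_mul_density (hσe : 0 < σe) (s : ℝ) :
    (1 - delayCutoff σv σe s) * density σe σv s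
      = (1 + delayCutoff σv σe s) * density σe (-σv) s := by
  rw [delayCutoff_eq hσe, density_neg_eq hσe]
  have := Real.exp_pos (-(decay σv σe * s))
  field_simp
  ring

theorem one_sub_delayCutoff (hσe : 0 < σe) (s : ℝ) : 1 - delayCutoff σv σe s
    = 2 * Real.exp (-(decay σv σe * s)) / (1 + Real.exp (-(decay σv σe * s))) := by
  rw [delayCutoff_eq hσe]
  have := Real.exp_pos (-(decay σv σe * s))
  field_simp
  ring

theorem delayCutoff_lt_one (hσe : 0 < σe) (s : ℝ) : delayCutoff σv σe s < 1 := by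
  have h := one_sub_delayCutoff (σv := σv) hσe s
  have : 0 < 1 - delayCutoff σv σe s := by rw [h]; positivity
  linarith

theorem delayCutoff_neg (hσe : 0 < σe) (s : ℝ) :
    delayCutoff σv σe (-s) = -delayCutoff σv σe s := by
  rw [delayCutoff_eq hσe, delayCutoff_eq hσe]
  have h1 := Real.exp_pos (-(decay σv σe * s))
  have h2 := Real.exp_pos (-(decay σv σe * -s))
  have h3 : Real.exp (-(decay σv σe * s)) * Real.exp (-(decay σv σe * -s)) = 1 := by
    rw [← Real.exp_add, ← Real.exp_zero]; congr 1; ring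
  rw [← neg_div, div_eq_div_iff (by positivity) (by positivity)]
  linarith

theorem neg_one_lt_delayCutoff (hσe : 0 < σe) (s : ℝ) : -1 < delayCutoff σv σe s := by
  have := delayCutoff_lt_one (σv := σv) hσe (-s)
  rw [delayCutoff_neg hσe] at this
  linarith

@[simp] theorem delayCutoff_zero (hσe : 0 < σe) : delayCutoff σv σe 0 = 0 := by
  rw [delayCutoff_eq hσe]; simp

theorem strictMono_delayCutoff (hσv : 0 < σv) (hσe : 0 < σe) :
    StrictMono (delayCutoff σv σe) := by
  intro s t hst
  rw [delayCutoff_eq hσe, delayCutoff_eq hσe, div_lt_div_iff₀ (by positivity) (by positivity)]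
  have h : Real.exp (-(decay σv σe * t)) < Real.exp (-(decay σv σe * s)) := by
    apply Real.exp_lt_exp.2
    have := mul_lt_mul_of_pos_left hst (decay_pos hσv hσe)
    linarith
  nlinarith

theorem delayCutoff_pos (hσv : 0 < σv) (hσe : 0 < σe) {s : ℝ} (hs : 0 < s) :
    0 < delayCutoff σv σe s := by
  have := strictMono_delayCutoff hσv hσe hs
  rwa [delayCutoff_zero hσe] at this

theorem delayCutoff_nonneg (hσv : 0 < σv) (hσe : 0 < σe) {s : ℝ} (hs : 0 ≤ s) :
    0 ≤ delayCutoff σv σe s := by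
  have := (strictMono_delayCutoff hσv hσe).monotone hs
  rwa [delayCutoff_zero hσe] at this

theorem abs_delayCutoff (hσv : 0 < σv) (hσe : 0 < σe) (s : ℝ) :
    |delayCutoff σv σe s| = delayCutoff σv σe |s| := by
  rcases le_total 0 s with h | h
  · rw [abs_of_nonneg h, abs_of_nonneg (delayCutoff_nonneg hσv hσe h)]
  · rw [abs_of_nonpos h, delayCutoff_neg hσe, abs_of_nonpos]
    have := delayCutoff_nonneg hσv hσe (neg_nonneg.2 h)
    rw [delayCutoff_neg hσe] at this
    linarith

/-- Every number in `(-1, 1)` is the delay cost corresponding to some signal. -/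
theorem exists_delayCutoff_eq (hσv : 0 < σv) (hσe : 0 < σe) {x : ℝ} (h1 : -1 < x) (h2 : x < 1) :
    ∃ s, delayCutoff σv σe s = x := by
  -- The cut-off is tanh(decay·s/2), and this is its inverse.
  refine ⟨-Real.log ((1 - x) / (1 + x)) / decay σv σe, ?_⟩
  have hd := decay_pos hσv hσe
  rw [delayCutoff_eq hσe, mul_div_cancel₀ _ hd.ne', neg_neg,
    Real.exp_log (div_pos (by linarith) (by linarith))]
  have : 1 + x ≠ 0 := by linarith
  field_simp
  ring

/-- Derivative of `delayCutoff`. -/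
def delayCutoffDeriv (σv σe s : ℝ) : ℝ :=
  2 * decay σv σe * Real.exp (-(decay σv σe * s)) / (1 + Real.exp (-(decay σv σe * s))) ^ 2

theorem hasDerivAt_delayCutoff (hσe : 0 < σe) (s : ℝ) :
    HasDerivAt (delayCutoff σv σe) (delayCutoffDeriv σv σe s) s := by
  have he : HasDerivAt (fun s => Real.exp (-(decay σv σe * s)))
      (Real.exp (-(decay σv σe * s)) * (-(decay σv σe))) s := by
    have := ((hasDerivAt_id s).const_mul (decay σv σe)).fun_neg.exp
    simpa using this
  have h : HasDerivAt (fun s => (1 - Real.exp (-(decay σv σe * s)))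
      / (1 + Real.exp (-(decay σv σe * s)))) _ s :=
    (he.const_sub 1).div (he.const_add 1) (by positivity)
  have hfun : delayCutoff σv σe = fun s => (1 - Real.exp (-(decay σv σe * s)))
      / (1 + Real.exp (-(decay σv σe * s))) := funext fun s => delayCutoff_eq hσe s
  rw [hfun]
  refine h.congr_deriv ?_
  unfold delayCutoffDeriv
  congr 1
  ring

theorem delayCutoffDeriv_pos (hσv : 0 < σv) (hσe : 0 < σe) (s : ℝ) :
    0 < delayCutoffDeriv σv σe s := by
  have := decay_pos hσv hσe
  unfold delayCutoffDeriv
  positivity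

theorem continuous_delayCutoffDeriv (σv σe : ℝ) : Continuous (delayCutoffDeriv σv σe) := by
  unfold delayCutoffDeriv
  refine Continuous.div (by fun_prop) (by fun_prop) fun s => ?_
  positivity

theorem continuous_delayCutoff (hσe : 0 < σe) : Continuous (delayCutoff σv σe) :=
  continuous_iff_continuousAt.2 fun s => (hasDerivAt_delayCutoff hσe s).continuousAt

/-- With e the exponential, 1 - x = 2e/(1 + e) and e ≤ 1. This will bound from below the liquidity
left in the exchange at high cut-offs. -/
theorem exp_le_one_sub_delayCutoff (hσv : 0 < σv) (hσe : 0 < σe) {s : ℝ} (hs : 0 ≤ s) :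
    Real.exp (-(decay σv σe * s)) ≤ 1 - delayCutoff σv σe s := by
  rw [one_sub_delayCutoff hσe, le_div_iff₀ (by positivity)]
  have h1 : Real.exp (-(decay σv σe * s)) ≤ 1 := by
    rw [Real.exp_le_one_iff]
    have := mul_nonneg (decay_pos hσv hσe).le hs
    linarith
  have := Real.exp_pos (-(decay σv σe * s))
  nlinarith

/-! ### Laws of the signal -/

instance (σe v : ℝ) : IsProbabilityMeasure (signalLaw σe v) := by
  unfold signalLaw; infer_instance

theorem signalLaw_eq_zero_iff (hσe : 0 < σe) (v : ℝ) (B : Set ℝ) :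
    signalLaw σe v B = 0 ↔ volume B = 0 :=
  ⟨fun h => gaussianReal_absolutelyContinuous' v (variance_ne_zero hσe) h,
    fun h => gaussianReal_absolutelyContinuous v (variance_ne_zero hσe) h⟩

theorem signalLaw_real_eq_zero_iff (hσe : 0 < σe) (v : ℝ) (B : Set ℝ) :
    (signalLaw σe v).real B = 0 ↔ volume B = 0 := by
  rw [← signalLaw_eq_zero_iff hσe v, measureReal_eq_zero_iff]

theorem signalLaw_real_congr (hσe : 0 < σe) (v : ℝ) {B C : Set ℝ}
    (h : B =ᵐ[(volume : Measure ℝ)] C) : (signalLaw σe v).real B = (signalLaw σe v).real C :=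
  measureReal_congr ((gaussianReal_absolutelyContinuous v (variance_ne_zero hσe)).ae_le h)

theorem integrable_density (σe v : ℝ) : Integrable (density σe v) :=
  integrable_gaussianPDFReal v _

theorem signalLaw_real_eq_integral (hσe : 0 < σe) (v : ℝ) (B : Set ℝ) :
    (signalLaw σe v).real B = ∫ s in B, density σe v s := by
  rw [measureReal_def, signalLaw, gaussianReal_apply_eq_integral v (variance_ne_zero hσe),
    ENNReal.toReal_ofReal]
  · rfl
  · exact integral_nonneg fun s => (gaussianPDFReal_nonneg _ _ _)

theorem signalLaw_real_Iic (hσe : 0 < σe) (v s : ℝ) :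
    (signalLaw σe v).real (Iic s) = Phi ((s - v) / σe) := by
  have h1 : signalLaw σe v = (gaussianReal 0 1).map (fun x => σe * x + v) := by
    have h2 : (fun x : ℝ => σe * x + v) = (fun x => x + v) ∘ (fun x => σe * x) := rfl
    rw [h2, ← Measure.map_map (by fun_prop) (by fun_prop), gaussianReal_map_const_mul,
      gaussianReal_map_add_const, signalLaw]
    congr 1
    · ring
    · rw [mul_one]
      exact Real.toNNReal_of_nonneg (by positivity)
  rw [h1, map_measureReal_apply (by fun_prop) measurableSet_Iic, Phi, cdf_eq_real]
  congr 1
  ext x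
  simp only [mem_preimage, mem_Iic]
  rw [le_div_iff₀ hσe]
  constructor <;> intro h <;> linarith

theorem signalLaw_real_Iio (hσe : 0 < σe) (v s : ℝ) :
    (signalLaw σe v).real (Iio s) = Phi ((s - v) / σe) := by
  rw [← signalLaw_real_Iic hσe, signalLaw_real_congr hσe v Iio_ae_eq_Iic]

theorem signalLaw_real_Ici (hσe : 0 < σe) (v s : ℝ) :
    (signalLaw σe v).real (Ici s) = 1 - Phi ((s - v) / σe) := by
  rw [← signalLaw_real_Iio hσe, ← compl_Iio, probReal_compl_eq_one_sub measurableSet_Iio]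

theorem signalLaw_real_Ico (hσe : 0 < σe) (v : ℝ) {s t : ℝ} (hst : s ≤ t) :
    (signalLaw σe v).real (Ico s t) = Phi ((t - v) / σe) - Phi ((s - v) / σe) := by
  rw [← signalLaw_real_Iio hσe, ← signalLaw_real_Iio hσe,
    ← measureReal_sdiff (Iio_subset_Iio hst) measurableSet_Iio]
  congr 1
  ext x
  simp

/-- The two conditional laws of the signal are mirror images of each other. -/
theorem signalLaw_real_neg (σe v : ℝ) {B : Set ℝ} (hB : MeasurableSet B) :
    (signalLaw σe v).real (Neg.neg ⁻¹' B) = (signalLaw σe (-v)).real B := by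
  rw [signalLaw, signalLaw, ← gaussianReal_map_neg, map_measureReal_apply measurable_neg hB]

theorem density_neg_le (hσv : 0 < σv) (hσe : 0 < σe) {s : ℝ} (hs : 0 ≤ s) :
    density σe (-σv) s ≤ density σe σv s := by
  rw [density_neg_eq hσe]
  refine mul_le_of_le_one_right (density_pos hσe _ _).le ?_
  rw [Real.exp_le_one_iff]
  have := mul_nonneg (decay_pos hσv hσe).le hs
  linarith

theorem density_neg_lt (hσv : 0 < σv) (hσe : 0 < σe) {s : ℝ} (hs : 0 < s) :
    density σe (-σv) s < density σe σv s := by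
  rw [density_neg_eq hσe]
  refine mul_lt_of_lt_one_right (density_pos hσe _ _) ?_
  rw [Real.exp_lt_one_iff]
  have := mul_pos (decay_pos hσv hσe) hs
  linarith

/-- A set of positive signals is more likely under the high asset value. -/
theorem signalLaw_neg_lt (hσv : 0 < σv) (hσe : 0 < σe) {B : Set ℝ} (hB : MeasurableSet B)
    (hB0 : B ⊆ Ici 0) (hvol : volume B ≠ 0) :
    (signalLaw σe (-σv)).real B < (signalLaw σe σv).real B := by
  rw [signalLaw_real_eq_integral hσe, signalLaw_real_eq_integral hσe, ← sub_pos,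
    ← integral_sub (integrable_density _ _).integrableOn (integrable_density _ _).integrableOn]
  have hnn : 0 ≤ᵐ[volume.restrict B] fun s => density σe σv s - density σe (-σv) s :=
    (ae_restrict_iff' hB).2 (Eventually.of_forall fun s hs =>
      sub_nonneg.2 (density_neg_le hσv hσe (hB0 hs)))
  rw [integral_pos_iff_support_of_nonneg_ae hnn
    ((integrable_density _ _).sub (integrable_density _ _)).integrableOn]
  rw [Measure.restrict_apply' hB]
  refine lt_of_lt_of_le (pos_iff_ne_zero.2 ?_) (measure_mono (s := B \ {0}) ?_)
  · rwa [measure_sdiff_null Real.volume_singleton]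
  · rintro s ⟨hs, hs0⟩
    refine ⟨?_, hs⟩
    have := density_neg_lt hσv hσe (lt_of_le_of_ne (hB0 hs) (Ne.symm hs0))
    exact (sub_pos.2 this).ne'

theorem signalLaw_neg_le (hσv : 0 < σv) (hσe : 0 < σe) {B : Set ℝ} (hB : MeasurableSet B)
    (hB0 : B ⊆ Ici 0) : (signalLaw σe (-σv)).real B ≤ (signalLaw σe σv).real B := by
  by_cases hvol : volume B = 0
  · rw [(signalLaw_real_eq_zero_iff hσe _ _).2 hvol, (signalLaw_real_eq_zero_iff hσe _ _).2 hvol]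
  · exact (signalLaw_neg_lt hσv hσe hB hB0 hvol).le

theorem continuous_Phi : Continuous Phi := by
  have h : Phi = fun x => (signalLaw 1 0).real (Iic x) := by
    funext x
    rw [signalLaw_real_Iic one_pos]; simp
  have h2 : ∀ x, (signalLaw 1 0).real (Iic x) = ∫ s in Iic x, density 1 0 s := fun x =>
    signalLaw_real_eq_integral one_pos _ _
  have h3 : ∀ x, ∫ s in Iic x, density 1 0 s
      = (∫ s in Iic 0, density 1 0 s) + ∫ s in (0 : ℝ)..x, density 1 0 s := fun x => by
    rw [← intervalIntegral.integral_Iic_sub_Iic (integrable_density _ _).integrableOn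
      (integrable_density _ _).integrableOn, add_sub_cancel]
  have h4 : Phi = fun x => (∫ s in Iic 0, density 1 0 s) + ∫ s in (0 : ℝ)..x, density 1 0 s := by
    funext x
    rw [h]
    exact (h2 x).trans (h3 x)
  rw [h4]
  exact continuous_const.add (intervalIntegral.continuous_primitive
    (fun a b => (integrable_density 1 0).intervalIntegrable) 0)

/-! ### Mean densities between two cut-offs -/

/-- Mean value of the density of the signal on the interval between `s` and `t`. -/
def meanDensity (σe v s t : ℝ) : ℝ := ∫ u in (0 : ℝ)..1, density σe v (s + u * (t - s))

theorem meanDensity_pos (hσe : 0 < σe) (v s t : ℝ) : 0 < meanDensity σe v s t :=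
  intervalIntegral.intervalIntegral_pos_of_pos
    (((continuous_density σe v).comp (by fun_prop)).intervalIntegrable _ _)
    (fun _ => density_pos hσe _ _) one_pos

theorem continuous_meanDensity (σe v : ℝ) :
    Continuous fun p : ℝ × ℝ => meanDensity σe v p.1 p.2 := by
  unfold meanDensity
  apply intervalIntegral.continuous_parametric_intervalIntegral_of_continuous'
  exact (continuous_density σe v).comp (by fun_prop)

@[simp] theorem meanDensity_self (σe v s : ℝ) : meanDensity σe v s s = density σe v s := by
  simp [meanDensity]

/-- Substituting s + u(t - s) extracts the factor t - s. The remaining mean stays positive and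
continuous as t tends to s. -/
theorem mul_meanDensity (hσe : 0 < σe) (v : ℝ) {s t : ℝ} (hst : s ≤ t) :
    (t - s) * meanDensity σe v s t = Phi ((t - v) / σe) - Phi ((s - v) / σe) := by
  have h := intervalIntegral.smul_integral_comp_add_mul (a := 0) (b := 1) (density σe v) (t - s) s
  rw [← signalLaw_real_Ico hσe v hst, signalLaw_real_congr hσe v Ico_ae_eq_Ioc,
    signalLaw_real_eq_integral hσe, ← intervalIntegral.integral_of_le hst, meanDensity]
  simp only [smul_eq_mul, mul_zero, add_zero, mul_one, add_sub_cancel] at h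
  rw [← h]
  congr 2
  funext u
  congr 1
  ring

theorem meanDensity_neg_lt (hσv : 0 < σv) (hσe : 0 < σe) {s t : ℝ} (hs : 0 ≤ s) (ht : 0 < t) :
    meanDensity σe (-σv) s t < meanDensity σe σv s t := by
  refine intervalIntegral.integral_lt_integral_of_continuousOn_of_le_of_exists_lt one_pos
    ((continuous_density _ _).comp (by fun_prop)).continuousOn
    ((continuous_density _ _).comp (by fun_prop)).continuousOn
    -- When s = 0 the two densities agree at u = 0, so strictness is taken at u = 1, where the
    -- signal is t > 0.
    (fun u hu => density_neg_le hσv hσe ?_) ⟨1, ⟨zero_le_one, le_rfl⟩, density_neg_lt hσv hσe ?_⟩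
  · nlinarith [hu.1, hu.2, mul_nonneg hs (sub_nonneg.2 hu.2), mul_nonneg ht.le hu.1.le]
  · linarith

/-- The Chernoff bound for the upper tail of the signal. -/
theorem signalLaw_real_Ici_le (σe v c : ℝ) (hc : 0 ≤ c) : ∃ K : ℝ, ∀ s : ℝ,
    (signalLaw σe v).real (Ici s) ≤ K * Real.exp (-(c * s)) := by
  refine ⟨mgf id (signalLaw σe v) c, fun s => ?_⟩
  have := measure_ge_le_exp_mul_mgf (μ := signalLaw σe v) (X := id) s hc
    (by simpa [signalLaw] using integrable_exp_mul_gaussianReal c)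
  rw [mul_comm, ← neg_mul]
  exact this


end

section

/-! ### Execution rates -/

theorem integral_pos_of_ae_nonneg {α : Type*} [MeasurableSpace α] {μ : Measure α} {f : α → ℝ}
    (hf : ∀ᵐ x ∂μ, 0 ≤ f x) (hfi : Integrable f μ) {s : Set α} (hs : μ s ≠ 0)
    (hpos : ∀ᵐ x ∂μ, x ∈ s → 0 < f x) : 0 < ∫ x, f x ∂μ := by
  rw [integral_pos_iff_support_of_nonneg_ae hf hfi, pos_iff_ne_zero]
  intro h0
  refine hs (measure_mono_null_ae ?_ h0)
  filter_upwards [hpos] with x hx hxs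
  exact (hx hxs).ne'

theorem fillRate_nonneg {own opp : ℝ} (h1 : 0 ≤ own) (h2 : 0 ≤ opp) : 0 ≤ fillRate own opp := by
  unfold fillRate
  split_ifs
  · exact zero_le_one
  · positivity

theorem fillRate_le_one {own opp : ℝ} (h : 0 ≤ own) : fillRate own opp ≤ 1 := by
  unfold fillRate
  split_ifs with h1
  · exact le_rfl
  · exact div_le_one_of_le₀ (not_le.1 h1).le h

theorem fillRate_eq_one {own opp : ℝ} (h : own ≤ opp) : fillRate own opp = 1 := if_pos h

theorem fillRate_of_lt {own opp : ℝ} (h : opp < own) : fillRate own opp = opp / own :=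
  if_neg (not_le.2 h)

theorem fillRate_eq_min {own opp : ℝ} (h : 0 < own) : fillRate own opp = min 1 (opp / own) := by
  rcases le_or_gt own opp with h1 | h1
  · rw [fillRate_eq_one h1, min_eq_left ((one_le_div h).2 h1)]
  · rw [fillRate_of_lt h1, min_eq_right ((div_le_one h).2 h1.le)]

/-- Over the larger of the two volumes, the rates of both sides share one denominator. -/
theorem fillRate_eq_div_max {own opp : ℝ} (h1 : 0 < own) :
    fillRate own opp = opp / max own opp := by
  rcases le_or_gt own opp with h | h
  · rw [fillRate_eq_one h, max_eq_right h, div_self (h1.trans_le h).ne']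
  · rw [fillRate_of_lt h, max_eq_left h.le]

theorem fillRate_le_fillRate {own own' opp opp' : ℝ} (h0 : 0 ≤ opp') (h1 : own ≤ own')
    (h2 : opp' ≤ opp) (hown : 0 ≤ own') : fillRate own' opp' ≤ fillRate own opp := by
  rcases le_or_gt own opp with h | h
  · rw [fillRate_eq_one h]
    exact fillRate_le_one hown
  · have hpos : 0 < own := by linarith
    rw [fillRate_of_lt h, fillRate_of_lt (by linarith)]
    exact div_le_div₀ (h0.trans h2) h2 hpos h1

theorem fillRate_lt_fillRate {own own' opp opp' : ℝ} (h0 : 0 ≤ opp') (h1 : own < own')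
    (h2 : opp' < opp) (hown : 0 ≤ own) (h3 : opp' < own') :
    fillRate own' opp' < fillRate own opp := by
  rw [fillRate_of_lt h3]
  rcases le_or_gt own opp with h | h
  · rw [fillRate_eq_one h, div_lt_one (by linarith)]
    exact h3
  · rw [fillRate_of_lt h, div_lt_div_iff₀ (by linarith) (by linarith)]
    nlinarith

/-- The shorter side is always filled completely. This keeps S ≥ 1/2. -/
theorem one_le_fillRate_add (u v : ℝ) (hu : 0 ≤ u) (hv : 0 ≤ v) :
    1 ≤ fillRate u v + fillRate v u := by
  rcases le_total u v with h | h
  · rw [fillRate_eq_one h]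
    linarith [fillRate_nonneg hv hu]
  · rw [fillRate_eq_one h]
    linarith [fillRate_nonneg hu hv]

/-- Scale invariance is what permits replacing participation by mean densities. -/
theorem fillRate_mul {c : ℝ} (hc : 0 < c) (own opp : ℝ) :
    fillRate (c * own) (c * opp) = fillRate own opp := by
  simp only [fillRate, mul_le_mul_iff_right₀ hc, mul_div_mul_left _ _ hc.ne']

theorem measurable_fillRate : Measurable fun p : ℝ × ℝ => fillRate p.1 p.2 := by
  unfold fillRate
  exact Measurable.ite (measurableSet_le measurable_fst measurable_snd) measurable_const
    (measurable_snd.div measurable_fst)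

namespace Market.Admissible

variable {M : Market Ω}



theorem ae_pos_Zp (hM : M.Admissible) : ∀ᵐ ω ∂M.P, 0 < M.Zp ω := by
  have h0 : ∀ᵐ ω ∂M.P, M.Zp ω ≠ 0 := by
    rw [ae_iff]; simpa using hM.Zp_atomless 0
  filter_upwards [h0, hM.Zp_nonneg] with ω h1 h2
  exact lt_of_le_of_ne h2 h1.symm

theorem ae_pos_Zm (hM : M.Admissible) : ∀ᵐ ω ∂M.P, 0 < M.Zm ω := by
  have h0 : ∀ᵐ ω ∂M.P, M.Zm ω ≠ 0 := by
    rw [ae_iff]; simpa using hM.Zm_atomless 0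
  filter_upwards [h0, hM.Zm_nonneg] with ω h1 h2
  exact lt_of_le_of_ne h2 h1.symm

theorem muZ_pos (hM : M.Admissible) : 0 < M.muZ := by
  have := hM.prob_P
  have h : 0 < ∫ ω, M.Zp ω ∂M.P := integral_pos_of_ae_nonneg hM.Zp_nonneg hM.Zp_integrable
    (s := univ) (by simp) (hM.ae_pos_Zp.mono fun _ h _ => h)
  rw [hM.Zp_mean] at h
  linarith

theorem integral_swap (hM : M.Admissible) {f : ℝ × ℝ → ℝ} (hf : Measurable f) :
    ∫ ω, f (M.Zp ω, M.Zm ω) ∂M.P = ∫ ω, f (M.Zm ω, M.Zp ω) ∂M.P :=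
  (hM.exchangeable.comp hf).integral_eq

/-- The two events cover the space and have equal probability by exchangeability. -/
theorem measure_le_ne_zero (hM : M.Admissible) :
    M.P {ω | M.Zm ω ≤ M.Zp ω} ≠ 0 ∧ M.P {ω | M.Zp ω ≤ M.Zm ω} ≠ 0 := by
  have := hM.prob_P
  have h : M.P {ω | M.Zm ω ≤ M.Zp ω} = M.P {ω | M.Zp ω ≤ M.Zm ω} :=
    hM.exchangeable.measure_mem_eq (s := {p : ℝ × ℝ | p.2 ≤ p.1})
      (measurableSet_le measurable_snd measurable_fst)
  have hne : M.P {ω | M.Zm ω ≤ M.Zp ω} ≠ 0 := by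
    intro h0
    have h1 : M.P (univ : Set Ω) = 0 := by
      refine measure_mono_null (t := {ω | M.Zm ω ≤ M.Zp ω} ∪ {ω | M.Zp ω ≤ M.Zm ω}) ?_
        (measure_union_null h0 (h ▸ h0))
      intro ω _
      exact le_total (M.Zm ω) (M.Zp ω)
    simp at h1
  exact ⟨hne, h ▸ hne⟩

/-! ### Expected execution rates as functions of participation -/

section Rates

variable {gR gW a : ℝ}

theorem ae_volume_nonneg (hM : M.Admissible) {g : ℝ} (hg : 0 ≤ g) (ha : 0 ≤ a) :
    ∀ᵐ ω ∂M.P, 0 ≤ g * M.mu + a * M.Zp ω ∧ 0 ≤ g * M.mu + a * M.Zm ω := by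
  have := hM.mu_pos
  filter_upwards [hM.Zp_nonneg, hM.Zm_nonneg] with ω h1 h2
  constructor <;> positivity

theorem measurable_fillWrong (hM : M.Admissible) (g1 g2 a : ℝ) :
    Measurable fun ω => fillRate (g1 * M.mu + a * M.Zm ω) (g2 * M.mu + a * M.Zp ω) :=
  measurable_fillRate.comp (((hM.measurable_Zm.const_mul a).const_add _).prodMk
    ((hM.measurable_Zp.const_mul a).const_add _))

theorem measurable_fillRight (hM : M.Admissible) (g1 g2 a : ℝ) :
    Measurable fun ω => fillRate (g1 * M.mu + a * M.Zp ω) (g2 * M.mu + a * M.Zm ω) :=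
  measurable_fillRate.comp (((hM.measurable_Zp.const_mul a).const_add _).prodMk
    ((hM.measurable_Zm.const_mul a).const_add _))

theorem integrable_fillWrong (hM : M.Admissible) (hR : 0 ≤ gR) (hW : 0 ≤ gW) (ha : 0 ≤ a) :
    Integrable (fun ω => fillRate (gW * M.mu + a * M.Zm ω) (gR * M.mu + a * M.Zp ω)) M.P := by
  have := hM.prob_P
  refine Integrable.of_bound (hM.measurable_fillWrong _ _ _).aestronglyMeasurable 1 ?_
  filter_upwards [hM.ae_volume_nonneg hR ha, hM.ae_volume_nonneg hW ha] with ω h1 h2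
  rw [Real.norm_of_nonneg (fillRate_nonneg h2.2 h1.1)]
  exact fillRate_le_one h2.2

theorem integrable_fillRight (hM : M.Admissible) (hR : 0 ≤ gR) (hW : 0 ≤ gW) (ha : 0 ≤ a) :
    Integrable (fun ω => fillRate (gR * M.mu + a * M.Zp ω) (gW * M.mu + a * M.Zm ω)) M.P := by
  have := hM.prob_P
  refine Integrable.of_bound (hM.measurable_fillRight _ _ _).aestronglyMeasurable 1 ?_
  filter_upwards [hM.ae_volume_nonneg hR ha, hM.ae_volume_nonneg hW ha] with ω h1 h2
  rw [Real.norm_of_nonneg (fillRate_nonneg h1.1 h2.2)]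
  exact fillRate_le_one h1.1

/-- After the swap of buyers and sellers, the integrands of the two rates differ only in the
informed volumes, so they can be compared pointwise. -/
theorem rateRight_swap (hM : M.Admissible) (gR gW a : ℝ) : rateRight M gR gW a
    = ∫ ω, fillRate (gR * M.mu + a * M.Zm ω) (gW * M.mu + a * M.Zp ω) ∂M.P :=
  hM.integral_swap (f := fun p => fillRate (gR * M.mu + a * p.1) (gW * M.mu + a * p.2))
    (measurable_fillRate.comp (((measurable_fst.const_mul a).const_add _).prodMk
      ((measurable_snd.const_mul a).const_add _)))

theorem rateWrong_le_one (hM : M.Admissible) (hR : 0 ≤ gR) (hW : 0 ≤ gW) (ha : 0 ≤ a) :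
    rateWrong M gR gW a ≤ 1 := by
  have := hM.prob_P
  have h := integral_mono_ae (hM.integrable_fillWrong hR hW ha) (integrable_const 1)
    ((hM.ae_volume_nonneg hW ha).mono fun ω h => fillRate_le_one h.2)
  rw [integral_const, probReal_univ, one_smul] at h
  exact h

theorem rateRight_nonneg (hM : M.Admissible) (hR : 0 ≤ gR) (hW : 0 ≤ gW) (ha : 0 ≤ a) :
    0 ≤ rateRight M gR gW a := by
  refine integral_nonneg_of_ae ?_
  filter_upwards [hM.ae_volume_nonneg hR ha, hM.ae_volume_nonneg hW ha] with ω h1 h2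
  exact fillRate_nonneg h1.1 h2.2

theorem one_le_rate_add (hM : M.Admissible) (hR : 0 ≤ gR) (hW : 0 ≤ gW) (ha : 0 ≤ a) :
    1 ≤ rateWrong M gR gW a + rateRight M gR gW a := by
  have := hM.prob_P
  rw [rateWrong, rateRight, ← integral_add (hM.integrable_fillWrong hR hW ha)
    (hM.integrable_fillRight hR hW ha)]
  have h := integral_mono_ae (integrable_const (1 : ℝ)) ((hM.integrable_fillWrong hR hW ha).add
    (hM.integrable_fillRight hR hW ha)) (by
      filter_upwards [hM.ae_volume_nonneg hR ha, hM.ae_volume_nonneg hW ha] with ω h1 h2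
      exact one_le_fillRate_add _ _ h2.2 h1.1)
  simpa using h

/-- Orders in the wrong direction are executed more often than those in the right one. -/
theorem rateRight_lt_rateWrong (hM : M.Admissible) (hW : 0 ≤ gW) (hWR : gW < gR) (ha : 0 ≤ a) :
    rateRight M gR gW a < rateWrong M gR gW a := by
  have hR := hW.trans hWR.le
  have hmu := hM.mu_pos
  rw [hM.rateRight_swap, ← sub_pos, rateWrong, ← integral_sub (hM.integrable_fillWrong hR hW ha)
    (hM.integrable_fillWrong hW hR ha)]
  have hlt := mul_lt_mul_of_pos_right hWR hmu
  refine integral_pos_of_ae_nonneg ?_ ((hM.integrable_fillWrong hR hW ha).sub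
    (hM.integrable_fillWrong hW hR ha)) hM.measure_le_ne_zero.2 ?_
  · filter_upwards [hM.ae_volume_nonneg hR ha, hM.ae_volume_nonneg hW ha] with ω h1 h2
    exact sub_nonneg.2 (fillRate_le_fillRate h2.1 (by linarith) (by linarith) h1.2)
  · filter_upwards [hM.ae_volume_nonneg hR ha, hM.ae_volume_nonneg hW ha] with ω h1 h2 hω
    have := mul_le_mul_of_nonneg_left hω ha
    exact sub_pos.2 (fillRate_lt_fillRate h2.1 (by linarith) (by linarith) h2.2 (by linarith))

theorem _root_.DarkPool.rateWrong_mul (M : Market Ω) {c : ℝ} (hc : 0 < c) (gR gW a : ℝ) :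
    rateWrong M (c * gR) (c * gW) (c * a) = rateWrong M gR gW a := by
  unfold rateWrong
  simp_rw [mul_assoc, ← mul_add, fillRate_mul hc]

theorem _root_.DarkPool.rateRight_mul (M : Market Ω) {c : ℝ} (hc : 0 < c) (gR gW a : ℝ) :
    rateRight M (c * gR) (c * gW) (c * a) = rateRight M gR gW a := by
  unfold rateRight
  simp_rw [mul_assoc, ← mul_add, fillRate_mul hc]

theorem rateWrong_eq_min (hM : M.Admissible) (hW : 0 < gW) (ha : 0 ≤ a) : rateWrong M gR gW a
    = ∫ ω, min 1 ((gR * M.mu + a * M.Zp ω) / (gW * M.mu + a * M.Zm ω)) ∂M.P := by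
  have hmu := hM.mu_pos
  refine integral_congr_ae ?_
  filter_upwards [hM.Zm_nonneg] with ω h
  exact fillRate_eq_min (by positivity)

theorem rateRight_eq_min (hM : M.Admissible) (hR : 0 < gR) (ha : 0 ≤ a) : rateRight M gR gW a
    = ∫ ω, min 1 ((gW * M.mu + a * M.Zm ω) / (gR * M.mu + a * M.Zp ω)) ∂M.P := by
  have hmu := hM.mu_pos
  refine integral_congr_ae ?_
  filter_upwards [hM.Zp_nonneg] with ω h
  exact fillRate_eq_min (by positivity)

/-- Participations for which both sides of the dark pool have positive volume. -/
def _root_.DarkPool.activePool : Set (ℝ × ℝ × ℝ) := {p | 0 < p.1 ∧ 0 < p.2.1 ∧ 0 ≤ p.2.2}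

/-- Dominated convergence with bound 1. Positive informed volume on both sides keeps the
denominators away from zero even without liquidity traders. -/
theorem continuousOn_rateWrong (hM : M.Admissible) :
    ContinuousOn (fun p : ℝ × ℝ × ℝ => rateWrong M p.1 p.2.1 p.2.2) activePool := by
  have := hM.prob_P
  have hmu := hM.mu_pos
  refine continuousOn_of_dominated (bound := fun _ => 1)
    (fun p _ => (hM.measurable_fillWrong _ _ _).aestronglyMeasurable) (fun p hp => ?_)
    (integrable_const 1) ?_
  · filter_upwards [hM.ae_volume_nonneg hp.1.le hp.2.2, hM.ae_volume_nonneg hp.2.1.le hp.2.2]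
      with ω h1 h2
    rw [Real.norm_of_nonneg (fillRate_nonneg h2.2 h1.1)]
    exact fillRate_le_one h2.2
  · filter_upwards [hM.Zp_nonneg, hM.Zm_nonneg] with ω h1 h2
    refine ContinuousOn.congr (f := fun p : ℝ × ℝ × ℝ =>
      min 1 ((p.1 * M.mu + p.2.2 * M.Zp ω) / (p.2.1 * M.mu + p.2.2 * M.Zm ω))) ?_ ?_
    · refine continuousOn_const.inf (ContinuousOn.div (by fun_prop) (by fun_prop) ?_)
      rintro ⟨x, y, z⟩ ⟨hx, hy, hz⟩
      have : 0 < y * M.mu + z * M.Zm ω := by simp only at hx hy hz; positivity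
      exact this.ne'
    · rintro ⟨x, y, z⟩ ⟨hx, hy, hz⟩
      simp only at hx hy hz
      exact fillRate_eq_min (by positivity)

theorem continuousOn_rateRight (hM : M.Admissible) :
    ContinuousOn (fun p : ℝ × ℝ × ℝ => rateRight M p.1 p.2.1 p.2.2) activePool := by
  have := hM.prob_P
  have hmu := hM.mu_pos
  refine continuousOn_of_dominated (bound := fun _ => 1)
    (fun p _ => (hM.measurable_fillRight _ _ _).aestronglyMeasurable) (fun p hp => ?_)
    (integrable_const 1) ?_
  · filter_upwards [hM.ae_volume_nonneg hp.1.le hp.2.2, hM.ae_volume_nonneg hp.2.1.le hp.2.2]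
      with ω h1 h2
    rw [Real.norm_of_nonneg (fillRate_nonneg h1.1 h2.2)]
    exact fillRate_le_one h1.1
  · filter_upwards [hM.Zp_nonneg, hM.Zm_nonneg] with ω h1 h2
    refine ContinuousOn.congr (f := fun p : ℝ × ℝ × ℝ =>
      min 1 ((p.2.1 * M.mu + p.2.2 * M.Zm ω) / (p.1 * M.mu + p.2.2 * M.Zp ω))) ?_ ?_
    · refine continuousOn_const.inf (ContinuousOn.div (by fun_prop) (by fun_prop) ?_)
      rintro ⟨x, y, z⟩ ⟨hx, hy, hz⟩
      have : 0 < x * M.mu + z * M.Zp ω := by simp only at hx hy hz; positivity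
      exact this.ne'
    · rintro ⟨x, y, z⟩ ⟨hx, hy, hz⟩
      simp only at hx hy hz
      exact fillRate_eq_min (by positivity)

/-- Liquidity traders in the dark pool make its selection of informed orders less adverse than the
likelihood ratio of the two asset values. -/
theorem mul_rateWrong_lt (hM : M.Admissible) (hW : 0 < gW) (hWR : gW < gR) (ha : 0 < a) :
    gW * rateWrong M gR gW a < gR * rateRight M gR gW a := by
  have := hM.prob_P
  have hmu := hM.mu_pos
  have hR := hW.trans hWR
  let K : ℝ × ℝ → ℝ := fun p => max (gR * M.mu + a * p.1) (gW * M.mu + a * p.2)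
  have hKm : Measurable K := by fun_prop
  have hK1 : ∀ p : ℝ × ℝ, 0 < p.1 → 0 < p.2 → 0 < K p := fun p h1 h2 =>
    lt_max_of_lt_left (by positivity)
  have bound : ∀ c : ℝ, 0 ≤ c → ∀ x y z : ℝ, 0 < x → 0 < y → 0 < z → (a * z ≤ K (x, y)) →
      ‖c * (a * z / K (x, y))‖ ≤ c := by
    intro c hc x y z hx hy hz h
    have hK := hK1 (x, y) hx hy
    rw [Real.norm_of_nonneg (by positivity)]
    refine mul_le_of_le_one_right hc ((div_le_one hK).2 h)
  have le1 : ∀ x y : ℝ, a * x ≤ K (x, y) := fun x y => le_max_of_le_left (by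
    have := mul_pos hR hmu; linarith)
  have le2 : ∀ x y : ℝ, a * y ≤ K (x, y) := fun x y => le_max_of_le_right (by
    have := mul_pos hW hmu; linarith)
  have hZm := hM.measurable_Zm
  have hZp := hM.measurable_Zp
  have i1 : Integrable (fun ω => gR * (a * M.Zm ω / K (M.Zp ω, M.Zm ω))) M.P := by
    refine Integrable.of_bound (Measurable.aestronglyMeasurable (by fun_prop)) gR ?_
    filter_upwards [hM.ae_pos_Zp, hM.ae_pos_Zm] with ω h1 h2
    exact bound _ hR.le _ _ _ h1 h2 h2 (le2 _ _)
  have i2 : Integrable (fun ω => gW * (a * M.Zp ω / K (M.Zp ω, M.Zm ω))) M.P := by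
    refine Integrable.of_bound (Measurable.aestronglyMeasurable (by fun_prop)) gW ?_
    filter_upwards [hM.ae_pos_Zp, hM.ae_pos_Zm] with ω h1 h2
    exact bound _ hW.le _ _ _ h1 h2 h1 (le1 _ _)
  have i3 : Integrable (fun ω => gR * (a * M.Zp ω / K (M.Zm ω, M.Zp ω))) M.P := by
    refine Integrable.of_bound (Measurable.aestronglyMeasurable (by fun_prop)) gR ?_
    filter_upwards [hM.ae_pos_Zp, hM.ae_pos_Zm] with ω h1 h2
    exact bound _ hR.le _ _ _ h2 h1 h1 (le2 _ _)
  -- Over the common denominator K the informed volumes cancel: gR·gW·mu occurs in both numerators,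
  -- and only liquidity orders remain.
  have e1 : gR * rateRight M gR gW a - gW * rateWrong M gR gW a
      = ∫ ω, (gR * (a * M.Zm ω / K (M.Zp ω, M.Zm ω)) - gW * (a * M.Zp ω / K (M.Zp ω, M.Zm ω)))
        ∂M.P := by
    rw [rateRight, rateWrong, ← integral_const_mul, ← integral_const_mul, ← integral_sub
      ((hM.integrable_fillRight hR.le hW.le ha.le).const_mul _)
      ((hM.integrable_fillWrong hR.le hW.le ha.le).const_mul _)]
    refine integral_congr_ae ?_
    filter_upwards [hM.ae_pos_Zp, hM.ae_pos_Zm] with ω h1 h2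
    rw [fillRate_eq_div_max (by positivity), fillRate_eq_div_max (by positivity),
      max_comm (gW * M.mu + a * M.Zm ω)]
    have hK := hK1 (M.Zp ω, M.Zm ω) h1 h2
    change gR * (_ / K (M.Zp ω, M.Zm ω)) - gW * (_ / K (M.Zp ω, M.Zm ω)) = _
    field_simp
    ring
  -- Exchangeability puts the same mass Zp in both numerators, which leaves a comparison of the two
  -- denominators.
  have e2 : ∫ ω, gR * (a * M.Zm ω / K (M.Zp ω, M.Zm ω)) ∂M.P
      = ∫ ω, gR * (a * M.Zp ω / K (M.Zm ω, M.Zp ω)) ∂M.P :=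
    hM.integral_swap (f := fun p => gR * (a * p.2 / K (p.1, p.2))) (by fun_prop)
  rw [← sub_pos, e1, integral_sub i1 i2, e2, ← integral_sub i3 i2]
  have hpos : ∀ᵐ ω ∂M.P, 0 < gR * (a * M.Zp ω / K (M.Zm ω, M.Zp ω))
      - gW * (a * M.Zp ω / K (M.Zp ω, M.Zm ω)) := by
    filter_upwards [hM.ae_pos_Zp, hM.ae_pos_Zm] with ω h1 h2
    have hK := hK1 (M.Zp ω, M.Zm ω) h1 h2
    have hK' := hK1 (M.Zm ω, M.Zp ω) h2 h1
    -- The left maximum is one of its two volumes. Its liquidity mass also occurs in one of the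
    -- volumes on the right, there weighted by gR > gW.
    have key : gW * K (M.Zm ω, M.Zp ω) < gR * K (M.Zp ω, M.Zm ω) := by
      have p1 : gR * (gW * M.mu + a * M.Zm ω) ≤ gR * K (M.Zp ω, M.Zm ω) :=
        mul_le_mul_of_nonneg_left (le_max_right _ _) hR.le
      have p2 : gR * (gR * M.mu + a * M.Zp ω) ≤ gR * K (M.Zp ω, M.Zm ω) :=
        mul_le_mul_of_nonneg_left (le_max_left _ _) hR.le
      rcases max_choice (gR * M.mu + a * M.Zm ω) (gW * M.mu + a * M.Zp ω) with h | h
      · change gW * max (gR * M.mu + a * M.Zm ω) (gW * M.mu + a * M.Zp ω) < _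
        rw [h]
        have := mul_lt_mul_of_pos_right hWR (mul_pos ha h2)
        linarith
      · change gW * max (gR * M.mu + a * M.Zm ω) (gW * M.mu + a * M.Zp ω) < _
        rw [h]
        have q1 := mul_lt_mul_of_pos_right hWR (mul_pos ha h1)
        have q2 : gW * (gW * M.mu) ≤ gR * (gR * M.mu) := by
          rw [← mul_assoc, ← mul_assoc]
          exact mul_le_mul_of_nonneg_right (by nlinarith) hmu.le
        linarith
    rw [sub_pos, ← mul_div_assoc, ← mul_div_assoc, div_lt_div_iff₀ hK hK']
    have := mul_lt_mul_of_pos_right key (mul_pos ha h1)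
    linarith
  exact integral_pos_of_ae_nonneg (hpos.mono fun _ h => h.le) (i3.sub i2) (s := univ) (by simp)
    (hpos.mono fun _ h _ => h)

/-- If the informed orders are unbalanced by a fixed amount, those in the right direction fail to
execute with a probability that is bounded below. -/
theorem exists_rateRight_le (hM : M.Admissible) :
    ∃ κ : ℝ, 0 < κ ∧ ∀ gR gW a c : ℝ, 0 ≤ c → 0 ≤ gW → gR ≤ 1 →
    0 ≤ a → a ≤ 1 → c ≤ gR - gW → rateRight M gR gW a ≤ 1 - c * κ := by
  have := hM.prob_P
  have hmu := hM.mu_pos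
  have hZp := hM.measurable_Zp
  set S : Set Ω := {ω | M.Zm ω ≤ M.Zp ω} with hS
  have hSm : MeasurableSet S := measurableSet_le hM.measurable_Zm hM.measurable_Zp
  -- When Zm ≤ Zp, right orders exceed wrong ones by at least c·mu out of a volume of at most mu +
  -- Zp. So a fraction of at least c·f stays unfilled.
  let f : Ω → ℝ := S.indicator fun ω => M.mu / (M.mu + M.Zp ω)
  have hf0 : ∀ᵐ ω ∂M.P, 0 ≤ f ω := by
    filter_upwards [hM.Zp_nonneg] with ω h
    exact indicator_apply_nonneg fun _ => by positivity
  have hfi : Integrable f M.P := by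
    refine Integrable.of_bound (Measurable.aestronglyMeasurable
      (Measurable.indicator (by fun_prop) hSm)) 1 ?_
    filter_upwards [hM.Zp_nonneg, hf0] with ω h h0
    rw [Real.norm_of_nonneg h0]
    refine indicator_apply_le' (fun _ => ?_) fun _ => zero_le_one
    exact div_le_one_of_le₀ (by linarith) (by positivity)
  refine ⟨∫ ω, f ω ∂M.P, integral_pos_of_ae_nonneg hf0 hfi hM.measure_le_ne_zero.1 ?_, ?_⟩
  · filter_upwards [hM.Zp_nonneg] with ω h hω
    have hω' : ω ∈ S := hω
    simp only [f, indicator_of_mem hω']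
    positivity
  · intro gR gW a c hc hW hR1 ha ha1 hd
    have hR : 0 ≤ gR := by linarith
    have hi := (integrable_const (1 : ℝ)).sub (hfi.const_mul c)
    have h := integral_mono_ae (hM.integrable_fillRight hR hW ha) hi (by
      filter_upwards [hM.Zp_nonneg, hM.ae_volume_nonneg hR ha, hM.ae_volume_nonneg hW ha]
        with ω h h1 h2
      by_cases hω : ω ∈ S
      · simp only [Pi.sub_apply, f, indicator_of_mem hω]
        have hz : a * M.Zm ω ≤ a * M.Zp ω := mul_le_mul_of_nonneg_left hω ha
        rcases hc.eq_or_lt with rfl | hc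
        · simpa using fillRate_le_one h1.1
        have hcm := mul_pos hc hmu
        have hdm := mul_le_mul_of_nonneg_right hd hmu.le
        have hlt : gW * M.mu + a * M.Zm ω < gR * M.mu + a * M.Zp ω := by linarith
        have hpos : 0 < gR * M.mu + a * M.Zp ω := by linarith [h2.2]
        rw [fillRate_of_lt hlt, div_le_iff₀ hpos, sub_mul, one_mul, ← mul_div_assoc]
        have hle : gR * M.mu + a * M.Zp ω ≤ M.mu + M.Zp ω :=
          add_le_add (mul_le_of_le_one_left hmu.le hR1) (mul_le_of_le_one_left h ha1)
        have : c * M.mu / (M.mu + M.Zp ω) * (gR * M.mu + a * M.Zp ω) ≤ c * M.mu := by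
          rw [div_mul_eq_mul_div, div_le_iff₀ (by positivity)]
          exact mul_le_mul_of_nonneg_left hle hcm.le
        linarith
      · simp only [Pi.sub_apply, f, indicator_of_notMem hω, mul_zero, sub_zero]
        exact fillRate_le_one h1.1)
    have e : ∫ ω, ((fun _ : Ω => (1 : ℝ)) - fun ω => c * f ω) ω ∂M.P = 1 - c * ∫ ω, f ω ∂M.P := by
      simp only [Pi.sub_apply]
      rw [integral_sub (integrable_const _) (hfi.const_mul c), integral_const_mul]
      simp
    rw [← e]
    exact h

end Rates

end Market.Admissible


end

section

/-! ### The distribution of the delay cost -/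

/-- Density of the delay cost. -/
def Market.dG (M : Market Ω) (x : ℝ) : ℝ := derivWithin M.G (Icc 0 M.dBar) x

namespace Market.Admissible

variable {M : Market Ω}

theorem dBar_pos (hM : M.Admissible) : 0 < M.dBar := one_pos.trans_le hM.one_le_dBar

theorem G_eq_real (hM : M.Admissible) (x : ℝ) : M.G x = M.nu.real (Iic x) := by
  have := hM.prob_nu
  exact cdf_eq_real M.nu x

theorem _root_.DarkPool.Market.monotone_G (M : Market Ω) : Monotone M.G := monotone_cdf M.nu

theorem _root_.DarkPool.Market.G_le_one (M : Market Ω) (x : ℝ) : M.G x ≤ 1 := cdf_le_one M.nu x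

theorem _root_.DarkPool.Market.G_nonneg (M : Market Ω) (x : ℝ) : 0 ≤ M.G x := cdf_nonneg M.nu x

theorem G_of_nonpos (hM : M.Admissible) {x : ℝ} (hx : x ≤ 0) : M.G x = 0 :=
  le_antisymm ((M.monotone_G hx).trans hM.G_zero.le) (M.G_nonneg x)

theorem G_of_ge (hM : M.Admissible) {x : ℝ} (hx : M.dBar ≤ x) : M.G x = 1 := by
  have := hM.prob_nu
  have h : M.nu.real (Iic x)ᶜ = 0 := by
    rw [measureReal_eq_zero_iff]
    refine measure_mono_null (fun y hy => ?_) hM.nu_support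
    intro h2
    exact hy (h2.2.trans hx)
  rw [probReal_compl_eq_one_sub measurableSet_Iic] at h
  rw [hM.G_eq_real]
  linarith

/-- The distribution function is constant on either side of its support, so it is the constant
extension of its continuous restriction. -/
theorem continuous_G (hM : M.Admissible) : Continuous M.G := by
  have h0 := hM.dBar_pos.le
  have h1 : Continuous (IccExtend h0 ((Icc 0 M.dBar).domRestrict M.G)) :=
    hM.G_contDiff.continuousOn.domRestrict.Icc_extend'
  have h2 : M.G = IccExtend h0 ((Icc 0 M.dBar).domRestrict M.G) := by
    funext x
    rcases le_total x 0 with hx | hx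
    · rw [IccExtend_of_le_left _ _ hx, hM.G_of_nonpos hx]
      exact hM.G_zero.symm
    · rcases le_total x M.dBar with hx' | hx'
      · rw [IccExtend_of_mem _ _ ⟨hx, hx'⟩]
        rfl
      · rw [IccExtend_of_right_le _ _ hx', hM.G_of_ge hx']
        exact (hM.G_of_ge le_rfl).symm
  rw [h2]
  exact h1

theorem nullSingletonClass_nu (hM : M.Admissible) : NullSingletonClass M.nu := by
  have := hM.prob_nu
  refine ⟨fun x => ?_⟩
  have h := (cdf M.nu).measure_singleton x
  have hl : Function.leftLim (cdf M.nu) x = cdf M.nu x :=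
    ContinuousWithinAt.leftLim_eq (hM.continuous_G).continuousWithinAt
  rwa [measure_cdf, hl, sub_self, ENNReal.ofReal_zero] at h

theorem nu_real_Iio (hM : M.Admissible) (x : ℝ) : M.nu.real (Iio x) = M.G x := by
  have := hM.nullSingletonClass_nu
  rw [hM.G_eq_real, measureReal_congr Iio_ae_eq_Iic]

theorem nu_real_Ici (hM : M.Admissible) (x : ℝ) : M.nu.real (Ici x) = 1 - M.G x := by
  have := hM.prob_nu
  rw [← hM.nu_real_Iio, ← compl_Iio, probReal_compl_eq_one_sub measurableSet_Iio]

theorem nu_real_Ico (hM : M.Admissible) {x y : ℝ} (hxy : x ≤ y) :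
    M.nu.real (Ico x y) = M.G y - M.G x := by
  have := hM.prob_nu
  rw [← hM.nu_real_Iio, ← hM.nu_real_Iio,
    ← measureReal_sdiff (Iio_subset_Iio hxy) measurableSet_Iio]
  congr 1
  ext z
  simp

theorem uniqueDiffOn (hM : M.Admissible) : UniqueDiffOn ℝ (Icc 0 M.dBar) :=
  uniqueDiffOn_Icc hM.dBar_pos

theorem hasDerivAt_G (hM : M.Admissible) {x : ℝ} (h0 : 0 < x) (h1 : x < M.dBar) :
    HasDerivAt M.G (M.dG x) x :=
  ((hM.G_contDiff.differentiableOn (by norm_num) x ⟨h0.le, h1.le⟩).hasDerivWithinAt).hasDerivAt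
    (Icc_mem_nhds h0 h1)

theorem contDiffOn_dG (hM : M.Admissible) : ContDiffOn ℝ 1 M.dG (Icc 0 M.dBar) := by
  have h : ContDiffOn ℝ (1 + 1) M.G (Icc 0 M.dBar) := by
    convert hM.G_contDiff using 1
    norm_num
  exact ((contDiffOn_succ_iff_derivWithin hM.uniqueDiffOn).1 h).2.2

theorem _root_.DarkPool.Market.dG_nonneg (M : Market Ω) (x : ℝ) : 0 ≤ M.dG x :=
  (M.monotone_G.monotoneOn _).derivWithin_nonneg

/-- The shape condition says that x·G'(x) has nonnegative derivative. It is used below only in this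
form. -/
theorem monotoneOn_mul_dG (hM : M.Admissible) : MonotoneOn (fun x => x * M.dG x) (Icc 0 1) := by
  have hsub : Icc (0 : ℝ) 1 ⊆ Icc 0 M.dBar := Icc_subset_Icc_right hM.one_le_dBar
  have hd : ∀ x ∈ Ioo (0 : ℝ) 1, HasDerivAt (fun x => x * M.dG x)
      (M.dG x + x * iteratedDerivWithin 2 M.G (Icc 0 M.dBar) x) x := by
    intro x hx
    have h1 : HasDerivAt M.dG (derivWithin M.dG (Icc 0 M.dBar) x) x :=
      ((hM.contDiffOn_dG.differentiableOn one_ne_zero x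
        (hsub ⟨hx.1.le, hx.2.le⟩)).hasDerivWithinAt).hasDerivAt
        (Icc_mem_nhds hx.1 (hx.2.trans_le hM.one_le_dBar))
    have h2 : iteratedDerivWithin 2 M.G (Icc 0 M.dBar) x = derivWithin M.dG (Icc 0 M.dBar) x := by
      rw [show (2 : ℕ) = 1 + 1 from rfl, iteratedDerivWithin_succ, iteratedDerivWithin_one]
      rfl
    rw [h2]
    simpa using (hasDerivAt_id x).fun_mul h1
  refine monotoneOn_of_deriv_nonneg (convex_Icc 0 1)
    (continuousOn_id.mul (hM.contDiffOn_dG.continuousOn.mono hsub)) ?_ ?_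
  · rw [interior_Icc]
    exact fun x hx => (hd x hx).differentiableAt.differentiableWithinAt
  · rw [interior_Icc]
    intro x hx
    rw [(hd x hx).deriv]
    exact hM.G_shape x ⟨hx.1.le, hx.2.le⟩

theorem exists_dG_eq_slope (hM : M.Admissible) {x y : ℝ} (h0 : 0 ≤ x) (hxy : x < y) (h1 : y ≤ 1) :
    ∃ c ∈ Ioo x y, M.dG c * (y - x) = M.G y - M.G x := by
  obtain ⟨c, hc, h⟩ := exists_hasDerivAt_eq_slope M.G M.dG hxy hM.continuous_G.continuousOn
    fun z hz => hM.hasDerivAt_G (h0.trans_lt hz.1) ((hz.2.trans_le h1).trans_le hM.one_le_dBar)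
  refine ⟨c, hc, ?_⟩
  rw [h, div_mul_cancel₀ _ (sub_pos.2 hxy).ne']

/-- Since G(x) > G(0), the mean value theorem gives a point below x with positive density.
Monotonicity of x·G'(x) carries positivity up to x. -/
theorem dG_pos (hM : M.Admissible) {x : ℝ} (h0 : 0 < x) (h1 : x ≤ 1) : 0 < M.dG x := by
  obtain ⟨c, hc, h⟩ := hM.exists_dG_eq_slope le_rfl h0 h1
  have hG := hM.G_pos x h0
  rw [hM.G_zero, sub_zero, sub_zero] at h
  have hc0 : 0 < M.dG c := pos_of_mul_pos_left (h ▸ hG) h0.le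
  have := hM.monotoneOn_mul_dG ⟨hc.1.le, hc.2.le.trans h1⟩ ⟨h0.le, h1⟩ hc.2.le
  simp only at this
  exact pos_of_mul_pos_right ((mul_pos hc.1 hc0).trans_le this) h0.le

theorem G_lt_G (hM : M.Admissible) {x y : ℝ} (h0 : 0 ≤ x) (hxy : x < y) (h1 : y ≤ 1) :
    M.G x < M.G y := by
  obtain ⟨c, hc, h⟩ := hM.exists_dG_eq_slope h0 hxy h1
  have := mul_pos (hM.dG_pos (h0.trans_lt hc.1) (hc.2.le.trans h1)) (sub_pos.2 hxy)
  linarith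

theorem G_lt_one (hM : M.Admissible) {x : ℝ} (h1 : x < 1) : M.G x < 1 := by
  have h := hM.G_lt_G (le_max_left 0 x) (max_lt one_pos h1) le_rfl
  exact (M.monotone_G (le_max_right 0 x)).trans_lt (h.trans_le (M.G_le_one 1))

theorem exists_mul_le_one_sub_G (hM : M.Admissible) : ∃ c : ℝ, 0 < c ∧
    ∀ x ∈ Icc (1 / 2 : ℝ) 1, c * (1 - x) ≤ 1 - M.G x := by
  -- This is the value of x·G'(x) at 1/2. By monotonicity it bounds ξ·G'(ξ), hence G'(ξ), from below
  -- for ξ in [1/2, 1], and the mean value theorem converts this into a bound on 1 - G.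
  refine ⟨1 / 2 * M.dG (1 / 2), mul_pos (by norm_num) (hM.dG_pos (by norm_num) (by norm_num)), ?_⟩
  rintro x ⟨hx0, hx1⟩
  have hG1 := M.G_le_one 1
  rcases hx1.eq_or_lt with rfl | hx1
  · linarith
  obtain ⟨ξ, hξ, h⟩ := hM.exists_dG_eq_slope (by linarith) hx1 le_rfl
  have hm := hM.monotoneOn_mul_dG (a := 1 / 2) (b := ξ) ⟨by norm_num, by norm_num⟩
    ⟨by linarith [hξ.1], hξ.2.le⟩ (by linarith [hξ.1])
  simp only at hm
  have h2 : ξ * M.dG ξ ≤ M.dG ξ :=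
    mul_le_of_le_one_left (M.dG_nonneg _) hξ.2.le
  have := mul_le_mul_of_nonneg_right (hm.trans h2) (sub_nonneg.2 hx1.le)
  linarith

end Market.Admissible

variable {M : Market Ω} {σv σe : ℝ}

/-- Density of the liquidity traders in terms of the informed signal at which they switch. -/
def liquidityDensity (M : Market Ω) (σv σe s : ℝ) : ℝ :=
  M.dG (delayCutoff σv σe |s|) * delayCutoffDeriv σv σe |s|

theorem liquidityDensity_nonneg (M : Market Ω) (hσv : 0 < σv) (hσe : 0 < σe) (s : ℝ) :
    0 ≤ liquidityDensity M σv σe s :=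
  mul_nonneg (M.dG_nonneg _) (delayCutoffDeriv_pos hσv hσe _).le

theorem liquidityDensity_pos (hM : M.Admissible) (hσv : 0 < σv) (hσe : 0 < σe) {s : ℝ}
    (hs : 0 < s) : 0 < liquidityDensity M σv σe s :=
  mul_pos (hM.dG_pos (delayCutoff_pos hσv hσe (abs_pos.2 hs.ne')) (delayCutoff_lt_one hσe _).le)
    (delayCutoffDeriv_pos hσv hσe _)

/-- The absolute value keeps the delay cost inside the interval on which G is assumed smooth, so the
density is continuous on the whole line. -/
theorem continuous_liquidityDensity (hM : M.Admissible) (hσv : 0 < σv) (hσe : 0 < σe) :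
    Continuous (liquidityDensity M σv σe) := by
  refine Continuous.mul ?_ ((continuous_delayCutoffDeriv σv σe).comp continuous_abs)
  refine hM.contDiffOn_dG.continuousOn.comp_continuous
    ((continuous_delayCutoff hσe).comp continuous_abs) fun s => ⟨?_, ?_⟩
  · exact delayCutoff_nonneg hσv hσe (abs_nonneg s)
  · exact (delayCutoff_lt_one hσe _).le.trans hM.one_le_dBar

/-- Mean value of `liquidityDensity` on the interval between `s` and `t`. -/
def meanLiquidity (M : Market Ω) (σv σe s t : ℝ) : ℝ :=
  ∫ u in (0 : ℝ)..1, liquidityDensity M σv σe (s + u * (t - s))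

@[simp] theorem meanLiquidity_self (M : Market Ω) (σv σe s : ℝ) :
    meanLiquidity M σv σe s s = liquidityDensity M σv σe s := by
  simp [meanLiquidity]

theorem continuous_meanLiquidity (hM : M.Admissible) (hσv : 0 < σv) (hσe : 0 < σe) :
    Continuous fun p : ℝ × ℝ => meanLiquidity M σv σe p.1 p.2 := by
  unfold meanLiquidity
  apply intervalIntegral.continuous_parametric_intervalIntegral_of_continuous'
  exact (continuous_liquidityDensity hM hσv hσe).comp (by fun_prop)

theorem meanLiquidity_nonneg (M : Market Ω) (hσv : 0 < σv) (hσe : 0 < σe) (s t : ℝ) :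
    0 ≤ meanLiquidity M σv σe s t :=
  intervalIntegral.integral_nonneg zero_le_one fun _ _ => liquidityDensity_nonneg M hσv hσe _

/-- The density may vanish at the signal 0, but every interior point of the averaging interval is
positive. -/
theorem meanLiquidity_pos (hM : M.Admissible) (hσv : 0 < σv) (hσe : 0 < σe) {s t : ℝ}
    (hs : 0 ≤ s) (ht : 0 < t) : 0 < meanLiquidity M σv σe s t := by
  refine intervalIntegral.intervalIntegral_pos_of_pos_on
    (((continuous_liquidityDensity hM hσv hσe).comp (by fun_prop)).intervalIntegrable _ _)
    (fun u hu => liquidityDensity_pos hM hσv hσe ?_) one_pos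
  nlinarith [mul_nonneg hs (sub_nonneg.2 hu.2.le), mul_pos ht hu.1]

theorem mul_meanLiquidity (hM : M.Admissible) (hσv : 0 < σv) (hσe : 0 < σe) {s t : ℝ}
    (hs : 0 ≤ s) (hst : s ≤ t) : (t - s) * meanLiquidity M σv σe s t
      = M.G (delayCutoff σv σe t) - M.G (delayCutoff σv σe s) := by
  have h := intervalIntegral.smul_integral_comp_add_mul (a := 0) (b := 1)
    (liquidityDensity M σv σe) (t - s) s
  have h2 := intervalIntegral.integral_eq_sub_of_hasDerivAt_of_le hst
    (f := fun x => M.G (delayCutoff σv σe x)) (f' := liquidityDensity M σv σe)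
    (hM.continuous_G.comp (continuous_delayCutoff hσe)).continuousOn (fun x hx => by
      have hx0 : 0 < x := hs.trans_lt hx.1
      have := (hM.hasDerivAt_G (delayCutoff_pos hσv hσe hx0)
        ((delayCutoff_lt_one hσe x).trans_le hM.one_le_dBar)).comp x (hasDerivAt_delayCutoff hσe x)
      rw [liquidityDensity, abs_of_pos hx0]
      exact this)
    ((continuous_liquidityDensity hM hσv hσe).intervalIntegrable _ _)
  rw [← h2, meanLiquidity]
  simp only [smul_eq_mul, mul_zero, add_zero, mul_one, add_sub_cancel] at h
  rw [← h]
  congr 2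
  funext u
  congr 1
  ring


end

section

/-! ### Solution of the indifference equations -/

variable {M : Market Ω} {σv σe : ℝ}

/-- Execution rate of wrong orders between the cut-offs `s` and `t`, extended to `s = t`. -/
def cutWrong (M : Market Ω) (σv σe s t : ℝ) : ℝ :=
  rateWrong M (meanDensity σe σv s t) (meanDensity σe (-σv) s t) (meanLiquidity M σv σe s t)

/-- Execution rate of right orders between the cut-offs `s` and `t`, extended to `s = t`. -/
def cutRight (M : Market Ω) (σv σe s t : ℝ) : ℝ :=
  rateRight M (meanDensity σe σv s t) (meanDensity σe (-σv) s t) (meanLiquidity M σv σe s t)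

theorem cutGammaDright_eq (hσe : 0 < σe) {s t : ℝ} (hst : s ≤ t) :
    cutGammaDright σv σe s t = (t - s) * meanDensity σe σv s t :=
  (mul_meanDensity hσe σv hst).symm

theorem cutGammaDwrong_eq (hσe : 0 < σe) {s t : ℝ} (hst : s ≤ t) :
    cutGammaDwrong σv σe s t = (t - s) * meanDensity σe (-σv) s t := by
  rw [mul_meanDensity hσe (-σv) hst, sub_neg_eq_add, sub_neg_eq_add, cutGammaDwrong]

theorem cutAlphaD_eq (hM : M.Admissible) (hσv : 0 < σv) (hσe : 0 < σe) {s t : ℝ}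
    (hs : 0 ≤ s) (hst : s ≤ t) : cutAlphaD M σv σe s t = (t - s) * meanLiquidity M σv σe s t :=
  (mul_meanLiquidity hM hσv hσe hs hst).symm

theorem rateWrong_cut (hM : M.Admissible) (hσv : 0 < σv) (hσe : 0 < σe) {s t : ℝ}
    (hs : 0 ≤ s) (hst : s < t) : rateWrong M (cutGammaDright σv σe s t) (cutGammaDwrong σv σe s t)
      (cutAlphaD M σv σe s t) = cutWrong M σv σe s t := by
  rw [cutGammaDright_eq hσe hst.le, cutGammaDwrong_eq hσe hst.le, cutAlphaD_eq hM hσv hσe hs hst.le,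
    rateWrong_mul M (sub_pos.2 hst), cutWrong]

theorem rateRight_cut (hM : M.Admissible) (hσv : 0 < σv) (hσe : 0 < σe) {s t : ℝ}
    (hs : 0 ≤ s) (hst : s < t) : rateRight M (cutGammaDright σv σe s t) (cutGammaDwrong σv σe s t)
      (cutAlphaD M σv σe s t) = cutRight M σv σe s t := by
  rw [cutGammaDright_eq hσe hst.le, cutGammaDwrong_eq hσe hst.le, cutAlphaD_eq hM hσv hσe hs hst.le,
    rateRight_mul M (sub_pos.2 hst), cutRight]

theorem continuous_meanParticipation (hM : M.Admissible) (hσv : 0 < σv) (hσe : 0 < σe) :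
    Continuous fun p : ℝ × ℝ => (meanDensity σe σv p.1 p.2, meanDensity σe (-σv) p.1 p.2,
      meanLiquidity M σv σe p.1 p.2) :=
  (continuous_meanDensity σe σv).prodMk
    ((continuous_meanDensity σe (-σv)).prodMk (continuous_meanLiquidity hM hσv hσe))

theorem meanParticipation_mem (M : Market Ω) (hσv : 0 < σv) (hσe : 0 < σe) (s t : ℝ) :
    (meanDensity σe σv s t, meanDensity σe (-σv) s t, meanLiquidity M σv σe s t) ∈ activePool :=
  ⟨meanDensity_pos hσe _ _ _, meanDensity_pos hσe _ _ _, meanLiquidity_nonneg M hσv hσe _ _⟩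

/-- Includes the diagonal s = t, where participation itself vanishes but its means do not. -/
theorem continuous_cutWrong (hM : M.Admissible) (hσv : 0 < σv) (hσe : 0 < σe) :
    Continuous fun p : ℝ × ℝ => cutWrong M σv σe p.1 p.2 :=
  hM.continuousOn_rateWrong.comp_continuous (continuous_meanParticipation hM hσv hσe)
    fun p => meanParticipation_mem M hσv hσe p.1 p.2

theorem continuous_cutRight (hM : M.Admissible) (hσv : 0 < σv) (hσe : 0 < σe) :
    Continuous fun p : ℝ × ℝ => cutRight M σv σe p.1 p.2 :=
  hM.continuousOn_rateRight.comp_continuous (continuous_meanParticipation hM hσv hσe)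
    fun p => meanParticipation_mem M hσv hσe p.1 p.2

theorem cutRight_nonneg (hM : M.Admissible) (hσv : 0 < σv) (hσe : 0 < σe) (s t : ℝ) :
    0 ≤ cutRight M σv σe s t :=
  hM.rateRight_nonneg (meanDensity_pos hσe _ _ _).le (meanDensity_pos hσe _ _ _).le
    (meanLiquidity_nonneg M hσv hσe _ _)

theorem cutWrong_le_one (hM : M.Admissible) (hσv : 0 < σv) (hσe : 0 < σe) (s t : ℝ) :
    cutWrong M σv σe s t ≤ 1 :=
  hM.rateWrong_le_one (meanDensity_pos hσe _ _ _).le (meanDensity_pos hσe _ _ _).le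
    (meanLiquidity_nonneg M hσv hσe _ _)

theorem cutRight_lt_cutWrong (hM : M.Admissible) (hσv : 0 < σv) (hσe : 0 < σe) {s t : ℝ}
    (hs : 0 ≤ s) (ht : 0 < t) : cutRight M σv σe s t < cutWrong M σv σe s t :=
  hM.rateRight_lt_rateWrong (meanDensity_pos hσe _ _ _).le (meanDensity_neg_lt hσv hσe hs ht)
    (meanLiquidity_nonneg M hσv hσe _ _)

/-- In a pool used only by traders who are just indifferent between the venues, the payoff of these
traders would be positive. -/
theorem darkPool_payoff_self_pos (hM : M.Admissible) (hσv : 0 < σv) (hσe : 0 < σe) {s : ℝ}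
    (hs : 0 < s) : cutWrong M σv σe s s - cutRight M σv σe s s
      < delayCutoff σv σe s * (cutWrong M σv σe s s + cutRight M σv σe s s) := by
  have h := hM.mul_rateWrong_lt (density_pos hσe (-σv) s) (density_neg_lt hσv hσe hs)
    (liquidityDensity_pos hM hσv hσe hs)
  have h1 := delayCutoff_mul_density (σv := σv) hσe s
  have h2 := neg_one_lt_delayCutoff (σv := σv) hσe s
  have h3 := density_pos hσe σv s
  simp only [cutWrong, cutRight, meanDensity_self, meanLiquidity_self]
  set W := rateWrong M (density σe σv s) (density σe (-σv) s) (liquidityDensity M σv σe s)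
  set r := rateRight M (density σe σv s) (density σe (-σv) s) (liquidityDensity M σv σe s)
  set x := delayCutoff σv σe s
  -- Bayes' rule rewrites the volume comparison `h` as (1 - x)·W < (1 + x)·r, which rearranges to
  -- the claim.
  have h4 : density σe σv s * ((1 - x) * W) < density σe σv s * ((1 + x) * r) := by
    calc density σe σv s * ((1 - x) * W) = ((1 - x) * density σe σv s) * W := by ring
      _ = (1 + x) * (density σe (-σv) s * W) := by rw [h1]; ring
      _ < (1 + x) * (density σe σv s * r) := mul_lt_mul_of_pos_left h (by linarith)
      _ = _ := by ring
  have := lt_of_mul_lt_mul_left h4 h3.le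
  linarith

/-! ### The spread as a function of the exchange cut-off -/

/-- The spread, in units of `σv`, when the exchange is used from the cut-off `s` on. -/
def cutSpread (M : Market Ω) (σv σe s : ℝ) : ℝ :=
  (cutGammaEright σv σe s - cutGammaEwrong σv σe s)
    / (cutGammaEright σv σe s + cutGammaEwrong σv σe s + cutAlphaE M σv σe s * (M.muZ / M.mu))

theorem cutGammaEright_eq (hσe : 0 < σe) (s : ℝ) :
    cutGammaEright σv σe s = (signalLaw σe σv).real (Ici s) :=
  (signalLaw_real_Ici hσe σv s).symm

theorem cutGammaEwrong_eq (hσe : 0 < σe) (s : ℝ) :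
    cutGammaEwrong σv σe s = (signalLaw σe (-σv)).real (Ici s) := by
  rw [signalLaw_real_Ici hσe, sub_neg_eq_add, cutGammaEwrong]

theorem signalLaw_real_pos (hσe : 0 < σe) (v : ℝ) {B : Set ℝ} (hB : volume B ≠ 0) :
    0 < (signalLaw σe v).real B :=
  lt_of_le_of_ne measureReal_nonneg fun h => hB ((signalLaw_real_eq_zero_iff hσe v B).1 h.symm)

theorem cutGammaEright_pos (hσe : 0 < σe) (s : ℝ) : 0 < cutGammaEright σv σe s := by
  rw [cutGammaEright_eq hσe]
  exact signalLaw_real_pos hσe _ (by simp)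

theorem cutGammaEwrong_pos (hσe : 0 < σe) (s : ℝ) : 0 < cutGammaEwrong σv σe s := by
  rw [cutGammaEwrong_eq hσe]
  exact signalLaw_real_pos hσe _ (by simp)

theorem cutGammaEwrong_lt (hσv : 0 < σv) (hσe : 0 < σe) {s : ℝ} (hs : 0 ≤ s) :
    cutGammaEwrong σv σe s < cutGammaEright σv σe s := by
  rw [cutGammaEright_eq hσe, cutGammaEwrong_eq hσe]
  exact signalLaw_neg_lt hσv hσe measurableSet_Ici (Ici_subset_Ici.2 hs) (by simp)

theorem cutAlphaE_pos (hM : M.Admissible) (hσe : 0 < σe) (s : ℝ) : 0 < cutAlphaE M σv σe s :=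
  sub_pos.2 (hM.G_lt_one (delayCutoff_lt_one hσe s))

theorem cutSpread_denom_pos (hM : M.Admissible) (hσe : 0 < σe) (s : ℝ) :
    0 < cutGammaEright σv σe s + cutGammaEwrong σv σe s
      + cutAlphaE M σv σe s * (M.muZ / M.mu) := by
  have h1 := cutGammaEright_pos (σv := σv) hσe s
  have h2 := cutGammaEwrong_pos (σv := σv) hσe s
  have h3 := cutAlphaE_pos (σv := σv) hM hσe s
  have h4 := hM.muZ_pos
  have h5 := hM.mu_pos
  positivity

theorem cutSpread_pos (hM : M.Admissible) (hσv : 0 < σv) (hσe : 0 < σe) {s : ℝ} (hs : 0 ≤ s) :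
    0 < cutSpread M σv σe s :=
  div_pos (sub_pos.2 (cutGammaEwrong_lt hσv hσe hs)) (cutSpread_denom_pos hM hσe s)

theorem continuous_cutSpread (hM : M.Admissible) (hσe : 0 < σe) :
    Continuous (cutSpread M σv σe) := by
  have h1 : Continuous (cutGammaEright σv σe) :=
    continuous_const.sub (continuous_Phi.comp (by fun_prop))
  have h2 : Continuous (cutGammaEwrong σv σe) :=
    continuous_const.sub (continuous_Phi.comp (by fun_prop))
  have h3 : Continuous (cutAlphaE M σv σe) :=
    continuous_const.sub (hM.continuous_G.comp (continuous_delayCutoff hσe))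
  exact (h1.sub h2).div ((h1.add h2).add (h3.mul continuous_const))
    fun s => (cutSpread_denom_pos hM hσe s).ne'

/-- Extreme signals are so rare that the spread vanishes when only they trade in the exchange. -/
theorem tendsto_cutSpread (hM : M.Admissible) (hσv : 0 < σv) (hσe : 0 < σe) :
    Tendsto (cutSpread M σv σe) atTop (𝓝 0) := by
  have hk := decay_pos hσv hσe
  -- Twice the decay rate of 1 - x: the informed tail is O(e²) while liquidity in the exchange is at
  -- least of order e, where e is the exponential set below. Their quotient is O(e).
  obtain ⟨K, hK⟩ := signalLaw_real_Ici_le σe σv (2 * decay σv σe) (by positivity)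
  obtain ⟨c, hc, hG⟩ := hM.exists_mul_le_one_sub_G
  have hz : 0 < M.muZ / M.mu := div_pos hM.muZ_pos hM.mu_pos
  obtain ⟨s1, hs1⟩ := exists_delayCutoff_eq hσv hσe (x := 1 / 2) (by norm_num) (by norm_num)
  have hlim : Tendsto (fun s => K / (c * (M.muZ / M.mu)) * Real.exp (-(decay σv σe * s))) atTop
      (𝓝 0) := by
    have h1 : Tendsto (fun s => -(decay σv σe * s)) atTop atBot :=
      tendsto_neg_atTop_atBot.comp (tendsto_id.const_mul_atTop hk)
    simpa using (Real.tendsto_exp_atBot.comp h1).const_mul (K / (c * (M.muZ / M.mu)))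
  refine tendsto_of_tendsto_of_tendsto_of_le_of_le' tendsto_const_nhds hlim ?_ ?_
  · filter_upwards [eventually_ge_atTop 0] with s hs
    exact (cutSpread_pos hM hσv hσe hs).le
  · filter_upwards [eventually_ge_atTop 0, eventually_ge_atTop s1] with s hs hss
    have hx : delayCutoff σv σe s ∈ Icc (1 / 2 : ℝ) 1 :=
      ⟨hs1 ▸ (strictMono_delayCutoff hσv hσe).monotone hss, (delayCutoff_lt_one hσe s).le⟩
    have h1 : c * Real.exp (-(decay σv σe * s)) ≤ cutAlphaE M σv σe s :=
      (mul_le_mul_of_nonneg_left (exp_le_one_sub_delayCutoff hσv hσe hs) hc.le).trans (hG _ hx)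
    have h2 := hK s
    rw [← cutGammaEright_eq hσe] at h2
    have h3 := cutGammaEright_pos (σv := σv) hσe s
    have h4 := cutGammaEwrong_pos (σv := σv) hσe s
    set e := Real.exp (-(decay σv σe * s)) with he
    have he0 : 0 < e := Real.exp_pos _
    have h5 : Real.exp (-(2 * decay σv σe * s)) = e * e := by
      rw [he, ← Real.exp_add]; congr 1; ring
    rw [h5] at h2
    have h6 : c * e * (M.muZ / M.mu) ≤ cutAlphaE M σv σe s * (M.muZ / M.mu) :=
      mul_le_mul_of_nonneg_right h1 hz.le
    calc cutSpread M σv σe s ≤ (K * (e * e)) / (c * e * (M.muZ / M.mu)) :=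
          div_le_div₀ (h3.le.trans h2) (by linarith) (by positivity) (by linarith)
      _ = K / (c * (M.muZ / M.mu)) * e := by field_simp

/-- Lower bound for the probability that right orders fail when the pool is used between a cut-off
below `1` and one above `2`. -/
theorem exists_cutRight_le (hM : M.Admissible) (hσv : 0 < σv) (hσe : 0 < σe) :
    ∃ η : ℝ, 0 < η ∧ ∀ s t : ℝ, 0 ≤ s → s ≤ 1 → 2 ≤ t → cutRight M σv σe s t ≤ 1 - η := by
  obtain ⟨κ, hκ, h⟩ := hM.exists_rateRight_le
  have diff : ∀ s t : ℝ, 0 ≤ s → s ≤ t →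
      0 ≤ cutGammaDright σv σe s t - cutGammaDwrong σv σe s t := by
    intro s t hs hst
    have := signalLaw_neg_le hσv hσe (B := Ico s t) measurableSet_Ico fun x hx => hs.trans hx.1
    rw [signalLaw_real_Ico hσe _ hst, signalLaw_real_Ico hσe _ hst, sub_neg_eq_add,
      sub_neg_eq_add] at this
    exact sub_nonneg.2 this
  set c := cutGammaDright σv σe 1 2 - cutGammaDwrong σv σe 1 2 with hcdef
  have hc : 0 < c := by
    have := signalLaw_neg_lt hσv hσe (B := Ico 1 2) measurableSet_Ico
      (fun x hx => zero_le_one.trans hx.1) (by simp)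
    rw [signalLaw_real_Ico hσe _ one_le_two, signalLaw_real_Ico hσe _ one_le_two, sub_neg_eq_add,
      sub_neg_eq_add] at this
    exact sub_pos.2 this
  refine ⟨c * κ, mul_pos hc hκ, fun s t hs0 hs1 ht => ?_⟩
  have hst : s < t := by linarith
  rw [← rateRight_cut hM hσv hσe hs0 hst]
  refine h _ _ _ c hc.le ?_ ?_ ?_ ?_ ?_
  · rw [cutGammaDwrong_eq hσe hst.le]
    exact mul_nonneg (sub_pos.2 hst).le (meanDensity_pos hσe _ _ _).le
  · rw [cutGammaDright, ← signalLaw_real_Ico hσe _ hst.le]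
    exact measureReal_le_one
  · rw [cutAlphaD_eq hM hσv hσe hs0 hst.le]
    exact mul_nonneg (sub_pos.2 hst).le (meanLiquidity_nonneg M hσv hσe _ _)
  · have h1 := M.G_le_one (delayCutoff σv σe t)
    have h2 := M.G_nonneg (delayCutoff σv σe s)
    rw [cutAlphaD]
    linarith
  · have h1 := diff s 1 hs0 hs1
    have h2 := diff 2 t zero_le_two ht
    -- The excess of right over wrong orders is additive over [s, 1), [1, 2) and [2, t). The outer
    -- two pieces are nonnegative and the middle one is c.
    simp only [cutGammaDright, cutGammaDwrong] at h1 h2 hcdef ⊢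
    linarith

/-! ### Existence of the two cut-offs -/

/-- A solution of two indifference equations, given their behaviour at the ends of the range
`[ε, L]` of the upper cut-off and for lower cut-offs between `0` and the upper one. -/
theorem exists_indifferent {x a : ℝ → ℝ} {W r : ℝ → ℝ → ℝ} {ε L : ℝ}
    (hx : Continuous x) (hxm : Monotone x) (hx0 : x 0 = 0) (ha : Continuous a)
    (hW : Continuous fun p : ℝ × ℝ => W p.1 p.2) (hr : Continuous fun p : ℝ × ℝ => r p.1 p.2)
    (hr0 : ∀ s t, 0 ≤ r s t) (hrW : ∀ s t, 0 ≤ s → 0 < t → r s t < W s t)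
    (hdiag : ∀ s, 0 < s → W s s - r s s < x s * (W s s + r s s))
    (hε : 0 < ε) (hεL : ε ≤ L) (haε : x ε < a ε)
    (haL : ∀ s, 0 ≤ s → s ≤ L → (W s L + r s L) / 2 * (x L - x s) < x L - a L) :
    ∃ s t : ℝ, 0 < s ∧ s < t ∧ x s * (W s t + r s t) = W s t - r s t ∧
      x t - a t = (W s t + r s t) / 2 * (x t - x s) := by
  -- The unit square parametrizes the region ε ≤ t ≤ L, 0 ≤ s ≤ t. Its edges u = 0 and u = 1 are s =
  -- 0 and the diagonal.
  let T : ℝ × ℝ → ℝ := fun p => ε + p.2 * (L - ε)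
  let S : ℝ × ℝ → ℝ := fun p => p.1 * T p
  have hTc : Continuous T := by fun_prop
  have hSc : Continuous S := by fun_prop
  have hWc : Continuous fun p => W (S p) (T p) := hW.comp (hSc.prodMk hTc)
  have hRc : Continuous fun p => r (S p) (T p) := hr.comp (hSc.prodMk hTc)
  have hfc : Continuous fun p => x (S p) * (W (S p) (T p) + r (S p) (T p))
      - (W (S p) (T p) - r (S p) (T p)) := ((hx.comp hSc).mul (hWc.add hRc)).sub (hWc.sub hRc)
  have hgc : Continuous fun p => x (T p) - a (T p)
      - (W (S p) (T p) + r (S p) (T p)) / 2 * (x (T p) - x (S p)) :=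
    ((hx.comp hTc).sub (ha.comp hTc)).sub
      (((hWc.add hRc).div_const 2).mul ((hx.comp hTc).sub (hx.comp hSc)))
  have hT : ∀ u : ℝ, ∀ y ∈ Icc (0 : ℝ) 1, 0 < T (u, y) := fun u y hy =>
    add_pos_of_pos_of_nonneg hε (mul_nonneg hy.1 (sub_nonneg.2 hεL))
  have hS0 : ∀ u ∈ Icc (0 : ℝ) 1, ∀ y ∈ Icc (0 : ℝ) 1, 0 ≤ S (u, y) := fun u hu y hy =>
    mul_nonneg hu.1 (hT u y hy).le
  have hST : ∀ u ∈ Icc (0 : ℝ) 1, ∀ y ∈ Icc (0 : ℝ) 1, S (u, y) ≤ T (u, y) := fun u hu y hy =>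
    mul_le_of_le_one_left (hT u y hy).le hu.2
  have hf0 : ∀ y ∈ Icc (0 : ℝ) 1, x (S (0, y)) * (W (S (0, y)) (T (0, y))
      + r (S (0, y)) (T (0, y))) - (W (S (0, y)) (T (0, y)) - r (S (0, y)) (T (0, y))) < 0 := by
    intro y hy
    have h2 : S (0, y) = 0 := zero_mul _
    have h1 := hrW 0 (T (0, y)) le_rfl (hT 0 y hy)
    rw [h2, hx0]
    linarith
  have hf1 : ∀ y ∈ Icc (0 : ℝ) 1, 0 < x (S (1, y)) * (W (S (1, y)) (T (1, y))
      + r (S (1, y)) (T (1, y))) - (W (S (1, y)) (T (1, y)) - r (S (1, y)) (T (1, y))) := by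
    intro y hy
    have h2 : S (1, y) = T (1, y) := one_mul _
    rw [h2]
    exact sub_pos.2 (hdiag _ (hT 1 y hy))
  have hg0 : ∀ u ∈ Icc (0 : ℝ) 1, x (T (u, 0)) - a (T (u, 0)) - (W (S (u, 0)) (T (u, 0))
      + r (S (u, 0)) (T (u, 0))) / 2 * (x (T (u, 0)) - x (S (u, 0))) < 0 := by
    intro u hu
    have h1 := hr0 (S (u, 0)) (T (u, 0))
    have h2 := hrW _ _ (hS0 u hu 0 ⟨le_rfl, zero_le_one⟩) (hT u 0 ⟨le_rfl, zero_le_one⟩)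
    have h3 := hxm (hST u hu 0 ⟨le_rfl, zero_le_one⟩)
    have h4 : T (u, 0) = ε := by simp [T]
    rw [h4] at h1 h2 h3 ⊢
    have h5 := mul_nonneg (show 0 ≤ (W (S (u, 0)) ε + r (S (u, 0)) ε) / 2 by linarith)
      (sub_nonneg.2 h3)
    linarith
  have hg1 : ∀ u ∈ Icc (0 : ℝ) 1, 0 < x (T (u, 1)) - a (T (u, 1)) - (W (S (u, 1)) (T (u, 1))
      + r (S (u, 1)) (T (u, 1))) / 2 * (x (T (u, 1)) - x (S (u, 1))) := by
    intro u hu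
    have h3 := hST u hu 1 ⟨zero_le_one, le_rfl⟩
    have h4 : T (u, 1) = L := by simp [T]
    rw [h4] at h3 ⊢
    exact sub_pos.2 (haL _ (hS0 u hu 1 ⟨zero_le_one, le_rfl⟩) h3)
  obtain ⟨⟨u, y⟩, ⟨hu, hy⟩, hfz, hgz⟩ :=
    poincare_miranda hfc.continuousOn hgc.continuousOn hf0 hf1 hg0 hg1
  -- The first function has a strict sign on these two edges, so the zero satisfies 0 < s < t.
  have hu0 : u ≠ 0 := fun h => (hf0 y hy).ne (h ▸ hfz)
  have hu1 : u ≠ 1 := fun h => (hf1 y hy).ne' (h ▸ hfz)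
  exact ⟨S (u, y), T (u, y), mul_pos (lt_of_le_of_ne hu.1 hu0.symm) (hT u y hy),
    mul_lt_of_lt_one_left (hT u y hy) (lt_of_le_of_ne hu.2 hu1), sub_eq_zero.1 hfz,
    sub_eq_zero.1 hgz⟩

/-- At the cut-off 0 the spread is still positive while x(0) = 0. Continuity gives the same ordering
at a small positive cut-off. -/
theorem exists_small_cutoff (hM : M.Admissible) (hσv : 0 < σv) (hσe : 0 < σe) :
    ∃ ε : ℝ, 0 < ε ∧ ε ≤ 1 ∧ delayCutoff σv σe ε < cutSpread M σv σe ε := by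
  have hc : Tendsto (fun s => delayCutoff σv σe s - cutSpread M σv σe s) (𝓝 0)
      (𝓝 (delayCutoff σv σe 0 - cutSpread M σv σe 0)) :=
    ((continuous_delayCutoff hσe).sub (continuous_cutSpread hM hσe)).tendsto 0
  have h0 : delayCutoff σv σe 0 - cutSpread M σv σe 0 < 0 := by
    rw [delayCutoff_zero hσe, zero_sub, neg_lt_zero]
    exact cutSpread_pos hM hσv hσe le_rfl
  have h1 := (hc.eventually_lt_const h0).and (eventually_lt_nhds (show (0 : ℝ) < 1 from one_pos))
  obtain ⟨ε, ⟨h2, h3⟩, h4⟩ :=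
    ((h1.filter_mono nhdsWithin_le_nhds).and (self_mem_nhdsWithin (s := Ioi (0 : ℝ)))).exists
  exact ⟨ε, h4, h3.le, sub_neg.1 h2⟩

/-- The claim is that the spread at L lies below x(L) - S(x(L) - x(s)). For s ≤ 1, S ≤ 1 - η/2, so
this quantity is at least x(1)·η/2. For s ≥ 1, S ≤ 1, so it is at least x(s) ≥ x(1). A vanishing
spread falls below both bounds. -/
theorem exists_large_cutoff (hM : M.Admissible) (hσv : 0 < σv) (hσe : 0 < σe) :
    ∃ L : ℝ, 1 ≤ L ∧ ∀ s, 0 ≤ s → s ≤ L →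
      (cutWrong M σv σe s L + cutRight M σv σe s L) / 2
          * (delayCutoff σv σe L - delayCutoff σv σe s)
        < delayCutoff σv σe L - cutSpread M σv σe L := by
  have hxm := (strictMono_delayCutoff hσv hσe).monotone
  have hx1 : 0 < delayCutoff σv σe 1 := delayCutoff_pos hσv hσe one_pos
  obtain ⟨η, hη, hle⟩ := exists_cutRight_le hM hσv hσe
  have hδ0 : 0 < min (delayCutoff σv σe 1) (delayCutoff σv σe 1 * (η / 2)) :=
    lt_min hx1 (mul_pos hx1 (half_pos hη))
  obtain ⟨L, hL2, hLa⟩ :=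
    ((eventually_ge_atTop 2).and ((tendsto_cutSpread hM hσv hσe).eventually_lt_const hδ0)).exists
  refine ⟨L, by linarith, fun s hs0 hsL => ?_⟩
  have hle' := fun h => hle s L hs0 h hL2
  have hr := cutRight_nonneg hM hσv hσe s L
  have hW := cutWrong_le_one hM hσv hσe s L
  have hrW := cutRight_lt_cutWrong hM hσv hσe hs0 (show 0 < L by linarith)
  have h0 := delayCutoff_nonneg hσv hσe hs0
  have h3 := hxm hsL
  have hL1 : delayCutoff σv σe 1 ≤ delayCutoff σv σe L := hxm (by linarith)
  have h7 : 1 ≤ s → delayCutoff σv σe 1 ≤ delayCutoff σv σe s := fun h => hxm h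
  clear hle
  generalize cutWrong M σv σe s L = W at *
  generalize cutRight M σv σe s L = r at *
  generalize delayCutoff σv σe s = x0 at *
  generalize delayCutoff σv σe L = x1 at *
  generalize cutSpread M σv σe L = a at *
  rcases le_total s 1 with h | h
  · have h7 := hle' h
    have h8 : delayCutoff σv σe 1 * (η / 2) ≤ x1 * (1 - (W + r) / 2) :=
      mul_le_mul hL1 (by linarith) (half_pos hη).le (hx1.le.trans hL1)
    have h9 := mul_nonneg (show 0 ≤ (W + r) / 2 by linarith) h0
    have h10 := hLa.trans_le (min_le_right _ _)
    linarith
  · have h8 := mul_nonneg (show 0 ≤ 1 - (W + r) / 2 by linarith) (sub_nonneg.2 h3)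
    have h10 := hLa.trans_le (min_le_left _ _)
    linarith [h7 h]

/-- The two indifference equations have a solution. -/
theorem exists_cutoffs (hM : M.Admissible) (hσv : 0 < σv) (hσe : 0 < σe) :
    ∃ s t : ℝ, 0 < s ∧ s < t ∧
      delayCutoff σv σe s * (cutWrong M σv σe s t + cutRight M σv σe s t)
        = cutWrong M σv σe s t - cutRight M σv σe s t ∧
      delayCutoff σv σe t - cutSpread M σv σe t
        = (cutWrong M σv σe s t + cutRight M σv σe s t) / 2
          * (delayCutoff σv σe t - delayCutoff σv σe s) := by
  obtain ⟨ε, hε, hε1, haε⟩ := exists_small_cutoff hM hσv hσe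
  obtain ⟨L, hL, haL⟩ := exists_large_cutoff hM hσv hσe
  exact exists_indifferent (continuous_delayCutoff hσe) (strictMono_delayCutoff hσv hσe).monotone
    (delayCutoff_zero hσe) (continuous_cutSpread hM hσe) (continuous_cutWrong hM hσv hσe)
    (continuous_cutRight hM hσv hσe) (cutRight_nonneg hM hσv hσe)
    (fun s t hs ht => cutRight_lt_cutWrong hM hσv hσe hs ht)
    (fun s hs => darkPool_payoff_self_pos hM hσv hσe hs) hε (hε1.trans hL) haε haL


end

section

/-! ### Participation generated by cut-off strategies -/

variable {M : Market Ω} {σv σe : ℝ}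

section CutoffSets

variable {s0 s1 : ℝ}

theorem setOf_informedCutoff_buy_exchange (s0 s1 : ℝ) :
    {s | informedCutoff s0 s1 s = .trade .buy .exchange} = Ici s1 := by
  ext s
  simp only [mem_ofPred_eq, mem_Ici, informedCutoff]
  split_ifs <;> simp_all

theorem setOf_informedCutoff_buy_darkPool (s0 s1 : ℝ) :
    {s | informedCutoff s0 s1 s = .trade .buy .darkPool} = Ico s0 s1 := by
  ext s
  simp only [mem_ofPred_eq, mem_Ico, informedCutoff]
  split_ifs <;> grind

/-- With s0 > 0, the buying regions, which are tested first, do not meet the selling region. -/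
theorem setOf_informedCutoff_sell_darkPool (h0 : 0 < s0) (h1 : s0 ≤ s1) :
    {s | informedCutoff s0 s1 s = .trade .sell .darkPool} = Ico (-s1) (-s0) := by
  ext s
  simp only [mem_ofPred_eq, mem_Ico, informedCutoff]
  split_ifs <;> grind

theorem setOf_informedCutoff_sell_exchange (h0 : 0 < s0) (h1 : s0 ≤ s1) :
    {s | informedCutoff s0 s1 s = .trade .sell .exchange} = Iio (-s1) := by
  ext s
  simp only [mem_ofPred_eq, mem_Iio, informedCutoff]
  split_ifs <;> grind

theorem measurableSet_informedCutoff (h0 : 0 < s0) (h1 : s0 ≤ s1) (a : InformedAction) :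
    MeasurableSet {s | informedCutoff s0 s1 s = a} := by
  rcases a with ⟨_ | _, _ | _⟩ | _
  · rw [setOf_informedCutoff_buy_exchange]; exact measurableSet_Ici
  · rw [setOf_informedCutoff_buy_darkPool]; exact measurableSet_Ico
  · rw [setOf_informedCutoff_sell_exchange h0 h1]; exact measurableSet_Iio
  · rw [setOf_informedCutoff_sell_darkPool h0 h1]; exact measurableSet_Ico
  · have h : {s | informedCutoff s0 s1 s = .noTrade} = Ico (-s0) s0 := by
      ext s
      simp only [mem_ofPred_eq, mem_Ico, informedCutoff]
      split_ifs <;> grind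
    rw [h]
    exact measurableSet_Ico

theorem setOf_liquidityCutoff_exchange (σv σe s0 s1 : ℝ) :
    {d | liquidityCutoff σv σe s0 s1 d = .trade .exchange} = Ici (delayCutoff σv σe s1) := by
  ext s
  simp only [mem_ofPred_eq, mem_Ici, liquidityCutoff]
  split_ifs <;> simp_all

theorem setOf_liquidityCutoff_darkPool (σv σe s0 s1 : ℝ) :
    {d | liquidityCutoff σv σe s0 s1 d = .trade .darkPool}
      = Ico (delayCutoff σv σe s0) (delayCutoff σv σe s1) := by
  ext s
  simp only [mem_ofPred_eq, mem_Ico, liquidityCutoff]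
  split_ifs <;> grind

theorem measurableSet_liquidityCutoff (σv σe s0 s1 : ℝ) (a : LiquidityAction) :
    MeasurableSet {d | liquidityCutoff σv σe s0 s1 d = a} := by
  rcases a with ⟨_ | _⟩ | _
  · rw [setOf_liquidityCutoff_exchange]; exact measurableSet_Ici
  · rw [setOf_liquidityCutoff_darkPool]; exact measurableSet_Ico
  · have h : {d | liquidityCutoff σv σe s0 s1 d = .delay}
        = (Ici (delayCutoff σv σe s1) ∪ Ico (delayCutoff σv σe s0) (delayCutoff σv σe s1))ᶜ := by
      ext d
      simp only [mem_ofPred_eq, mem_compl_iff, mem_union, mem_Ici, mem_Ico, liquidityCutoff]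
      split_ifs <;> grind
    rw [h]
    exact (measurableSet_Ici.union measurableSet_Ico).compl

end CutoffSets

/-- The candidate in which all traders follow the cut-offs `s0`, `s1`. -/
def cutoffCandidate (M : Market Ω) (σv σe s0 s1 : ℝ) : Candidate where
  hI := informedCutoff s0 s1
  hU _ := liquidityCutoff σv σe s0 s1
  A := cutSpread M σv σe s1 * σv
  Rwrong := rateWrong M (cutGammaDright σv σe s0 s1) (cutGammaDwrong σv σe s0 s1)
    (cutAlphaD M σv σe s0 s1)
  Rright := rateRight M (cutGammaDright σv σe s0 s1) (cutGammaDwrong σv σe s0 s1)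
    (cutAlphaD M σv σe s0 s1)
  gammaEright := cutGammaEright σv σe s1
  gammaEwrong := cutGammaEwrong σv σe s1
  gammaDright := cutGammaDright σv σe s0 s1
  gammaDwrong := cutGammaDwrong σv σe s0 s1
  alphaE := cutAlphaE M σv σe s1
  alphaD := cutAlphaD M σv σe s0 s1

theorem signalLaw_real_Iio_neg (hσe : 0 < σe) (v s : ℝ) :
    (signalLaw σe v).real (Iio (-s)) = (signalLaw σe (-v)).real (Ici s) := by
  rw [← signalLaw_real_neg σe v measurableSet_Ici]
  refine signalLaw_real_congr hσe v ?_
  rw [neg_preimage, neg_Ici]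
  exact Iio_ae_eq_Iic

theorem signalLaw_real_Ico_neg (hσe : 0 < σe) (v s t : ℝ) :
    (signalLaw σe v).real (Ico (-t) (-s)) = (signalLaw σe (-v)).real (Ico s t) := by
  rw [← signalLaw_real_neg σe v measurableSet_Ico]
  refine signalLaw_real_congr hσe v ?_
  rw [neg_preimage, neg_Ico]
  exact Ico_ae_eq_Ioc

theorem cutGammaDright_eq_real (hσe : 0 < σe) {s t : ℝ} (hst : s ≤ t) :
    (signalLaw σe σv).real (Ico s t) = cutGammaDright σv σe s t :=
  signalLaw_real_Ico hσe _ hst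

theorem cutGammaDwrong_eq_real (hσe : 0 < σe) {s t : ℝ} (hst : s ≤ t) :
    (signalLaw σe (-σv)).real (Ico s t) = cutGammaDwrong σv σe s t := by
  rw [signalLaw_real_Ico hσe _ hst, sub_neg_eq_add, sub_neg_eq_add, cutGammaDwrong]

theorem fractionsConsistent_cutoffCandidate (hM : M.Admissible) (hσv : 0 < σv) (hσe : 0 < σe)
    {s0 s1 : ℝ} (h0 : 0 < s0) (h1 : s0 < s1) :
    FractionsConsistent M σv σe (cutoffCandidate M σv σe s0 s1) where
  measurable_hI := measurableSet_informedCutoff h0 h1.le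
  measurable_hU _ := measurableSet_liquidityCutoff σv σe s0 s1
  eright_high := by
    rw [cutoffCandidate, setOf_informedCutoff_buy_exchange, cutGammaEright_eq hσe]
  eright_low := by
    rw [cutoffCandidate, setOf_informedCutoff_sell_exchange h0 h1.le, cutGammaEright_eq hσe,
      signalLaw_real_Iio_neg hσe, neg_neg]
  ewrong_high := by
    rw [cutoffCandidate, setOf_informedCutoff_sell_exchange h0 h1.le, cutGammaEwrong_eq hσe,
      signalLaw_real_Iio_neg hσe]
  ewrong_low := by
    rw [cutoffCandidate, setOf_informedCutoff_buy_exchange, cutGammaEwrong_eq hσe]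
  dright_high := by
    rw [cutoffCandidate, setOf_informedCutoff_buy_darkPool, cutGammaDright_eq_real hσe h1.le]
  dright_low := by
    rw [cutoffCandidate, setOf_informedCutoff_sell_darkPool h0 h1.le, signalLaw_real_Ico_neg hσe,
      neg_neg, cutGammaDright_eq_real hσe h1.le]
  dwrong_high := by
    rw [cutoffCandidate, setOf_informedCutoff_sell_darkPool h0 h1.le, signalLaw_real_Ico_neg hσe,
      cutGammaDwrong_eq_real hσe h1.le]
  dwrong_low := by
    rw [cutoffCandidate, setOf_informedCutoff_buy_darkPool, cutGammaDwrong_eq_real hσe h1.le]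
  alphaE_eq _ := by
    rw [cutoffCandidate, setOf_liquidityCutoff_exchange, hM.nu_real_Ici, cutAlphaE]
  alphaD_eq _ := by
    rw [cutoffCandidate, setOf_liquidityCutoff_darkPool,
      hM.nu_real_Ico ((strictMono_delayCutoff hσv hσe).monotone h1.le), cutAlphaD]

/-! ### Payoffs and break-even -/

theorem belief_eq_delayCutoff (σv σe s : ℝ) : belief σv σe s = (1 + delayCutoff σv σe s) / 2 := by
  unfold delayCutoff; ring

/-- In terms of x all payoffs are affine: slope σv in the exchange, σv·S in the pool. Selling
replaces x by -x. -/
theorem informedUnitPayoff_buy_exchange (E : Candidate) (s : ℝ) :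
    informedUnitPayoff σv σe E .buy s .exchange = σv * delayCutoff σv σe s - E.A := by
  simp only [informedUnitPayoff, probRight, belief_eq_delayCutoff]; ring

theorem informedUnitPayoff_sell_exchange (E : Candidate) (s : ℝ) :
    informedUnitPayoff σv σe E .sell s .exchange = σv * -delayCutoff σv σe s - E.A := by
  simp only [informedUnitPayoff, probRight, belief_eq_delayCutoff]; ring

theorem informedUnitPayoff_buy_darkPool (E : Candidate) (s : ℝ) :
    informedUnitPayoff σv σe E .buy s .darkPool
      = σv * ((E.Rwrong + E.Rright) / 2 * delayCutoff σv σe s - (E.Rwrong - E.Rright) / 2) := by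
  simp only [informedUnitPayoff, probRight, belief_eq_delayCutoff]; ring

theorem informedUnitPayoff_sell_darkPool (E : Candidate) (s : ℝ) :
    informedUnitPayoff σv σe E .sell s .darkPool
      = σv * ((E.Rwrong + E.Rright) / 2 * -delayCutoff σv σe s - (E.Rwrong - E.Rright) / 2) := by
  simp only [informedUnitPayoff, probRight, belief_eq_delayCutoff]; ring

/-- Up to the common term -σv·d, this is the payoff of an informed buyer in the pool with x = d.
This is why both types share the same cut-offs. -/
theorem liquidityPayoff_darkPool (E : Candidate) (d : ℝ) :
    liquidityPayoff σv E d (.trade .darkPool)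
      = σv * ((E.Rwrong + E.Rright) / 2 * d - (E.Rwrong - E.Rright) / 2) - σv * d := by
  simp only [liquidityPayoff]; ring

/-- Buyers and sellers have equal means, so the liquidity imbalance contributes nothing on average.
-/
theorem integral_marketMakerPayoff (hM : M.Admissible) (σv : ℝ) (E : Candidate) :
    ∫ ω, marketMakerPayoff M σv E ω ∂M.P
      = σv * ((E.gammaEwrong - E.gammaEright) * M.mu)
        + E.A * ((E.gammaEright + E.gammaEwrong) * M.mu + E.alphaE * M.muZ) := by
  have := hM.prob_P
  have hp := hM.Zp_integrable
  have hm := hM.Zm_integrable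
  have h : ∀ ω, marketMakerPayoff M σv E ω
      = (σv * ((E.gammaEwrong - E.gammaEright) * M.mu)
          + E.A * ((E.gammaEright + E.gammaEwrong) * M.mu))
        + (((E.A - σv) * E.alphaE) * M.Zp ω + ((E.A + σv) * E.alphaE) * M.Zm ω) := fun ω => by
    unfold marketMakerPayoff; ring
  simp_rw [h]
  have hi : Integrable (fun ω => (E.A - σv) * E.alphaE * M.Zp ω
      + (E.A + σv) * E.alphaE * M.Zm ω) M.P := (hp.const_mul _).add (hm.const_mul _)
  rw [integral_add (integrable_const _) hi, integral_add (hp.const_mul _) (hm.const_mul _),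
    integral_const_mul, integral_const_mul,
    hM.Zp_mean, hM.Zm_mean, integral_const, probReal_univ, one_smul]
  ring

/-- A market maker who breaks even charges the spread determined by the participation. -/
theorem spread_of_breakEven (hM : M.Admissible) {σv : ℝ} {E : Candidate}
    (h : ∫ ω, marketMakerPayoff M σv E ω ∂M.P = 0)
    (hpos : 0 < E.gammaEright + E.gammaEwrong + E.alphaE * (M.muZ / M.mu)) :
    E.A = (E.gammaEright - E.gammaEwrong)
      / (E.gammaEright + E.gammaEwrong + E.alphaE * (M.muZ / M.mu)) * σv := by
  have hmu := hM.mu_pos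
  rw [integral_marketMakerPayoff hM] at h
  rw [div_mul_eq_mul_div, eq_div_iff hpos.ne']
  have h2 : M.mu * (M.muZ / M.mu) = M.muZ := mul_div_cancel₀ _ hmu.ne'
  have h3 : M.mu * (E.A * (E.gammaEright + E.gammaEwrong + E.alphaE * (M.muZ / M.mu))
      - (E.gammaEright - E.gammaEwrong) * σv) = 0 := by
    calc _ = σv * ((E.gammaEwrong - E.gammaEright) * M.mu) + E.A * ((E.gammaEright + E.gammaEwrong)
        * M.mu + E.alphaE * (M.mu * (M.muZ / M.mu))) := by ring
      _ = 0 := by rw [h2, h]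
  have := (mul_eq_zero.1 h3).resolve_left hmu.ne'
  linarith

theorem breakEven_of_spread (hM : M.Admissible) {σv : ℝ} {E : Candidate}
    (hpos : 0 < E.gammaEright + E.gammaEwrong + E.alphaE * (M.muZ / M.mu))
    (hA : E.A = (E.gammaEright - E.gammaEwrong)
      / (E.gammaEright + E.gammaEwrong + E.alphaE * (M.muZ / M.mu)) * σv) :
    ∫ ω, marketMakerPayoff M σv E ω ∂M.P = 0 := by
  have hmu := hM.mu_pos
  rw [integral_marketMakerPayoff hM]
  rw [div_mul_eq_mul_div, eq_div_iff hpos.ne'] at hA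
  have h2 : M.mu * (M.muZ / M.mu) = M.muZ := mul_div_cancel₀ _ hmu.ne'
  calc _ = σv * ((E.gammaEwrong - E.gammaEright) * M.mu) + M.mu * (E.A * (E.gammaEright
        + E.gammaEwrong + E.alphaE * (M.muZ / M.mu))) := by
        rw [mul_left_comm M.mu, mul_add M.mu, mul_left_comm M.mu E.alphaE, h2]; ring
    _ = 0 := by rw [hA]; ring

/-- The cut-off system from the equations in terms of the delay cost cut-offs. -/
theorem cutoffSystem_of_indifferent (hM : M.Admissible) (hσv : 0 < σv) (hσe : 0 < σe)
    {E : Candidate} {s0 s1 : ℝ}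
    (h0 : 0 < s0) (h1 : s0 < s1)
    (hi0 : (E.Rwrong + E.Rright) / 2 * delayCutoff σv σe s0 - (E.Rwrong - E.Rright) / 2 = 0)
    (hi1 : σv * delayCutoff σv σe s1 - E.A
      = σv * ((E.Rwrong + E.Rright) / 2 * delayCutoff σv σe s1 - (E.Rwrong - E.Rright) / 2))
    (hER : E.gammaEright = cutGammaEright σv σe s1) (hEW : E.gammaEwrong = cutGammaEwrong σv σe s1)
    (hDR : E.gammaDright = cutGammaDright σv σe s0 s1)
    (hDW : E.gammaDwrong = cutGammaDwrong σv σe s0 s1)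
    (haE : E.alphaE = cutAlphaE M σv σe s1) (haD : E.alphaD = cutAlphaD M σv σe s0 s1)
    (hA : E.A = cutSpread M σv σe s1 * σv)
    (hW : E.Rwrong = rateWrong M E.gammaDright E.gammaDwrong E.alphaD)
    (hr : E.Rright = rateRight M E.gammaDright E.gammaDwrong E.alphaD) :
    CutoffSystem M σv σe E s0 s1 where
  s0_pos := h0
  s0_lt_s1 := h1
  indifference0 := by rw [belief_eq_delayCutoff]; linarith
  indifference1 := by rw [belief_eq_delayCutoff]; linarith
  spread_eq := by rw [hER, hEW, haE, hA, cutSpread]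
  rateWrong_eq := by
    rw [hW]
    refine hM.rateWrong_eq_min ?_ ?_
    · rw [hDW, cutGammaDwrong_eq hσe h1.le]
      exact mul_pos (sub_pos.2 h1) (meanDensity_pos hσe _ _ _)
    · rw [haD, cutAlphaD_eq hM hσv hσe h0.le h1.le]
      exact mul_nonneg (sub_pos.2 h1).le (meanLiquidity_nonneg M hσv hσe _ _)
  rateRight_eq := by
    rw [hr]
    refine hM.rateRight_eq_min ?_ ?_
    · rw [hDR, cutGammaDright_eq hσe h1.le]
      exact mul_pos (sub_pos.2 h1) (meanDensity_pos hσe _ _ _)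
    · rw [haD, cutAlphaD_eq hM hσv hσe h0.le h1.le]
      exact mul_nonneg (sub_pos.2 h1).le (meanLiquidity_nonneg M hσv hσe _ _)
  gammaEright_eq := hER
  gammaEwrong_eq := hEW
  gammaDright_eq := hDR
  gammaDwrong_eq := hDW
  alphaE_eq := haE
  alphaD_eq := haD


end

section

/-! ### Existence of an equilibrium -/

variable {M : Market Ω} {σv σe : ℝ}

/-- A split order earns a convex combination of pure payoffs, so only pure actions need to be
compared. -/
theorem split_order_le {qe qd ue ud u0 m : ℝ} (he : 0 ≤ qe) (hd : 0 ≤ qd) (h1 : qe + qd ≤ 1)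
    (hue : ue ≤ m) (hud : ud ≤ m) (hu0 : u0 ≤ m) : qe * ue + qd * ud + (1 - qe - qd) * u0 ≤ m := by
  have h2 := mul_le_mul_of_nonneg_left hue he
  have h3 := mul_le_mul_of_nonneg_left hud hd
  have h4 := mul_le_mul_of_nonneg_left hu0 (show 0 ≤ 1 - qe - qd by linarith)
  linarith

/-- The payoff of a cut-off strategy in the signal. -/
theorem informedPayoff_cutoff (hσe : 0 < σe) (E : Candidate) {s0 s1 : ℝ}
    (h0 : 0 < s0) (h1 : s0 < s1) (s : ℝ) :
    (s1 ≤ |s| ∧ informedPayoff σv σe E s (informedCutoff s0 s1 s)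
        = σv * delayCutoff σv σe |s| - E.A) ∨
    (s0 ≤ |s| ∧ |s| ≤ s1 ∧ informedPayoff σv σe E s (informedCutoff s0 s1 s)
        = σv * ((E.Rwrong + E.Rright) / 2 * delayCutoff σv σe |s| - (E.Rwrong - E.Rright) / 2)) ∨
    (|s| ≤ s0 ∧ informedPayoff σv σe E s (informedCutoff s0 s1 s) = 0) := by
  unfold informedCutoff
  split_ifs with c1 c2 c3 c4
  · rw [abs_of_pos (by linarith), informedPayoff, informedUnitPayoff_buy_exchange]
    exact Or.inl ⟨c1, rfl⟩
  · rw [abs_of_pos (by linarith), informedPayoff, informedUnitPayoff_buy_darkPool]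
    exact Or.inr (Or.inl ⟨c2.1, c2.2.le, rfl⟩)
  · rw [abs_of_neg (by linarith), informedPayoff, informedUnitPayoff_sell_darkPool,
      delayCutoff_neg hσe]
    exact Or.inr (Or.inl ⟨by linarith [c3.2], by linarith [c3.1], rfl⟩)
  · rw [abs_of_neg (by linarith), informedPayoff, informedUnitPayoff_sell_exchange,
      delayCutoff_neg hσe]
    exact Or.inl ⟨by linarith, rfl⟩
  · refine Or.inr (Or.inr ⟨abs_le.2 ⟨?_, ?_⟩, rfl⟩)
    · by_contra h
      exact c3 ⟨by linarith, by linarith⟩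
    · by_contra h
      exact c2 ⟨by linarith, by linarith⟩

theorem informedUnitPayoff_exchange_le (hσv : 0 < σv) (hσe : 0 < σe) (E : Candidate)
    (dir : Direction) (s : ℝ) :
    informedUnitPayoff σv σe E dir s .exchange ≤ σv * delayCutoff σv σe |s| - E.A := by
  rw [← abs_delayCutoff hσv hσe]
  rcases dir
  · rw [informedUnitPayoff_buy_exchange]
    linarith [mul_le_mul_of_nonneg_left (le_abs_self (delayCutoff σv σe s)) hσv.le]
  · rw [informedUnitPayoff_sell_exchange]
    linarith [mul_le_mul_of_nonneg_left (neg_le_abs (delayCutoff σv σe s)) hσv.le]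

theorem informedUnitPayoff_darkPool_le (hσv : 0 < σv) (hσe : 0 < σe) (E : Candidate)
    (hS : 0 ≤ E.Rwrong + E.Rright) (dir : Direction) (s : ℝ) :
    informedUnitPayoff σv σe E dir s .darkPool
      ≤ σv * ((E.Rwrong + E.Rright) / 2 * delayCutoff σv σe |s| - (E.Rwrong - E.Rright) / 2) := by
  have hS2 : 0 ≤ (E.Rwrong + E.Rright) / 2 := by linarith
  rw [← abs_delayCutoff hσv hσe]
  rcases dir
  · rw [informedUnitPayoff_buy_darkPool]
    refine mul_le_mul_of_nonneg_left ?_ hσv.le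
    linarith [mul_le_mul_of_nonneg_left (le_abs_self (delayCutoff σv σe s)) hS2]
  · rw [informedUnitPayoff_sell_darkPool]
    refine mul_le_mul_of_nonneg_left ?_ hσv.le
    linarith [mul_le_mul_of_nonneg_left (neg_le_abs (delayCutoff σv σe s)) hS2]

/-- Of the three linear payoffs, that of the exchange, that of the dark pool and zero, each is the
largest one on its side of the cut-offs. -/
theorem linear_payoff_comparison {S D a x0 x1 p : ℝ} (hσv : 0 < σv) (hS0 : 0 ≤ S) (hS1 : S ≤ 1)
    (hx : x0 ≤ x1) (hi0 : S * x0 - D = 0) (hi1 : σv * x1 - a = σv * (S * x1 - D)) :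
    (x1 ≤ p → σv * (S * p - D) ≤ σv * p - a ∧ 0 ≤ σv * p - a) ∧
    (x0 ≤ p → p ≤ x1 → σv * p - a ≤ σv * (S * p - D) ∧ 0 ≤ σv * (S * p - D)) ∧
    (p ≤ x0 → σv * p - a ≤ 0 ∧ σv * (S * p - D) ≤ 0) := by
  -- The two indifference equations make each payoff difference a nonnegative multiple of the
  -- distance to a cut-off, so its sign can be read off.
  have e1 : σv * p - a - σv * (S * p - D) = σv * ((1 - S) * (p - x1)) := by linarith
  have e2 : σv * (S * p - D) = σv * (S * (p - x0)) := by
    rw [show D = S * x0 by linarith]; ring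
  have hS : 0 ≤ 1 - S := by linarith
  refine ⟨fun h => ?_, fun h h' => ?_, fun h => ?_⟩
  · have h1 := mul_nonneg hσv.le (mul_nonneg hS (sub_nonneg.2 h))
    have h2 := mul_nonneg hσv.le (mul_nonneg hS0 (sub_nonneg.2 (hx.trans h)))
    constructor <;> linarith
  · have h1 := mul_nonneg hσv.le (mul_nonneg hS (sub_nonneg.2 h'))
    have h2 := mul_nonneg hσv.le (mul_nonneg hS0 (sub_nonneg.2 h))
    constructor <;> linarith
  · have h1 := mul_nonneg hσv.le (mul_nonneg hS (sub_nonneg.2 (h.trans hx)))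
    have h2 := mul_nonneg hσv.le (mul_nonneg hS0 (sub_nonneg.2 h))
    constructor <;> linarith

theorem informedOptimal_of_cutoffs (hσv : 0 < σv) (hσe : 0 < σe) {E : Candidate} {s0 s1 : ℝ}
    (h0 : 0 < s0) (h1 : s0 < s1) (hI : ∀ s, E.hI s = informedCutoff s0 s1 s)
    (hS0 : 0 ≤ E.Rwrong + E.Rright) (hS1 : E.Rwrong + E.Rright ≤ 2)
    (hi0 : (E.Rwrong + E.Rright) / 2 * delayCutoff σv σe s0 - (E.Rwrong - E.Rright) / 2 = 0)
    (hi1 : σv * delayCutoff σv σe s1 - E.A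
      = σv * ((E.Rwrong + E.Rright) / 2 * delayCutoff σv σe s1 - (E.Rwrong - E.Rright) / 2)) :
    InformedOptimal σv σe E := by
  intro s dir qe qd he hd hq
  have hxm := (strictMono_delayCutoff hσv hσe).monotone
  obtain ⟨l1, l2, l3⟩ := linear_payoff_comparison (p := delayCutoff σv σe |s|) hσv
    (show 0 ≤ (E.Rwrong + E.Rright) / 2 by linarith) (by linarith) (hxm h1.le) hi0 hi1
  have ue := informedUnitPayoff_exchange_le hσv hσe E dir s
  have ud := informedUnitPayoff_darkPool_le hσv hσe E hS0 dir s
  rw [hI]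
  have key : ∀ m, informedUnitPayoff σv σe E dir s .exchange ≤ m →
      informedUnitPayoff σv σe E dir s .darkPool ≤ m → 0 ≤ m →
      qe * informedUnitPayoff σv σe E dir s .exchange
        + qd * informedUnitPayoff σv σe E dir s .darkPool ≤ m := fun m a b c => by
    simpa using split_order_le he hd hq a b c
  rcases informedPayoff_cutoff hσe E h0 h1 s with ⟨c, e⟩ | ⟨c, c', e⟩ | ⟨c, e⟩
  · rw [e]
    have := l1 (hxm c)
    exact key _ ue (ud.trans this.1) this.2
  · rw [e]
    have := l2 (hxm c) (hxm c')
    exact key _ (ue.trans this.1) ud this.2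
  · rw [e]
    have := l3 (hxm c)
    exact key _ (ue.trans this.1) (ud.trans this.2) le_rfl

theorem liquidityOptimal_of_cutoffs (hσv : 0 < σv) (hσe : 0 < σe) {E : Candidate} {s0 s1 : ℝ}
    (h1 : s0 < s1) (hU : ∀ side d, E.hU side d = liquidityCutoff σv σe s0 s1 d)
    (hS0 : 0 ≤ E.Rwrong + E.Rright) (hS1 : E.Rwrong + E.Rright ≤ 2)
    (hi0 : (E.Rwrong + E.Rright) / 2 * delayCutoff σv σe s0 - (E.Rwrong - E.Rright) / 2 = 0)
    (hi1 : σv * delayCutoff σv σe s1 - E.A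
      = σv * ((E.Rwrong + E.Rright) / 2 * delayCutoff σv σe s1 - (E.Rwrong - E.Rright) / 2)) :
    LiquidityOptimal M σv E := by
  intro side d _ qe qd he hd hq
  have hxm := (strictMono_delayCutoff hσv hσe).monotone
  obtain ⟨l1, l2, l3⟩ := linear_payoff_comparison (p := d) hσv
    (show 0 ≤ (E.Rwrong + E.Rright) / 2 by linarith) (by linarith) (hxm h1.le) hi0 hi1
  have ud := liquidityPayoff_darkPool (σv := σv) E d
  have ue : liquidityPayoff σv E d (.trade .exchange) = -E.A := rfl
  have u0 : liquidityPayoff σv E d .delay = -(σv * d) := rfl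
  rw [hU]
  refine split_order_le he hd hq ?_ ?_ ?_ <;>
  · unfold liquidityCutoff
    split_ifs with c1 c2
    · have := l1 c1
      simp only [ue, ud, u0]
      linarith
    · have := l2 c2.1 c2.2.le
      simp only [ue, ud, u0]
      linarith
    · have := l3 (by
        by_contra h
        exact c2 ⟨by linarith, by linarith⟩)
      simp only [ue, ud, u0]
      linarith

theorem exists_equilibrium (hM : M.Admissible) (hσv : 0 < σv) (hσe : 0 < σe) :
    ∃ (E : Candidate) (s0 s1 : ℝ), IsEquilibrium M σv σe E ∧
      (∀ s : ℝ, E.hI s = informedCutoff s0 s1 s) ∧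
      (∀ (side : Side) (d : ℝ), E.hU side d = liquidityCutoff σv σe s0 s1 d) ∧
      CutoffSystem M σv σe E s0 s1 := by
  obtain ⟨s0, s1, h0, h1, e0, e1⟩ := exists_cutoffs hM hσv hσe
  set E := cutoffCandidate M σv σe s0 s1 with hE
  have hW : E.Rwrong = cutWrong M σv σe s0 s1 := rateWrong_cut hM hσv hσe h0.le h1
  have hr : E.Rright = cutRight M σv σe s0 s1 := rateRight_cut hM hσv hσe h0.le h1
  have hA : E.A = cutSpread M σv σe s1 * σv := rfl
  have hr0 : 0 ≤ E.Rright := hr ▸ cutRight_nonneg hM hσv hσe s0 s1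
  have hW1 : E.Rwrong ≤ 1 := hW ▸ cutWrong_le_one hM hσv hσe s0 s1
  have hrW : E.Rright < E.Rwrong := by
    rw [hW, hr]
    exact cutRight_lt_cutWrong hM hσv hσe h0.le (h0.trans h1)
  rw [← hW, ← hr] at e0 e1
  have hi0 : (E.Rwrong + E.Rright) / 2 * delayCutoff σv σe s0 - (E.Rwrong - E.Rright) / 2 = 0 := by
    linarith
  have hi1 : σv * delayCutoff σv σe s1 - E.A
      = σv * ((E.Rwrong + E.Rright) / 2 * delayCutoff σv σe s1 - (E.Rwrong - E.Rright) / 2) := by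
    have e2 : delayCutoff σv σe s1 - cutSpread M σv σe s1
        = (E.Rwrong + E.Rright) / 2 * delayCutoff σv σe s1 - (E.Rwrong - E.Rright) / 2 := by
      rw [e1]; linarith
    rw [← e2, hA]
    ring
  have hDpos : 0 < E.gammaDright := by
    change 0 < cutGammaDright σv σe s0 s1
    rw [cutGammaDright_eq hσe h1.le]
    exact mul_pos (sub_pos.2 h1) (meanDensity_pos hσe _ _ _)
  refine ⟨E, s0, s1, ⟨?_, ?_, ⟨?_, ?_⟩, ⟨fun _ => ⟨rfl, rfl⟩, ?_⟩, ?_⟩, fun _ => rfl,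
    fun _ _ => rfl, ?_⟩
  · exact informedOptimal_of_cutoffs hσv hσe h0 h1 (fun _ => rfl) (by linarith) (by linarith)
      hi0 hi1
  · exact liquidityOptimal_of_cutoffs hσv hσe h1 (fun _ _ => rfl) (by linarith) (by linarith)
      hi0 hi1
  · exact breakEven_of_spread hM (cutSpread_denom_pos hM hσe s1) rfl
  -- Both venues are active, so the limit conventions for empty venues are vacuous here and in the
  -- next goal.
  · exact fun h => absurd h.1 (cutGammaEright_pos hσe s1).ne'
  · exact fun h => absurd h.1 hDpos.ne'
  · exact fractionsConsistent_cutoffCandidate hM hσv hσe h0 h1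
  · exact cutoffSystem_of_indifferent hM hσv hσe h0 h1 hi0 hi1 rfl rfl rfl rfl rfl rfl rfl rfl rfl


end

section

/-! ### Every equilibrium is a non-trivial cut-off equilibrium -/

variable {M : Market Ω} {σv σe : ℝ} {E : Candidate}

theorem InformedOptimal.le (h : InformedOptimal σv σe E) (s : ℝ) (b : InformedAction) :
    informedPayoff σv σe E s b ≤ informedPayoff σv σe E s (E.hI s) := by
  rcases b with ⟨dir, _ | _⟩ | _
  · simpa [informedPayoff] using h s dir 1 0 zero_le_one le_rfl (by norm_num)
  · simpa [informedPayoff] using h s dir 0 1 le_rfl zero_le_one (by norm_num)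
  · simpa [informedPayoff] using h s .buy 0 0 le_rfl le_rfl (by norm_num)

/-- The premise `b = E.hI s` allows discarding actions that the trader is already known not to take.
-/
theorem InformedOptimal.eq_of_lt (h : InformedOptimal σv σe E) {s : ℝ} {a : InformedAction}
    (ha : ∀ b, b ≠ a → b = E.hI s → informedPayoff σv σe E s b < informedPayoff σv σe E s a) :
    E.hI s = a := by
  by_contra hne
  exact (ha _ hne rfl).not_ge (h.le s a)

theorem LiquidityOptimal.le (h : LiquidityOptimal M σv E) (side : Side) {d : ℝ}
    (hd : d ∈ Icc 0 M.dBar) (b : LiquidityAction) :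
    liquidityPayoff σv E d b ≤ liquidityPayoff σv E d (E.hU side d) := by
  rcases b with ⟨_ | _⟩ | _
  · simpa using h side d hd 1 0 zero_le_one le_rfl (by norm_num)
  · simpa using h side d hd 0 1 le_rfl zero_le_one (by norm_num)
  · simpa using h side d hd 0 0 le_rfl le_rfl (by norm_num)

theorem LiquidityOptimal.eq_of_lt (h : LiquidityOptimal M σv E) (side : Side) {d : ℝ}
    (hd : d ∈ Icc 0 M.dBar) {a : LiquidityAction}
    (ha : ∀ b, b ≠ a → b = E.hU side d → liquidityPayoff σv E d b < liquidityPayoff σv E d a) :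
    E.hU side d = a := by
  by_contra hne
  exact (ha _ hne rfl).not_ge (h.le side hd a)

/-- A set of full measure is dense. This produces a trader near a given signal who avoids prescribed
null actions. -/
theorem exists_of_ae_of_eventually {p q : ℝ → Prop} {s : ℝ} (hp : ∀ᵐ t ∂(volume : Measure ℝ), p t)
    (hq : ∀ᶠ t in 𝓝 s, q t) : ∃ t, p t ∧ q t := by
  obtain ⟨t, hpt, hqt⟩ := (Measure.dense_of_ae hp).inter_nhds_nonempty hq
  exact ⟨t, hpt, hqt⟩

theorem nonneg_of_delayCutoff_nonneg (hσv : 0 < σv) (hσe : 0 < σe) {s : ℝ}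
    (h : 0 ≤ delayCutoff σv σe s) : 0 ≤ s := by
  rwa [← delayCutoff_zero (σv := σv) hσe, (strictMono_delayCutoff hσv hσe).le_iff_le] at h

/-- Informed participation in a venue whose buyers have positive signals is zero, or greater in the
right than in the wrong direction. -/
theorem participation_dichotomy (hσv : 0 < σv) (hσe : 0 < σe) {B C : Set ℝ} {gR gW : ℝ}
    (hB : MeasurableSet B) (hB0 : B ⊆ Ici 0) (hR : (signalLaw σe σv).real B = gR)
    (hW : (signalLaw σe (-σv)).real B = gW) (hC : (signalLaw σe σv).real C = gW) :
    (gR = 0 ∧ gW = 0 ∧ volume B = 0 ∧ volume C = 0) ∨ (0 < gW ∧ gW < gR ∧ volume B ≠ 0) := by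
  by_cases h : volume B = 0
  · have h1 := (signalLaw_real_eq_zero_iff hσe σv B).2 h
    have h2 := (signalLaw_real_eq_zero_iff hσe (-σv) B).2 h
    refine Or.inl ⟨hR ▸ h1, hW ▸ h2, h, ?_⟩
    rw [← signalLaw_real_eq_zero_iff hσe σv, hC, ← hW, h2]
  · exact Or.inr ⟨hW ▸ signalLaw_real_pos hσe _ h, hW ▸ hR ▸ signalLaw_neg_lt hσv hσe hB hB0 h, h⟩

namespace IsEquilibrium

/-- Comparing a purchase with a sale in the exchange shows that buyers have x ≥ 0, so the likelihood
ratio favours the right direction. -/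
theorem exchange_dichotomy (hE : IsEquilibrium M σv σe E) (hσv : 0 < σv) (hσe : 0 < σe) :
    (E.gammaEright = 0 ∧ E.gammaEwrong = 0 ∧ volume {s | E.hI s = .trade .buy .exchange} = 0 ∧
      volume {s | E.hI s = .trade .sell .exchange} = 0) ∨
    (0 < E.gammaEwrong ∧ E.gammaEwrong < E.gammaEright ∧
      volume {s | E.hI s = .trade .buy .exchange} ≠ 0) := by
  refine participation_dichotomy hσv hσe (hE.fractions.measurable_hI _) (fun s hs => ?_)
    hE.fractions.eright_high hE.fractions.ewrong_low hE.fractions.ewrong_high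
  have h := hE.informed_optimal.le s (.trade .sell .exchange)
  rw [show E.hI s = _ from hs, informedPayoff, informedPayoff, informedUnitPayoff_buy_exchange,
    informedUnitPayoff_sell_exchange] at h
  refine nonneg_of_delayCutoff_nonneg hσv hσe ?_
  exact nonneg_of_mul_nonneg_right (by linarith : 0 ≤ σv * delayCutoff σv σe s) hσv

/-- As for the exchange. A positive sum of rates is needed for the direction of a pool order to
matter. -/
theorem darkPool_dichotomy (hE : IsEquilibrium M σv σe E) (hσv : 0 < σv) (hσe : 0 < σe)
    (hS : 0 < E.Rwrong + E.Rright) :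
    (E.gammaDright = 0 ∧ E.gammaDwrong = 0 ∧ volume {s | E.hI s = .trade .buy .darkPool} = 0 ∧
      volume {s | E.hI s = .trade .sell .darkPool} = 0) ∨
    (0 < E.gammaDwrong ∧ E.gammaDwrong < E.gammaDright ∧
      volume {s | E.hI s = .trade .buy .darkPool} ≠ 0) := by
  refine participation_dichotomy hσv hσe (hE.fractions.measurable_hI _) (fun s hs => ?_)
    hE.fractions.dright_high hE.fractions.dwrong_low hE.fractions.dwrong_high
  have h := hE.informed_optimal.le s (.trade .sell .darkPool)
  rw [show E.hI s = _ from hs, informedPayoff, informedPayoff, informedUnitPayoff_buy_darkPool,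
    informedUnitPayoff_sell_darkPool] at h
  refine nonneg_of_delayCutoff_nonneg hσv hσe ?_
  have h2 := le_of_mul_le_mul_left h hσv
  exact nonneg_of_mul_nonneg_right
    (by linarith : 0 ≤ (E.Rwrong + E.Rright) / 2 * delayCutoff σv σe s) (by linarith)

theorem alphaE_nonneg (hE : IsEquilibrium M σv σe E) : 0 ≤ E.alphaE :=
  hE.fractions.alphaE_eq .buyer ▸ measureReal_nonneg

theorem alphaD_nonneg (hE : IsEquilibrium M σv σe E) : 0 ≤ E.alphaD :=
  hE.fractions.alphaD_eq .buyer ▸ measureReal_nonneg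

/-- The spread is positive, unless no informed speculator trades in the exchange. -/
theorem spread_dichotomy (hE : IsEquilibrium M σv σe E) (hM : M.Admissible) (hσv : 0 < σv)
    (hσe : 0 < σe) :
    (E.A = 0 ∧ volume {s | E.hI s = .trade .buy .exchange} = 0 ∧
      volume {s | E.hI s = .trade .sell .exchange} = 0) ∨
    (0 < E.A ∧ volume {s | E.hI s = .trade .buy .exchange} ≠ 0) := by
  have hα := hE.alphaE_nonneg
  rcases hE.exchange_dichotomy hσv hσe with ⟨h1, h2, h3, h4⟩ | ⟨h1, h2, h3⟩
  · refine Or.inl ⟨?_, h3, h4⟩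
    rcases hα.eq_or_lt with h | h
    -- Without any trade break-even is no restriction. The limit convention fixes the spread, and
    -- `tendsto_cutSpread` makes it zero.
    · have ht := hE.break_even.2 ⟨h1, h2, h.symm⟩
      have h0 : Tendsto (fun s1 => cutSpread M σv σe s1 * σv) atTop (𝓝 (0 * σv)) :=
        (tendsto_cutSpread hM hσv hσe).mul_const σv
      rw [zero_mul] at h0
      exact tendsto_nhds_unique ht h0
    -- With liquidity traders only, the market maker's expected profit is A·alphaE·muZ, so A = 0.
    · have h0 := hE.break_even.1
      rw [integral_marketMakerPayoff hM, h1, h2] at h0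
      have h5 : E.A * (E.alphaE * M.muZ) = 0 := by linarith
      exact (mul_eq_zero.1 h5).resolve_right (mul_pos h hM.muZ_pos).ne'
  · have hz : 0 ≤ M.muZ / M.mu := (div_pos hM.muZ_pos hM.mu_pos).le
    have hpos : 0 < E.gammaEright + E.gammaEwrong + E.alphaE * (M.muZ / M.mu) := by
      have := mul_nonneg hα hz
      linarith
    refine Or.inr ⟨?_, h3⟩
    rw [spread_of_breakEven hM hE.break_even.1 hpos]
    exact mul_pos (div_pos (sub_pos.2 h2) hpos) hσv

theorem ae_ne_of_volume_eq_zero {a : InformedAction} (h : volume {s | E.hI s = a} = 0) :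
    ∀ᵐ s ∂(volume : Measure ℝ), E.hI s ≠ a := by
  rw [ae_iff]
  simpa using h

/-- If informed speculators avoid the dark pool then the spread is positive. -/
theorem spread_pos_of_darkPool_null (hE : IsEquilibrium M σv σe E) (hM : M.Admissible)
    (hσv : 0 < σv) (hσe : 0 < σe) (hb : ∀ᵐ s ∂(volume : Measure ℝ), E.hI s ≠ .trade .buy .darkPool)
    (hs : ∀ᵐ s ∂(volume : Measure ℝ), E.hI s ≠ .trade .sell .darkPool) :
    0 < E.A ∧ volume {s | E.hI s = .trade .buy .exchange} ≠ 0 := by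
  rcases hE.spread_dichotomy hM hσv hσe with ⟨hA, h1, h2⟩ | h
  · exfalso
    -- At zero spread a positive signal earns a profit in the exchange, yet almost every such trader
    -- would have to stay out of both venues.
    obtain ⟨s, ⟨⟨⟨c1, c2⟩, c3⟩, c4⟩, c5⟩ := exists_of_ae_of_eventually
      (((hb.and hs).and (ae_ne_of_volume_eq_zero h1)).and (ae_ne_of_volume_eq_zero h2))
      (lt_mem_nhds (zero_lt_one' ℝ))
    have h := hE.informed_optimal.le s (.trade .buy .exchange)
    have hx := mul_pos hσv (delayCutoff_pos hσv hσe c5)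
    rw [informedPayoff, informedUnitPayoff_buy_exchange, hA] at h
    rcases hh : E.hI s with ⟨_ | _, _ | _⟩ | _
    · exact c3 hh
    · exact c1 hh
    · exact c4 hh
    · exact c2 hh
    · rw [hh, informedPayoff] at h
      linarith
  · exact h

/-- The dark pool cannot be empty. -/
theorem not_emptyPool (hE : IsEquilibrium M σv σe E) (hM : M.Admissible) (hσv : 0 < σv)
    (hσe : 0 < σe) : ¬ EmptyPool E := by
  intro hemp
  obtain ⟨g1, g2, g3⟩ := hemp
  have hb : ∀ᵐ s ∂(volume : Measure ℝ), E.hI s ≠ .trade .buy .darkPool := by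
    refine ae_ne_of_volume_eq_zero ?_
    rw [← signalLaw_real_eq_zero_iff hσe σv, hE.fractions.dright_high, g1]
  have hs : ∀ᵐ s ∂(volume : Measure ℝ), E.hI s ≠ .trade .sell .darkPool := by
    refine ae_ne_of_volume_eq_zero ?_
    rw [← signalLaw_real_eq_zero_iff hσe σv, hE.fractions.dwrong_high, g2]
  have hd : ∀ side : Side, ∀ᵐ d ∂M.nu, E.hU side d ≠ .trade .darkPool := by
    intro side
    have := hM.prob_nu
    have h := hE.fractions.alphaD_eq side
    rw [g3, measureReal_eq_zero_iff] at h
    rw [ae_iff]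
    simpa using h
  obtain ⟨hA, hvol⟩ := hE.spread_pos_of_darkPool_null hM hσv hσe hb hs
  obtain ⟨s', hs'⟩ := nonempty_of_measure_ne_zero hvol
  have hA1 : E.A < σv := by
    have h := hE.informed_optimal.le s' .noTrade
    rw [show E.hI s' = _ from hs', informedPayoff, informedPayoff,
      informedUnitPayoff_buy_exchange] at h
    have := mul_lt_mul_of_pos_left (delayCutoff_lt_one (σv := σv) hσe s') hσv
    linarith
  -- With the pool unused, the choice is between the exchange and inaction, with indifference at
  -- x(s) = A/σv.
  obtain ⟨s, hxs⟩ := exists_delayCutoff_eq hσv hσe (x := E.A / σv)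
    (by have := div_pos hA hσv; linarith) ((div_lt_one hσv).2 hA1)
  have hAs : σv * delayCutoff σv σe s = E.A := by rw [hxs, mul_div_cancel₀ _ hσv.ne']
  have hs0 : 0 < s := by
    rw [← (strictMono_delayCutoff hσv hσe).lt_iff_lt, delayCutoff_zero hσe, hxs]
    exact div_pos hA hσv
  have hmono := strictMono_delayCutoff hσv hσe
  -- Off the indifferent points this comparison is strict, so almost all traders follow the
  -- degenerate cut-offs s, s and the limit convention for the rates applies.
  have hcut : AECutoff M σv σe E s s := by
    refine ⟨?_, fun side => ?_⟩
    · have hne : ∀ t : ℝ, ∀ᵐ u ∂(volume : Measure ℝ), u ≠ t := fun t => by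
        simp [ae_iff]
      filter_upwards [hb, hs, hne s, hne (-s)] with t c1 c2 c3 c4
      refine hE.informed_optimal.eq_of_lt fun b hb1 hb2 => ?_
      rw [← hb2] at c1 c2
      unfold informedCutoff at hb1 ⊢
      rcases lt_or_gt_of_ne c3 with h | h
      · rcases lt_or_gt_of_ne c4 with h' | h'
        · rw [if_neg (by linarith), if_neg (by grind), if_neg (by grind), if_pos h'] at hb1 ⊢
          have h5 := mul_lt_mul_of_pos_left (hmono h') hσv
          rw [delayCutoff_neg hσe] at h5
          rcases b with ⟨_ | _, _ | _⟩ | _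
          · simp only [informedPayoff, informedUnitPayoff_sell_exchange,
              informedUnitPayoff_buy_exchange]
            linarith
          · exact absurd rfl c1
          · exact absurd rfl hb1
          · exact absurd rfl c2
          · simp only [informedPayoff, informedUnitPayoff_sell_exchange]
            linarith
        · rw [if_neg (by linarith), if_neg (by grind), if_neg (by grind),
            if_neg (by linarith)] at hb1 ⊢
          have h5 := mul_lt_mul_of_pos_left (hmono h') hσv
          have h6 := mul_lt_mul_of_pos_left (hmono h) hσv
          rw [delayCutoff_neg hσe] at h5
          rcases b with ⟨_ | _, _ | _⟩ | _
          · simp only [informedPayoff, informedUnitPayoff_buy_exchange]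
            linarith
          · exact absurd rfl c1
          · simp only [informedPayoff, informedUnitPayoff_sell_exchange]
            linarith
          · exact absurd rfl c2
          · exact absurd rfl hb1
      · rw [if_pos (le_of_lt h)] at hb1 ⊢
        have h5 := mul_lt_mul_of_pos_left (hmono h) hσv
        rcases b with ⟨_ | _, _ | _⟩ | _
        · exact absurd rfl hb1
        · exact absurd rfl c1
        · simp only [informedPayoff, informedUnitPayoff_sell_exchange,
            informedUnitPayoff_buy_exchange]
          linarith
        · exact absurd rfl c2
        · simp only [informedPayoff, informedUnitPayoff_buy_exchange]
          linarith
    · have := hM.nullSingletonClass_nu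
      have hne : ∀ᵐ d ∂M.nu, d ≠ delayCutoff σv σe s := by
        simp [ae_iff]
      have hsupp : ∀ᵐ d ∂M.nu, d ∈ Icc 0 M.dBar := by
        rw [ae_iff]
        exact hM.nu_support
      filter_upwards [hd side, hne, hsupp] with d c1 c2 c3
      refine hE.liquidity_optimal.eq_of_lt side c3 fun b hb1 hb2 => ?_
      rw [← hb2] at c1
      unfold liquidityCutoff at hb1 ⊢
      rcases lt_or_gt_of_ne c2 with h | h
      · have h5 := mul_lt_mul_of_pos_left h hσv
        rw [if_neg (by linarith), if_neg (by grind)] at hb1 ⊢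
        rcases b with ⟨_ | _⟩ | _
        · simp only [liquidityPayoff]; linarith
        · exact absurd rfl c1
        · exact absurd rfl hb1
      · have h5 := mul_lt_mul_of_pos_left h hσv
        rw [if_pos (le_of_lt h)] at hb1 ⊢
        rcases b with ⟨_ | _⟩ | _
        · exact absurd rfl hb1
        · exact absurd rfl c1
        · simp only [liquidityPayoff]; linarith
  obtain ⟨tW, tR⟩ := hE.rates.2 ⟨g1, g2, g3⟩ s hs0.le hcut
  have hpath : Tendsto (fun ε : ℝ => ((s, s + ε) : ℝ × ℝ)) (𝓝[>] 0) (𝓝 (s, s)) := by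
    have : Continuous fun ε : ℝ => ((s, s + ε) : ℝ × ℝ) := by fun_prop
    have := this.tendsto 0
    rw [add_zero] at this
    exact this.mono_left nhdsWithin_le_nhds
  have hW : E.Rwrong = cutWrong M σv σe s s := by
    refine tendsto_nhds_unique tW ?_
    refine (((continuous_cutWrong hM hσv hσe).tendsto (s, s)).comp hpath).congr' ?_
    filter_upwards [self_mem_nhdsWithin] with ε hε
    exact (rateWrong_cut hM hσv hσe hs0.le (lt_add_of_pos_right s hε)).symm
  have hR : E.Rright = cutRight M σv σe s s := by
    refine tendsto_nhds_unique tR ?_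
    refine (((continuous_cutRight hM hσv hσe).tendsto (s, s)).comp hpath).congr' ?_
    filter_upwards [self_mem_nhdsWithin] with ε hε
    exact (rateRight_cut hM hσv hσe hs0.le (lt_add_of_pos_right s hε)).symm
  -- At s the exchange and inaction both yield zero, while the pool at the limit rates yields
  -- strictly more. By continuity this holds nearby, contradicting the almost sure absence of pool
  -- orders.
  have hpos := darkPool_payoff_self_pos hM hσv hσe hs0
  rw [← hW, ← hR] at hpos
  have hx := continuous_delayCutoff (σv := σv) hσe
  have hgt : 0 < (E.Rwrong + E.Rright) / 2 * delayCutoff σv σe s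
      - (E.Rwrong - E.Rright) / 2 := by linarith
  have e1 : ∀ᶠ t in 𝓝 s, 0 < σv * ((E.Rwrong + E.Rright) / 2 * delayCutoff σv σe t
      - (E.Rwrong - E.Rright) / 2) :=
    continuousAt_const.eventually_lt (by fun_prop) (mul_pos hσv hgt)
  have e2 : ∀ᶠ t in 𝓝 s, σv * delayCutoff σv σe t - E.A
      < σv * ((E.Rwrong + E.Rright) / 2 * delayCutoff σv σe t - (E.Rwrong - E.Rright) / 2) :=
    ContinuousAt.eventually_lt (by fun_prop) (by fun_prop)
      (by rw [hAs, sub_self]; exact mul_pos hσv hgt)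
  obtain ⟨t, ⟨c1, c2⟩, ⟨d1, d2⟩, d3⟩ := exists_of_ae_of_eventually (hb.and hs)
    ((e1.and e2).and (lt_mem_nhds hs0))
  have h := hE.informed_optimal.le t (.trade .buy .darkPool)
  have hxt := mul_pos hσv (delayCutoff_pos hσv hσe d3)
  rw [informedPayoff, informedUnitPayoff_buy_darkPool] at h
  rcases hh : E.hI t with ⟨_ | _, _ | _⟩ | _
  · rw [hh, informedPayoff, informedUnitPayoff_buy_exchange] at h
    linarith
  · exact c1 hh
  · rw [hh, informedPayoff, informedUnitPayoff_sell_exchange] at h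
    linarith
  · exact c2 hh
  · rw [hh, informedPayoff] at h
    linarith

/-- The equilibrium rates are those of an active dark pool. -/
theorem rates_eq (hE : IsEquilibrium M σv σe E) (hM : M.Admissible) (hσv : 0 < σv)
    (hσe : 0 < σe) : E.Rwrong = rateWrong M E.gammaDright E.gammaDwrong E.alphaD ∧
      E.Rright = rateRight M E.gammaDright E.gammaDwrong E.alphaD :=
  hE.rates.1 (hE.not_emptyPool hM hσv hσe)

theorem one_le_rates (hE : IsEquilibrium M σv σe E) (hM : M.Admissible) (hσv : 0 < σv)
    (hσe : 0 < σe) : 1 ≤ E.Rwrong + E.Rright ∧ 0 ≤ E.Rright ∧ E.Rwrong ≤ 1 := by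
  have h1 : 0 ≤ E.gammaDright := hE.fractions.dright_high ▸ measureReal_nonneg
  have h2 : 0 ≤ E.gammaDwrong := hE.fractions.dwrong_high ▸ measureReal_nonneg
  have h3 := hE.alphaD_nonneg
  obtain ⟨hW, hR⟩ := hE.rates_eq hM hσv hσe
  rw [hW, hR]
  exact ⟨hM.one_le_rate_add h1 h2 h3, hM.rateRight_nonneg h1 h2 h3, hM.rateWrong_le_one h1 h2 h3⟩

/-- Informed speculators trade in the dark pool and in the exchange. -/
theorem venues_active (hE : IsEquilibrium M σv σe E) (hM : M.Admissible) (hσv : 0 < σv)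
    (hσe : 0 < σe) : E.Rright < E.Rwrong ∧ 0 < E.A ∧
      volume {s | E.hI s = .trade .buy .exchange} ≠ 0 ∧
      volume {s | E.hI s = .trade .buy .darkPool} ≠ 0 := by
  obtain ⟨hS, hr0, hW1⟩ := hE.one_le_rates hM hσv hσe
  obtain ⟨hW, hR⟩ := hE.rates_eq hM hσv hσe
  rcases hE.darkPool_dichotomy hσv hσe (by linarith) with ⟨g1, g2, v1, v2⟩ | ⟨g1, g2, v1⟩
  · exfalso
    have hb := ae_ne_of_volume_eq_zero v1
    have hs := ae_ne_of_volume_eq_zero v2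
    obtain ⟨hA, -⟩ := hE.spread_pos_of_darkPool_null hM hσv hσe hb hs
    -- With no informed orders in the pool, exchangeability equates the two rates.
    have hD : E.Rright = E.Rwrong := by
      rw [hR, hW, g1, g2, hM.rateRight_swap]
      rfl
    have hx := continuous_delayCutoff (σv := σv) hσe
    have e1 : ∀ᶠ t in 𝓝 (0 : ℝ), σv * delayCutoff σv σe t < E.A :=
      ContinuousAt.eventually_lt (by fun_prop) continuousAt_const
        (by rw [delayCutoff_zero hσe, mul_zero]; exact hA)
    obtain ⟨δ, hδ, hδ'⟩ := Metric.eventually_nhds_iff.1 e1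
    -- A positive signal too weak to pay the spread still profits in a pool without adverse
    -- selection.
    obtain ⟨t, ⟨c1, c2⟩, d1, d2⟩ := exists_of_ae_of_eventually (hb.and hs) (s := δ / 2)
      ((lt_mem_nhds (half_pos hδ)).and (gt_mem_nhds (half_lt_self hδ)))
    have d3 : σv * delayCutoff σv σe t < E.A := hδ' (by
      rw [Real.dist_eq, sub_zero, abs_of_pos d1]; exact d2)
    have hxt := delayCutoff_pos hσv hσe d1
    have h := hE.informed_optimal.le t (.trade .buy .darkPool)
    rw [informedPayoff, informedUnitPayoff_buy_darkPool, hD] at h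
    have h5 := mul_pos hσv (mul_pos (show 0 < (E.Rwrong + E.Rwrong) / 2 by linarith) hxt)
    have h6 := mul_pos hσv hxt
    rcases hh : E.hI t with ⟨_ | _, _ | _⟩ | _
    · rw [hh, informedPayoff, informedUnitPayoff_buy_exchange] at h
      linarith
    · exact c1 hh
    · rw [hh, informedPayoff, informedUnitPayoff_sell_exchange] at h
      linarith
    · exact c2 hh
    · rw [hh, informedPayoff] at h
      linarith
  · have hlt : E.Rright < E.Rwrong := by
      rw [hW, hR]
      exact hM.rateRight_lt_rateWrong g1.le g2 hE.alphaD_nonneg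
    rcases hE.spread_dichotomy hM hσv hσe with ⟨hA, -, -⟩ | h
    · exfalso
      obtain ⟨s, hs⟩ := nonempty_of_measure_ne_zero v1
      have h := hE.informed_optimal.le s (.trade .buy .exchange)
      have h' := hE.informed_optimal.le s .noTrade
      rw [show E.hI s = _ from hs] at h h'
      simp only [informedPayoff, informedUnitPayoff_buy_darkPool, informedUnitPayoff_buy_exchange,
        hA] at h h'
      have h2 : delayCutoff σv σe s ≤ (E.Rwrong + E.Rright) / 2 * delayCutoff σv σe s
          - (E.Rwrong - E.Rright) / 2 := le_of_mul_le_mul_left (by linarith) hσv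
      have h3 : 0 ≤ (E.Rwrong + E.Rright) / 2 * delayCutoff σv σe s
          - (E.Rwrong - E.Rright) / 2 := nonneg_of_mul_nonneg_right h' hσv
      have h4 : 0 < delayCutoff σv σe s :=
        pos_of_mul_pos_right (show 0 < (E.Rwrong + E.Rright) / 2 * delayCutoff σv σe s by linarith)
          (by linarith)
      -- At zero spread `h2` reads (1 - S)·x + D ≤ 0, which is impossible for S ≤ 1, x > 0 and D >
      -- 0.
      nlinarith
    · exact ⟨hlt, h.1, h.2, v1⟩

/-- The cut-offs of an equilibrium. -/
theorem exists_indifferent (hE : IsEquilibrium M σv σe E) (hM : M.Admissible) (hσv : 0 < σv)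
    (hσe : 0 < σe) : ∃ s0 s1 : ℝ, 0 < s0 ∧ s0 < s1 ∧
      (E.Rwrong + E.Rright) / 2 * delayCutoff σv σe s0 - (E.Rwrong - E.Rright) / 2 = 0 ∧
      σv * delayCutoff σv σe s1 - E.A
        = σv * ((E.Rwrong + E.Rright) / 2 * delayCutoff σv σe s1 - (E.Rwrong - E.Rright) / 2) := by
  obtain ⟨hS, hr0, hW1⟩ := hE.one_le_rates hM hσv hσe
  obtain ⟨hlt, hA, v1, v2⟩ := hE.venues_active hM hσv hσe
  set S := (E.Rwrong + E.Rright) / 2 with hSdef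
  set D := (E.Rwrong - E.Rright) / 2 with hDdef
  have hS0 : 0 < S := by linarith
  have hS1 : 0 < 1 - S := by linarith
  have hD0 : 0 < D := by linarith
  have hmono := strictMono_delayCutoff hσv hσe
  set x0 := D / S with hx0
  set x1 := (E.A / σv - D) / (1 - S) with hx1
  have hx0p : 0 < x0 := div_pos hD0 hS0
  have eA : σv * (E.A / σv) = E.A := mul_div_cancel₀ _ hσv.ne'
  -- Some trader buys in the exchange and weakly prefers it to the pool, so x1 is at most that
  -- trader's x. This keeps x1 in the range of `delayCutoff`.
  have hx1lt : x1 < 1 := by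
    obtain ⟨s, hs⟩ := nonempty_of_measure_ne_zero v1
    have h := hE.informed_optimal.le s (.trade .buy .darkPool)
    rw [show E.hI s = _ from hs] at h
    simp only [informedPayoff, informedUnitPayoff_buy_darkPool,
      informedUnitPayoff_buy_exchange] at h
    refine lt_of_le_of_lt ?_ (delayCutoff_lt_one (σv := σv) hσe s)
    rw [hx1, div_le_iff₀ hS1]
    have h2 : S * delayCutoff σv σe s - D ≤ delayCutoff σv σe s - E.A / σv :=
      le_of_mul_le_mul_left (by rw [mul_sub σv _ (E.A / σv), eA]; exact h) hσv
    linarith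
  have hsub : {s | E.hI s = .trade .buy .darkPool} ⊆ {s | x0 ≤ delayCutoff σv σe s ∧
      delayCutoff σv σe s ≤ x1} := by
    intro s hs
    have h := hE.informed_optimal.le s (.trade .buy .exchange)
    have h' := hE.informed_optimal.le s .noTrade
    rw [show E.hI s = _ from hs] at h h'
    simp only [informedPayoff, informedUnitPayoff_buy_darkPool,
      informedUnitPayoff_buy_exchange] at h h'
    have h2 : delayCutoff σv σe s - E.A / σv ≤ S * delayCutoff σv σe s - D :=
      le_of_mul_le_mul_left (by rw [mul_sub σv _ (E.A / σv), eA]; exact h) hσv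
    have h3 : 0 ≤ S * delayCutoff σv σe s - D := nonneg_of_mul_nonneg_right h' hσv
    constructor
    · rw [hx0, div_le_iff₀ hS0]; linarith
    · rw [hx1, le_div_iff₀ hS1]; linarith
  have hx01 : x0 < x1 := by
    by_contra hcon
    push Not at hcon
    -- If x1 ≤ x0, pool buyers have at most one value of x, hence at most one signal. This
    -- contradicts their positive measure.
    refine v2 (measure_mono_null hsub (Set.Subsingleton.measure_zero (fun s hs t ht => ?_) _))
    refine hmono.injective (le_antisymm ?_ ?_)
    · exact (hs.2.trans hcon).trans ht.1
    · exact (ht.2.trans hcon).trans hs.1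
  obtain ⟨s0, e0⟩ := exists_delayCutoff_eq hσv hσe (x := x0) (by linarith) (hx01.trans hx1lt)
  obtain ⟨s1, e1⟩ := exists_delayCutoff_eq hσv hσe (x := x1) (by linarith) hx1lt
  refine ⟨s0, s1, ?_, ?_, ?_, ?_⟩
  · rw [← hmono.lt_iff_lt, delayCutoff_zero hσe, e0]
    exact hx0p
  · rw [← hmono.lt_iff_lt, e0, e1]
    exact hx01
  · rw [e0, hx0, mul_div_cancel₀ _ hS0.ne', sub_self]
  · rw [e1]
    have h : x1 * (1 - S) = E.A / σv - D := div_mul_cancel₀ _ hS1.ne'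
    have h2 : x1 - E.A / σv = S * x1 - D := by linarith
    rw [← h2, mul_sub, eA]

end IsEquilibrium


end

/-! ### Equilibrium strategies and participation are those of the cut-offs -/

section

variable {M : Market Ω} {σv σe : ℝ} {E : Candidate}

/-- Slopes 1 > S > 0 make every comparison strict away from the cut-offs, which leaves a single
optimal action there. -/
theorem linear_payoff_comparison_strict {S D a x0 x1 p : ℝ} (hσv : 0 < σv) (hS0 : 0 < S)
    (hS1 : S < 1) (hx : x0 ≤ x1) (hi0 : S * x0 - D = 0)
    (hi1 : σv * x1 - a = σv * (S * x1 - D)) :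
    (x1 < p → σv * (S * p - D) < σv * p - a ∧ 0 < σv * p - a) ∧
    (x0 < p → p < x1 → σv * p - a < σv * (S * p - D) ∧ 0 < σv * (S * p - D)) ∧
    (p < x0 → σv * p - a < 0 ∧ σv * (S * p - D) < 0) := by
  have e1 : σv * p - a - σv * (S * p - D) = σv * ((1 - S) * (p - x1)) := by linarith
  have e2 : σv * (S * p - D) = σv * (S * (p - x0)) := by
    rw [show D = S * x0 by linarith]; ring
  have hS : 0 < 1 - S := by linarith
  refine ⟨fun h => ?_, fun h h' => ?_, fun h => ?_⟩
  · have h1 := mul_pos hσv (mul_pos hS (sub_pos.2 h))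
    have h2 := mul_pos hσv (mul_pos hS0 (sub_pos.2 (hx.trans_lt h)))
    constructor <;> linarith
  · have h1 := mul_pos hσv (mul_pos hS (sub_pos.2 h'))
    have h2 := mul_pos hσv (mul_pos hS0 (sub_pos.2 h))
    constructor <;> linarith
  · have h1 := mul_pos hσv (mul_pos hS (sub_pos.2 (h.trans_le hx)))
    have h2 := mul_pos hσv (mul_pos hS0 (sub_pos.2 h))
    constructor <;> linarith

namespace IsEquilibrium

theorem informed_eq_cutoff (hE : IsEquilibrium M σv σe E) (hM : M.Admissible) (hσv : 0 < σv)
    (hσe : 0 < σe) {s0 s1 : ℝ} (h0 : 0 < s0) (h1 : s0 < s1)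
    (hi0 : (E.Rwrong + E.Rright) / 2 * delayCutoff σv σe s0 - (E.Rwrong - E.Rright) / 2 = 0)
    (hi1 : σv * delayCutoff σv σe s1 - E.A
      = σv * ((E.Rwrong + E.Rright) / 2 * delayCutoff σv σe s1 - (E.Rwrong - E.Rright) / 2))
    {s : ℝ} (hs0 : |s| ≠ s0) (hs1 : |s| ≠ s1) : E.hI s = informedCutoff s0 s1 s := by
  obtain ⟨hS, hr0, hW1⟩ := hE.one_le_rates hM hσv hσe
  obtain ⟨hlt, -, -, -⟩ := hE.venues_active hM hσv hσe
  have hmono := strictMono_delayCutoff hσv hσe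
  obtain ⟨l1, l2, l3⟩ := linear_payoff_comparison_strict (p := delayCutoff σv σe |s|) hσv
    (show 0 < (E.Rwrong + E.Rright) / 2 by linarith) (by linarith) (hmono h1).le hi0 hi1
  have ue := fun dir => informedUnitPayoff_exchange_le hσv hσe E dir s
  have ud := fun dir => informedUnitPayoff_darkPool_le hσv hσe E (by linarith) dir s
  have hdir : ∀ b, b ≠ informedCutoff s0 s1 s → b = E.hI s →
      informedPayoff σv σe E s b < informedPayoff σv σe E s (informedCutoff s0 s1 s) := by
    intro b hb _
    -- The affine comparison excludes the wrong venue, and this excludes the wrong direction within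
    -- the right venue.
    have sell : ∀ q, 0 < q → σv * -q - E.A < σv * q - E.A ∧ σv * ((E.Rwrong + E.Rright) / 2 * -q
        - (E.Rwrong - E.Rright) / 2) < σv * ((E.Rwrong + E.Rright) / 2 * q
        - (E.Rwrong - E.Rright) / 2) := by
      intro q hq
      have h2 := mul_pos hσv hq
      have h3 := mul_pos hσv (mul_pos (show 0 < (E.Rwrong + E.Rright) / 2 by linarith) hq)
      constructor <;> linarith
    rcases informedPayoff_cutoff (σv := σv) hσe E h0 h1 s with ⟨c, e⟩ | ⟨c, c', e⟩ | ⟨c, e⟩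
    · obtain ⟨m1, m2⟩ := l1 (hmono (lt_of_le_of_ne c hs1.symm))
      rw [e]
      rcases b with ⟨dir, _ | _⟩ | _
      · have hp := sell _ (delayCutoff_pos hσv hσe (h0.trans (h1.trans_le c)))
        rcases abs_choice s with hs | hs
        · rw [informedCutoff, if_pos (by rwa [hs] at c)] at hb
          rcases dir
          · exact absurd rfl hb
          · rw [hs] at hp ⊢
            rw [informedPayoff, informedUnitPayoff_sell_exchange]
            exact hp.1
        · rw [hs] at c hp ⊢
          rw [informedCutoff, if_neg (by linarith), if_neg (by grind), if_neg (by grind),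
            if_pos (by grind)] at hb
          rcases dir
          · rw [delayCutoff_neg hσe] at hp ⊢
            rw [neg_neg] at hp
            rw [informedPayoff, informedUnitPayoff_buy_exchange]
            exact hp.1
          · exact absurd rfl hb
      · exact (ud dir).trans_lt m1
      · exact m2
    · obtain ⟨m1, m2⟩ := l2 (hmono (lt_of_le_of_ne c hs0.symm)) (hmono (lt_of_le_of_ne c' hs1))
      rw [e]
      rcases b with ⟨dir, _ | _⟩ | _
      · exact (ue dir).trans_lt m1
      · have hp := sell _ (delayCutoff_pos hσv hσe (h0.trans_le c))
        rcases abs_choice s with hs | hs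
        · rw [hs] at c c' hs1 hp ⊢
          rw [informedCutoff, if_neg (by grind), if_pos (by grind)] at hb
          rcases dir
          · exact absurd rfl hb
          · rw [informedPayoff, informedUnitPayoff_sell_darkPool]
            exact hp.2
        · rw [hs] at c c' hs0 hs1 hp ⊢
          rw [informedCutoff, if_neg (by linarith), if_neg (by grind), if_pos (by grind)] at hb
          rcases dir
          · rw [delayCutoff_neg hσe] at hp ⊢
            rw [neg_neg] at hp
            rw [informedPayoff, informedUnitPayoff_buy_darkPool]
            exact hp.2
          · exact absurd rfl hb
      · exact m2
    · obtain ⟨m1, m2⟩ := l3 (hmono (lt_of_le_of_ne c hs0))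
      rw [e]
      rcases b with ⟨dir, _ | _⟩ | _
      · exact (ue dir).trans_lt m1
      · exact (ud dir).trans_lt m2
      · obtain ⟨c1, c2⟩ := abs_le.1 c
        have c3 : s ≠ s0 := by
          rintro rfl
          exact hs0 (abs_of_pos h0)
        rw [informedCutoff, if_neg (by linarith), if_neg (by grind), if_neg (by grind),
          if_neg (by linarith)] at hb
        exact absurd rfl hb
  exact hE.informed_optimal.eq_of_lt hdir

/-- The informed comparison applies verbatim with d in place of x, and no direction has to be
chosen. -/
theorem liquidity_eq_cutoff (hE : IsEquilibrium M σv σe E) (hM : M.Admissible) (hσv : 0 < σv)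
    (hσe : 0 < σe) {s0 s1 : ℝ} (h1 : s0 < s1)
    (hi0 : (E.Rwrong + E.Rright) / 2 * delayCutoff σv σe s0 - (E.Rwrong - E.Rright) / 2 = 0)
    (hi1 : σv * delayCutoff σv σe s1 - E.A
      = σv * ((E.Rwrong + E.Rright) / 2 * delayCutoff σv σe s1 - (E.Rwrong - E.Rright) / 2))
    (side : Side) {d : ℝ} (hd : d ∈ Icc 0 M.dBar) (hd0 : d ≠ delayCutoff σv σe s0)
    (hd1 : d ≠ delayCutoff σv σe s1) : E.hU side d = liquidityCutoff σv σe s0 s1 d := by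
  obtain ⟨hS, hr0, hW1⟩ := hE.one_le_rates hM hσv hσe
  obtain ⟨hlt, -, -, -⟩ := hE.venues_active hM hσv hσe
  have hmono := strictMono_delayCutoff hσv hσe
  obtain ⟨l1, l2, l3⟩ := linear_payoff_comparison_strict (p := d) hσv
    (show 0 < (E.Rwrong + E.Rright) / 2 by linarith) (by linarith) (hmono h1).le hi0 hi1
  have ud := liquidityPayoff_darkPool (σv := σv) E d
  have ue : liquidityPayoff σv E d (.trade .exchange) = -E.A := rfl
  have u0 : liquidityPayoff σv E d .delay = -(σv * d) := rfl
  refine hE.liquidity_optimal.eq_of_lt side hd fun b hb _ => ?_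
  unfold liquidityCutoff at hb ⊢
  split_ifs at hb ⊢ with c1 c2
  · obtain ⟨m1, m2⟩ := l1 (lt_of_le_of_ne c1 hd1.symm)
    rcases b with ⟨_ | _⟩ | _
    · exact absurd rfl hb
    · rw [ue, ud]; linarith
    · rw [ue, u0]; linarith
  · obtain ⟨m1, m2⟩ := l2 (lt_of_le_of_ne c2.1 hd0.symm) c2.2
    rcases b with ⟨_ | _⟩ | _
    · rw [ue, ud]; linarith
    · exact absurd rfl hb
    · rw [u0, ud]; linarith
  · obtain ⟨m1, m2⟩ := l3 (by
      by_contra h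
      exact c2 ⟨not_lt.1 h, not_le.1 c1⟩)
    rcases b with ⟨_ | _⟩ | _
    · rw [ue, u0]; linarith
    · rw [u0, ud]; linarith
    · exact absurd rfl hb

end IsEquilibrium

/-- Strategies that follow cut-offs generate the participation of the cut-off strategies. -/
theorem FractionsConsistent.eq_of_followsCutoffs (hF : FractionsConsistent M σv σe E)
    (hM : M.Admissible) (hσv : 0 < σv) (hσe : 0 < σe) {s0 s1 : ℝ} (h0 : 0 < s0) (h1 : s0 < s1)
    (hC : FollowsCutoffs M σv σe E s0 s1) :
    E.gammaEright = cutGammaEright σv σe s1 ∧ E.gammaEwrong = cutGammaEwrong σv σe s1 ∧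
    E.gammaDright = cutGammaDright σv σe s0 s1 ∧ E.gammaDwrong = cutGammaDwrong σv σe s0 s1 ∧
    E.alphaE = cutAlphaE M σv σe s1 ∧ E.alphaD = cutAlphaD M σv σe s0 s1 := by
  have hF' := fractionsConsistent_cutoffCandidate hM hσv hσe h0 h1
  have hI : ∀ (v : ℝ) (a : InformedAction), (signalLaw σe v).real {s | E.hI s = a}
      = (signalLaw σe v).real {s | informedCutoff s0 s1 s = a} := by
    intro v a
    have hne : ∀ t : ℝ, ∀ᵐ u ∂(volume : Measure ℝ), u ≠ t := fun t => by simp [ae_iff]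
    refine signalLaw_real_congr hσe v (eventuallyEq_set.2 ?_)
    filter_upwards [hne s0, hne s1, hne (-s0), hne (-s1)] with s c1 c2 c3 c4
    have h : E.hI s = informedCutoff s0 s1 s := hC.1 s
      (fun h => by rcases abs_choice s with hs | hs <;> grind)
      (fun h => by rcases abs_choice s with hs | hs <;> grind)
    rw [h]
  have hU : ∀ a : LiquidityAction, M.nu.real {d | E.hU .buyer d = a}
      = M.nu.real {d | liquidityCutoff σv σe s0 s1 d = a} := by
    intro a
    have := hM.nullSingletonClass_nu
    have hne : ∀ t : ℝ, ∀ᵐ u ∂M.nu, u ≠ t := fun t => by simp [ae_iff]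
    have hsupp : ∀ᵐ d ∂M.nu, d ∈ Icc 0 M.dBar := by
      rw [ae_iff]
      exact hM.nu_support
    refine measureReal_congr (eventuallyEq_set.2 ?_)
    filter_upwards [hne (delayCutoff σv σe s0), hne (delayCutoff σv σe s1), hsupp] with d c1 c2 c3
    have h := hC.2 .buyer d c3 c1 c2
    rw [h]
  exact ⟨hF.eright_high.symm.trans ((hI _ _).trans hF'.eright_high),
    hF.ewrong_high.symm.trans ((hI _ _).trans hF'.ewrong_high),
    hF.dright_high.symm.trans ((hI _ _).trans hF'.dright_high),
    hF.dwrong_high.symm.trans ((hI _ _).trans hF'.dwrong_high),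
    (hF.alphaE_eq .buyer).symm.trans ((hU _).trans (hF'.alphaE_eq .buyer)),
    (hF.alphaD_eq .buyer).symm.trans ((hU _).trans (hF'.alphaD_eq .buyer))⟩

theorem IsEquilibrium.isCutoff (hE : IsEquilibrium M σv σe E) (hM : M.Admissible) (hσv : 0 < σv)
    (hσe : 0 < σe) : (∃ s0 s1 : ℝ, FollowsCutoffs M σv σe E s0 s1 ∧ CutoffSystem M σv σe E s0 s1) ∧
      NonTrivial E := by
  obtain ⟨s0, s1, h0, h1, hi0, hi1⟩ := hE.exists_indifferent hM hσv hσe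
  have hC : FollowsCutoffs M σv σe E s0 s1 :=
    ⟨fun s c0 c1 => hE.informed_eq_cutoff hM hσv hσe h0 h1 hi0 hi1 c0 c1,
      fun side d hd c0 c1 => hE.liquidity_eq_cutoff hM hσv hσe h1 hi0 hi1 side hd c0 c1⟩
  obtain ⟨e1, e2, e3, e4, e5, e6⟩ := hE.fractions.eq_of_followsCutoffs hM hσv hσe h0 h1 hC
  obtain ⟨hW, hR⟩ := hE.rates_eq hM hσv hσe
  have hA : E.A = cutSpread M σv σe s1 * σv := by
    have h := spread_of_breakEven hM hE.break_even.1
      (by rw [e1, e2, e5]; exact cutSpread_denom_pos hM hσe s1)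
    rw [e1, e2, e5] at h
    exact h
  refine ⟨⟨s0, s1, hC, cutoffSystem_of_indifferent hM hσv hσe h0 h1 hi0 hi1 e1 e2 e3 e4 e5 e6 hA
    hW hR⟩, ?_⟩
  have hpos := sub_pos.2 h1
  rw [NonTrivial, e1, e2, e3, e4, e5, e6]
  refine ⟨cutGammaEright_pos hσe s1, cutGammaEwrong_pos hσe s1, ?_, ?_, cutAlphaE_pos hM hσe s1, ?_⟩
  · rw [cutGammaDright_eq hσe h1.le]
    exact mul_pos hpos (meanDensity_pos hσe _ _ _)
  · rw [cutGammaDwrong_eq hσe h1.le]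
    exact mul_pos hpos (meanDensity_pos hσe _ _ _)
  · rw [cutAlphaD_eq hM hσv hσe h0.le h1.le]
    exact mul_pos hpos (meanLiquidity_pos hM hσv hσe h0.le (h0.trans h1))


end

end DarkPool

end

theorem mainTheorem2 {Ω : Type*} [MeasurableSpace Ω] (M : DarkPool.Market Ω) (hM : M.Admissible)
    (σv σe : ℝ) (hσv : 0 < σv) (hσe : 0 < σe) :
    (∃ (E : DarkPool.Candidate) (s0 s1 : ℝ),
      DarkPool.IsEquilibrium M σv σe E ∧
      (∀ s : ℝ, E.hI s = DarkPool.informedCutoff s0 s1 s) ∧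
      (∀ (side : DarkPool.Side) (d : ℝ), E.hU side d = DarkPool.liquidityCutoff σv σe s0 s1 d) ∧
      DarkPool.CutoffSystem M σv σe E s0 s1) ∧
    (∀ E : DarkPool.Candidate, DarkPool.IsEquilibrium M σv σe E →
      (∃ s0 s1 : ℝ, DarkPool.FollowsCutoffs M σv σe E s0 s1 ∧
        DarkPool.CutoffSystem M σv σe E s0 s1) ∧
      DarkPool.NonTrivial E) :=
  ⟨DarkPool.exists_equilibrium hM hσv hσe, fun _ hE => hE.isCutoff hM hσv hσe⟩
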